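/- **Setting.** Let $\mathfrak h$ be a real separable Hilbert space with complexification $\mathfrak h_{\mathbb C}$ (inner products antilinear in the first variable) and $\mathfrak H=\bigoplus_n\mathfrak h_{\mathbb C}^{\odot n}$ the symmetric Fock space, with exponential vectors $\mathcal E(k)=\sum_n k^{\otimes n}/\sqrt{n!}$, creation and annihilation operators $a^+(h),a(h)$, $Q(h)=a(\bar h)+a^+(h)$, $P(h)=i(a(\bar h)-a^+(h))$, and Weyl operators $U(h_1,h_2)=\exp(iP(h_1)+iQ(h_2))$ for $h_1,h_2\in\mathfrak h$. An expression $\sum_jX_jB_jY_j$, with $B_j\in\mathcal B(\mathfrak H)$ and $X_j,Y_j$ linear operators on $\mathrm{span}\,\mathcal E(\mathfrak h_{\mathbb C})$ having adjoints $X_j^*,Y_j^*$ defined there, *has matrix elements* $\sum_j\langle X_j^*\mathcal E(f),B_jY_j\mathcal E(g)\rangle$ $(f,g\in\mathfrak h_{\mathbb C})$, and *defines a bounded operator* if these are the matrix elements $\langle\mathcal E(f),M\mathcal E(g)\rangle$ of some (necessarily unique) $M\in\mathcal B(\mathfrak H)$, with which it is then identified. For $h\in\mathfrak h\otimes\mathbb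 R^2$, i.e. $h=(h_1,h_2)$ with $h_1,h_2\in\mathfrak h$, and $\varphi:\mathbb R^2\to\mathbb C$, let $O_h(\varphi)$ be the bounded operator $M$, if it exists, with $$\langle\mathcal E(k_1),M\mathcal E(k_2)\rangle=\frac1{2\pi}\int_{\mathbb R^2}\langle\mathcal E(k_1),U(sh_1,th_2)\mathcal E(k_2)\rangle\,(\mathcal F^{-1}\varphi)(s,t)\,ds\,dt\qquad(k_1,k_2\in\mathfrak h_{\mathbb C}),$$ where $\mathcal F^{-1}\varphi(s,t)=\frac1{2\pi}\int\varphi(x,y)e^{-i(sx+ty)}dx\,dy$ in the sense of distributions, i.e. the right hand side means $\int\varphi\,d\mu$ (absolutely convergent) for the complex measure $\mu$ with $\int e^{i(sx+ty)}d\mu(x,y)=\langle\mathcal E(k_1),U(sh_1,th_2)\mathcal E(k_2)\rangle$. Let $\mathcal S$ be the algebra generated by the $O_h(\varphi)$, $h\in\mathfrak h\otimes\mathbb R^2$, with $\varphi\in C^\infty(\mathbb R^2)$ such that $O_h$ is defined on all partial derivatives of $\varphi$ (including $\varphi$), and let $D:\mathcal S\to\mathcal B(\mathfrak H)\otimes\mathfrak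 h_{\mathbb C}\otimes\mathbb C^2$ be the derivation with $DO_h(\varphi)=\big(O_h(\partial_x\varphi)\otimes h_1,\;O_h(\partial_y\varphi)\otimes h_2\big)$. On $\mathcal B(\mathfrak H)\otimes\mathfrak h_{\mathbb C}\otimes\mathbb C^2$ put $O(A\otimes k)=OA\otimes k$, $(A\otimes k)O=AO\otimes k$, $\overline{A\otimes k}=A^*\otimes\bar k$ and $\langle A\otimes k,A'\otimes k'\rangle=\langle k,k'\rangle A^*A'$, and identify $k$ with $\mathrm{id}\otimes k$. For $G\in\mathcal S$ and $u\in\mathcal B(\mathfrak H)\otimes\mathfrak h_{\mathbb C}\otimes\mathbb C^2$ put $\overrightarrow D_uG=\langle\bar u,DG\rangle$ and $G\overleftarrow D_u=\langle\overline{DG},u\rangle$. For $k=(k_1,k_2)\in\mathfrak h_{\mathbb C}\otimes\mathbb C^2$ write $T_k=P(k_1)+Q(k_2)$. Let $D_kB=\frac i2[Q(k_1)-P(k_2),B]$, with $\mathrm{Dom}\,D_k$ the set of $B\in\mathcal B(\mathfrak H)$ for which this defines a bounded operator. Let $\mathcal S_{\mathfrak h}$ be the set of finite sums $u=\sum_jF_j\otimes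 h^{(j)}$ with $F_j\in\mathcal S$, $h^{(j)}\in\mathfrak h_{\mathbb C}\otimes\mathbb C^2$. The divergence expression of $u$ is $\delta(u)=\frac12\sum_j\{T_{h^{(j)}},F_j\}-\sum_jD_{h^{(j)}}F_j$; $\mathcal S_{\mathfrak h,\delta}$ is the set of $u\in\mathcal S_{\mathfrak h}$ for which it defines a bounded operator. For $u\in\mathcal S_{\mathfrak h}$, $D_ku=\sum_j(D_kF_j)\otimes h^{(j)}$. **Proposition.** Let $u=\sum_{j=1}^nF_j\otimes h^{(j)}\in\mathcal S_{\mathfrak h,\delta}$ with $F_j\in\mathcal S$, $h^{(j)}\in\mathfrak h_{\mathbb C}\otimes\mathbb C^2$. 1. For every $h\in\mathfrak h_{\mathbb C}\otimes\mathbb C^2$: $F_j\in\mathrm{Dom}\,D_h$ for all $j$, $D_hu\in\mathcal S_{\mathfrak h}$, and the relation $$D_h\delta(u)=\langle\bar h,u\rangle+\delta(D_hu)$$ holds between the matrix elements, for all pairs of exponential vectors, of the expressions on the two sides. Moreover $\delta(u)\in\mathrm{Dom}\,D_h$ if and only if $D_hu\in\mathcal S_{\mathfrak h,\delta}$, and in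 this case the relation is an equality of bounded operators. 2. For every $G\in\mathcal S$: the commutators $[T_{h^{(j)}},G]$ define bounded operators, $Gu$ and $uG$ lie in $\mathcal S_{\mathfrak h,\delta}$, and $$\delta(Gu)=G\delta(u)-G\overleftarrow D_u+\tfrac12\sum_{j=1}^n[T_{h^{(j)}},G]\,F_j,\qquad \delta(uG)=\delta(u)G-\overrightarrow D_uG+\tfrac12\sum_{j=1}^nF_j\,[G,T_{h^{(j)}}].$$ 3. If $G\in\mathcal B(\mathfrak H)$ commutes with every $T_{h^{(j)}}$ (the matrix elements of $[T_{h^{(j)}},G]$ between exponential vectors vanish), then both correction sums in 2 vanish. Hence, if moreover $G\in\mathcal S$, then $\delta(Gu)=G\delta(u)-G\overleftarrow D_u$ and $\delta(uG)=\delta(u)G-\overrightarrow D_uG$. -/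

import Mathlib

open scoped TensorProduct ContDiff

set_option linter.unusedSectionVars false

noncomputable section

namespace QuantumMalliavin

universe u

/-! ### The complexification of a real Hilbert space -/

/-- The complexification `𝔥_ℂ = 𝔥 ⊕ i𝔥` of a real inner product space; the pair `(a, b)` stands
for `a + i b`. -/
def Complexification (𝔥 : Type u) : Type u := WithLp 2 (𝔥 × 𝔥)

namespace Complexification

variable {𝔥 : Type u} [NormedAddCommGroup 𝔥] [InnerProductSpace ℝ 𝔥]

instance instNormedAddCommGroup : NormedAddCommGroup (Complexification 𝔥) :=
  inferInstanceAs (NormedAddCommGroup (WithLp 2 (𝔥 × 𝔥)))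

instance instCompleteSpace [CompleteSpace 𝔥] : CompleteSpace (Complexification 𝔥) :=
  inferInstanceAs (CompleteSpace (WithLp 2 (𝔥 × 𝔥)))

/-- The element `a + i b`. -/
def mk (a b : 𝔥) : Complexification 𝔥 := WithLp.toLp 2 (a, b)

/-- The real part of `a + i b`. -/
def re (x : Complexification 𝔥) : 𝔥 := WithLp.fst x

/-- The imaginary part of `a + i b`. -/
def im (x : Complexification 𝔥) : 𝔥 := WithLp.snd x

@[simp] theorem re_mk (a b : 𝔥) : (mk a b).re = a := rfl

@[simp] theorem im_mk (a b : 𝔥) : (mk a b).im = b := rfl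

@[simp] theorem re_add (x y : Complexification 𝔥) : (x + y).re = x.re + y.re := rfl

@[simp] theorem im_add (x y : Complexification 𝔥) : (x + y).im = x.im + y.im := rfl

@[simp] theorem re_zero : (0 : Complexification 𝔥).re = 0 := rfl

@[simp] theorem im_zero : (0 : Complexification 𝔥).im = 0 := rfl

theorem ext' {x y : Complexification 𝔥} (h₁ : x.re = y.re) (h₂ : x.im = y.im) : x = y :=
  (WithLp.equiv 2 (𝔥 × 𝔥)).injective (Prod.ext h₁ h₂)

theorem norm_sq (x : Complexification 𝔥) : ‖x‖ ^ 2 = ‖x.re‖ ^ 2 + ‖x.im‖ ^ 2 :=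
  WithLp.prod_norm_sq_eq_of_L2 (α := 𝔥) (β := 𝔥) x

instance instSMul : SMul ℂ (Complexification 𝔥) where
  smul c x := mk (c.re • x.re - c.im • x.im) (c.re • x.im + c.im • x.re)

@[simp] theorem re_smul (c : ℂ) (x : Complexification 𝔥) :
    (c • x).re = c.re • x.re - c.im • x.im := rfl

@[simp] theorem im_smul (c : ℂ) (x : Complexification 𝔥) :
    (c • x).im = c.re • x.im + c.im • x.re := rfl

instance instModule : Module ℂ (Complexification 𝔥) where
  one_smul x := ext' (by simp) (by simp)
  mul_smul c d x := ext' (by simp; module) (by simp; module)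
  smul_zero c := ext' (by simp) (by simp)
  smul_add c x y := ext' (by simp; module) (by simp; module)
  add_smul c d x := ext' (by simp; module) (by simp; module)
  zero_smul x := ext' (by simp) (by simp)

theorem norm_sq_smul (c : ℂ) (x : Complexification 𝔥) : ‖c • x‖ ^ 2 = (‖c‖ * ‖x‖) ^ 2 := by
  rw [norm_sq, mul_pow, norm_sq x, Complex.sq_norm, Complex.normSq_apply, re_smul, im_smul,
    @norm_sub_sq_real, @norm_add_sq_real]
  simp only [norm_smul, inner_smul_left, inner_smul_right, mul_pow, Real.norm_eq_abs, sq_abs,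
    real_inner_comm x.re x.im]
  simp
  ring

instance instNormedSpace : NormedSpace ℂ (Complexification 𝔥) where
  norm_smul_le c x := by
    have h := norm_sq_smul c x
    rw [sq_eq_sq₀ (norm_nonneg _) (by positivity)] at h
    exact h.le

/-- The inner product is the sesquilinear extension of the one of `𝔥`, antilinear in the first
variable: `⟪a + i b, c + i d⟫ = ⟪a, c⟫ + ⟪b, d⟫ + i (⟪a, d⟫ - ⟪b, c⟫)`. -/
instance instInnerProductSpace : InnerProductSpace ℂ (Complexification 𝔥) where
  inner x y := ⟨inner ℝ x.re y.re + inner ℝ x.im y.im, inner ℝ x.re y.im - inner ℝ x.im y.re⟩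
  norm_sq_eq_re_inner x := by
    rw [norm_sq]
    simp
  conj_inner_symm x y := by
    apply Complex.ext
    · simp [real_inner_comm]
    · simp [real_inner_comm]
  add_left x y z := by
    apply Complex.ext
    · simp [inner_add_left]; ring
    · simp [inner_add_left]; ring
  smul_left x y c := by
    apply Complex.ext
    · simp [inner_add_left, inner_sub_left, inner_smul_left]; ring
    · simp [inner_add_left, inner_sub_left, inner_smul_left]; ring

/-- The conjugation `a + i b ↦ a - i b`. -/
def conj (x : Complexification 𝔥) : Complexification 𝔥 := mk x.re (-x.im)

/-- The embedding of `𝔥` as the real elements of `𝔥_ℂ`. -/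
def ofReal (a : 𝔥) : Complexification 𝔥 := mk a 0

theorem conj_add (x y : Complexification 𝔥) : conj (x + y) = conj x + conj y :=
  ext' rfl (neg_add _ _)

theorem conj_smul (c : ℂ) (x : Complexification 𝔥) :
    conj (c • x) = (starRingEnd ℂ) c • conj x :=
  ext' (by simp [conj]) (by simp [conj]; abel)

end Complexification

/-! ### Hilbert space tensor powers and symmetric tensors -/

/-- A bundled complex Hilbert space, used for the recursive construction of tensor powers. -/
structure HilbertBundle : Type (u + 1) where
  carrier : Type u
  [group : NormedAddCommGroup carrier]
  [space : InnerProductSpace ℂ carrier]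
  [complete : CompleteSpace carrier]

attribute [instance] HilbertBundle.group HilbertBundle.space HilbertBundle.complete

section TensorPowers

variable (V : Type u) [NormedAddCommGroup V] [InnerProductSpace ℂ V]

/-- `V^{⊗0} = ℂ` (realized as the one-dimensional Euclidean space) and `V^{⊗(n+1)}` is the
completion of `V ⊗ V^{⊗n}`. -/
def tensorPowerBundle : ℕ → HilbertBundle.{u}
  | 0 => ⟨EuclideanSpace ℂ PUnit.{u + 1}⟩
  | n + 1 => ⟨UniformSpace.Completion (V ⊗[ℂ] (tensorPowerBundle n).carrier)⟩

/-- The Hilbert space tensor power `V^{⊗n}`. -/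
abbrev HilbertTensorPower (n : ℕ) : Type u := (tensorPowerBundle V n).carrier

variable {V}

/-- The map `x ↦ v ⊗ x` from `V^{⊗n}` to `V^{⊗(n+1)}`. -/
def tensorLeft (n : ℕ) (v : V) : HilbertTensorPower V n →L[ℂ] HilbertTensorPower V (n + 1) :=
  (UniformSpace.Completion.toComplL :
      V ⊗[ℂ] HilbertTensorPower V n →L[ℂ] UniformSpace.Completion (V ⊗[ℂ] HilbertTensorPower V n)) ∘L
    (TensorProduct.mk ℂ V (HilbertTensorPower V n) v).mkContinuous ‖v‖
      (fun x => (TensorProduct.norm_tmul v x).le)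

theorem norm_tensorLeft_apply (n : ℕ) (v : V) (x : HilbertTensorPower V n) :
    ‖tensorLeft n v x‖ = ‖v‖ * ‖x‖ := by
  have h : ‖((v ⊗ₜ[ℂ] x : V ⊗[ℂ] HilbertTensorPower V n) :
      UniformSpace.Completion (V ⊗[ℂ] HilbertTensorPower V n))‖ = ‖v‖ * ‖x‖ := by
    rw [UniformSpace.Completion.norm_coe, TensorProduct.norm_tmul]
  exact h

/-- The elementary tensor `v 0 ⊗ ⋯ ⊗ v (n-1)`. -/
def elemTensor : (n : ℕ) → (Fin n → V) → HilbertTensorPower V n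
  | 0, _ => EuclideanSpace.single PUnit.unit (1 : ℂ)
  | n + 1, v => tensorLeft n (v 0) (elemTensor n (Fin.tail v))

theorem norm_elemTensor_const (n : ℕ) (k : V) : ‖elemTensor n (fun _ => k)‖ = ‖k‖ ^ n := by
  induction n with
  | zero => exact (PiLp.norm_single 2 (fun _ => ℂ) _ _).trans (by simp)
  | succ n ih =>
    have : elemTensor (n + 1) (fun _ => k) = tensorLeft n k (elemTensor n (fun _ => k)) := rfl
    rw [this, norm_tensorLeft_apply, ih, pow_succ']

/-- The symmetric product `v 0 ⊙ ⋯ ⊙ v (n-1)`, the symmetrization of the elementary tensor. -/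
def symProduct (n : ℕ) (v : Fin n → V) : HilbertTensorPower V n :=
  ((n.factorial : ℂ)⁻¹) • ∑ σ : Equiv.Perm (Fin n), elemTensor n (v ∘ σ)

theorem symProduct_const (n : ℕ) (k : V) :
    symProduct n (fun _ => k) = elemTensor n (fun _ => k) := by
  have h : ∀ σ : Equiv.Perm (Fin n), (fun _ : Fin n => k) ∘ σ = fun _ => k := fun _ => rfl
  simp only [symProduct, h, Finset.sum_const, Finset.card_univ, Fintype.card_perm,
    Fintype.card_fin]
  rw [← Nat.cast_smul_eq_nsmul ℂ, smul_smul,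
    inv_mul_cancel₀ (by exact_mod_cast Nat.factorial_ne_zero n), one_smul]

variable (V)

/-- The closed subspace of `V^{⊗n}` generated by the symmetric products. -/
def symSubspace (n : ℕ) : Submodule ℂ (HilbertTensorPower V n) :=
  (Submodule.span ℂ (Set.range (symProduct (V := V) n))).topologicalClosure

instance instCompleteSymSubspace (n : ℕ) : CompleteSpace (symSubspace V n) :=
  Submodule.topologicalClosure.completeSpace _

/-- The symmetric tensor power `V^{⊙n}`. -/
abbrev SymPower (n : ℕ) : Type u := symSubspace V n

variable {V}

/-- The `n`-fold power `k ⊗ ⋯ ⊗ k` as a symmetric tensor. -/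
def symPow (n : ℕ) (k : V) : SymPower V n :=
  ⟨elemTensor n (fun _ => k), by
    rw [← symProduct_const]
    exact Submodule.le_topologicalClosure _ (Submodule.subset_span ⟨_, rfl⟩)⟩

theorem norm_symPow (n : ℕ) (k : V) : ‖symPow n k‖ = ‖k‖ ^ n := norm_elemTensor_const n k

/-- The `n`-particle part `ψ ↦ √(n+1) • (h ⊙ ψ)` of the creation operator; `h ⊙ ψ` is the orthogonal
projection of `h ⊗ ψ` to the symmetric tensors. -/
def createLevel (n : ℕ) (h : V) : SymPower V n →L[ℂ] SymPower V (n + 1) :=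
  ((Real.sqrt (n + 1) : ℝ) : ℂ) •
    ((symSubspace V (n + 1)).orthogonalProjectionOnto ∘L tensorLeft n h ∘L (symSubspace V n).subtypeL)

/-- The part of the annihilation operator that maps `n+1` particles to `n` particles. -/
def annihilateLevel (n : ℕ) (h : V) : SymPower V (n + 1) →L[ℂ] SymPower V n :=
  ContinuousLinearMap.adjoint (createLevel n h)

theorem norm_createLevel_le (n : ℕ) (h : V) : ‖createLevel n h‖ ≤ Real.sqrt (n + 1) * ‖h‖ := by
  refine ContinuousLinearMap.opNorm_le_bound _ (by positivity) fun x => ?_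
  have h1 : ‖(symSubspace V (n + 1)).orthogonalProjectionOnto (tensorLeft n h (x : HilbertTensorPower V n))‖
      ≤ ‖h‖ * ‖x‖ := by
    refine ((symSubspace V (n + 1)).norm_orthogonalProjectionOnto_apply_le _).trans ?_
    rw [norm_tensorLeft_apply]
    rfl
  have h2 : createLevel n h x = ((Real.sqrt (n + 1) : ℝ) : ℂ) •
      (symSubspace V (n + 1)).orthogonalProjectionOnto (tensorLeft n h (x : HilbertTensorPower V n)) := rfl
  rw [h2, norm_smul, Complex.norm_real, Real.norm_of_nonneg (Real.sqrt_nonneg _), mul_assoc]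
  gcongr

theorem norm_annihilateLevel_le (n : ℕ) (h : V) :
    ‖annihilateLevel n h‖ ≤ Real.sqrt (n + 1) * ‖h‖ := by
  rw [annihilateLevel, LinearIsometryEquiv.norm_map]
  exact norm_createLevel_le n h

end TensorPowers

/-! ### Fock space, exponential vectors, creation and annihilation operators -/

section Fock

variable (V : Type u) [NormedAddCommGroup V] [InnerProductSpace ℂ V]

/-- The symmetric Fock space, the Hilbert space direct sum of the symmetric tensor powers. -/
abbrev Fock : Type u := lp (fun n : ℕ => SymPower V n) 2

variable {V}

/-- The homogeneous components `k^{⊗n} / √(n!)` of the exponential vector. -/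
def expComponent (k : V) (n : ℕ) : SymPower V n :=
  (((Real.sqrt n.factorial)⁻¹ : ℝ) : ℂ) • symPow n k

theorem norm_sq_expComponent (k : V) (n : ℕ) :
    ‖expComponent k n‖ ^ 2 = (‖k‖ ^ 2) ^ n / n.factorial := by
  rw [expComponent, norm_smul, norm_symPow, mul_pow, Complex.norm_real, Real.norm_eq_abs, sq_abs,
    inv_pow, Real.sq_sqrt (by positivity), ← pow_mul, ← pow_mul, mul_comm 2 n]
  ring

theorem summable_weighted (x : ℝ) (hx : 0 ≤ x) :
    Summable fun n : ℕ => ((n : ℝ) + 1) * (x ^ n / n.factorial) := by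
  refine Summable.of_nonneg_of_le (fun n => by positivity) (fun n => ?_)
    (Real.summable_pow_div_factorial (2 * x))
  have h : ((n : ℝ) + 1) ≤ 2 ^ n := by exact_mod_cast Nat.lt_two_pow_self
  rw [mul_pow, mul_div_assoc]
  gcongr

theorem memlp_two_of_summable {G : ℕ → Type u} [∀ n, NormedAddCommGroup (G n)] (f : ∀ n, G n)
    (hf : Summable fun n => ‖f n‖ ^ 2) : Memℓp f 2 := by
  refine memℓp_gen ?_
  simpa using hf

theorem memlp_expComponent (k : V) : Memℓp (expComponent k) 2 := by
  refine memlp_two_of_summable _ ?_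
  simp only [norm_sq_expComponent]
  exact Real.summable_pow_div_factorial _

/-- The exponential vector `𝓔(k) = ∑ k^{⊗n} / √(n!)`. -/
def expVec (k : V) : Fock V := ⟨expComponent k, memlp_expComponent k⟩

/-- The components of `a⁺(h) ψ`. -/
def createComponents (h : V) (ψ : ∀ n, SymPower V n) : ∀ n, SymPower V n
  | 0 => 0
  | n + 1 => createLevel n h (ψ n)

/-- The components of `a(h) ψ`. -/
def annihilateComponents (h : V) (ψ : ∀ n, SymPower V n) (n : ℕ) : SymPower V n :=
  annihilateLevel n h (ψ (n + 1))

theorem createComponents_add (h : V) (ψ φ : ∀ n, SymPower V n) :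
    createComponents h (ψ + φ) = createComponents h ψ + createComponents h φ := by
  funext n
  cases n <;> simp [createComponents]

theorem createComponents_smul (h : V) (c : ℂ) (ψ : ∀ n, SymPower V n) :
    createComponents h (c • ψ) = c • createComponents h ψ := by
  funext n
  cases n <;> simp [createComponents]

theorem annihilateComponents_add (h : V) (ψ φ : ∀ n, SymPower V n) :
    annihilateComponents h (ψ + φ) = annihilateComponents h ψ + annihilateComponents h φ := by
  funext n
  simp [annihilateComponents]

theorem annihilateComponents_smul (h : V) (c : ℂ) (ψ : ∀ n, SymPower V n) :
    annihilateComponents h (c • ψ) = c • annihilateComponents h ψ := by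
  funext n
  simp [annihilateComponents]

/-- The creation operator `a⁺(h)`, an unbounded operator on its maximal domain. -/
def creation (h : V) : Fock V →ₗ.[ℂ] Fock V where
  domain :=
    { carrier := {ψ | Memℓp (createComponents h ψ) 2}
      add_mem' := fun {ψ φ} hψ hφ => by
        have := Memℓp.add hψ hφ
        rw [← createComponents_add] at this
        exact this
      zero_mem' := by
        have h0 : createComponents h (0 : ∀ n, SymPower V n) = 0 := by
          simpa using createComponents_smul h 0 0
        have : Memℓp (createComponents h (0 : ∀ n, SymPower V n)) 2 := by
          rw [h0]
          exact zero_memℓp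
        exact this
      smul_mem' := fun c ψ hψ => by
        have := Memℓp.const_smul hψ c
        rw [← createComponents_smul] at this
        exact this }
  toFun :=
    { toFun := fun ψ => ⟨createComponents h ψ.1, ψ.2⟩
      map_add' := fun ψ φ => Subtype.ext (createComponents_add h ψ.1 φ.1)
      map_smul' := fun c ψ => Subtype.ext (createComponents_smul h c ψ.1) }

/-- The annihilation operator `a(h)`, an unbounded operator on its maximal domain. -/
def annihilation (h : V) : Fock V →ₗ.[ℂ] Fock V where
  domain :=
    { carrier := {ψ | Memℓp (annihilateComponents h ψ) 2}
      add_mem' := fun {ψ φ} hψ hφ => by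
        have := Memℓp.add hψ hφ
        rw [← annihilateComponents_add] at this
        exact this
      zero_mem' := by
        have h0 : annihilateComponents h (0 : ∀ n, SymPower V n) = 0 := by
          simpa using annihilateComponents_smul h 0 0
        have : Memℓp (annihilateComponents h (0 : ∀ n, SymPower V n)) 2 := by
          rw [h0]
          exact zero_memℓp
        exact this
      smul_mem' := fun c ψ hψ => by
        have := Memℓp.const_smul hψ c
        rw [← annihilateComponents_smul] at this
        exact this }
  toFun :=
    { toFun := fun ψ => ⟨annihilateComponents h ψ.1, ψ.2⟩
      map_add' := fun ψ φ => Subtype.ext (annihilateComponents_add h ψ.1 φ.1)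
      map_smul' := fun c ψ => Subtype.ext (annihilateComponents_smul h c ψ.1) }

variable (V)

/-- The linear span of the exponential vectors. -/
def expSpan : Submodule ℂ (Fock V) := Submodule.span ℂ (Set.range (expVec (V := V)))

variable {V}

theorem expVec_mem_expSpan (k : V) : expVec k ∈ expSpan V := Submodule.subset_span ⟨k, rfl⟩

theorem expSpan_le_creation_domain (h : V) : expSpan V ≤ (creation h).domain := by
  refine Submodule.span_le.2 ?_
  rintro _ ⟨k, rfl⟩
  have : Memℓp (createComponents h (expComponent k)) 2 := by
    refine memlp_two_of_summable _ ?_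
    rw [← summable_nat_add_iff 1]
    refine Summable.of_nonneg_of_le (fun n => by positivity) (fun n => ?_)
      ((summable_weighted (‖k‖ ^ 2) (by positivity)).mul_left (‖h‖ ^ 2))
    have h1 : ‖createComponents h (expComponent k) (n + 1)‖ ≤
        (Real.sqrt (n + 1) * ‖h‖) * ‖expComponent k n‖ :=
      (createLevel n h).le_of_opNorm_le (norm_createLevel_le n h) _
    calc ‖createComponents h (expComponent k) (n + 1)‖ ^ 2
        ≤ ((Real.sqrt (n + 1) * ‖h‖) * ‖expComponent k n‖) ^ 2 := by gcongr
      _ = _ := by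
        rw [mul_pow, mul_pow, Real.sq_sqrt (by positivity), norm_sq_expComponent]
        ring
  exact this

theorem expSpan_le_annihilation_domain (h : V) : expSpan V ≤ (annihilation h).domain := by
  refine Submodule.span_le.2 ?_
  rintro _ ⟨k, rfl⟩
  have : Memℓp (annihilateComponents h (expComponent k)) 2 := by
    refine memlp_two_of_summable _ ?_
    refine Summable.of_nonneg_of_le (fun n => by positivity) (fun n => ?_)
      ((Real.summable_pow_div_factorial (‖k‖ ^ 2)).mul_left (‖h‖ ^ 2 * ‖k‖ ^ 2))
    have h1 : ‖annihilateComponents h (expComponent k) n‖ ≤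
        (Real.sqrt (n + 1) * ‖h‖) * ‖expComponent k (n + 1)‖ :=
      (annihilateLevel n h).le_of_opNorm_le (norm_annihilateLevel_le n h) _
    calc ‖annihilateComponents h (expComponent k) n‖ ^ 2
        ≤ ((Real.sqrt (n + 1) * ‖h‖) * ‖expComponent k (n + 1)‖) ^ 2 := by gcongr
      _ = _ := by
        rw [mul_pow, mul_pow, Real.sq_sqrt (by positivity), norm_sq_expComponent,
          Nat.factorial_succ, pow_succ (‖k‖ ^ 2)]
        push_cast
        field_simp
  exact this

/-- The creation and annihilation operators are adjoint to each other. -/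
theorem inner_creation_left (h : V) (ψ : (creation h).domain) (φ : (annihilation h).domain) :
    inner ℂ (creation h ψ) (φ : Fock V) = inner ℂ (ψ : Fock V) (annihilation h φ) := by
  have hs := lp.summable_inner (𝕜 := ℂ) (creation h ψ) (φ : Fock V)
  rw [lp.inner_eq_tsum, lp.inner_eq_tsum, hs.tsum_eq_zero_add]
  have h0 : inner ℂ ((creation h ψ) 0) ((φ : Fock V) 0) = 0 := by
    have : (creation h ψ) 0 = 0 := rfl
    rw [this, inner_zero_left]
  rw [h0, zero_add]
  refine tsum_congr fun n => ?_
  exact (ContinuousLinearMap.adjoint_inner_right (createLevel n h) ((ψ : Fock V) n)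
    ((φ : Fock V) (n + 1))).symm

end Fock

/-! ### Operators on the exponential vectors and expressions that define bounded operators -/

section ExpOperators

variable {V : Type u} [NormedAddCommGroup V] [InnerProductSpace ℂ V]

/-- The exponential vector as an element of the span of the exponential vectors. -/
def expSpanVec (k : V) : expSpan V := ⟨expVec k, expVec_mem_expSpan k⟩

variable (V)

/-- The space `𝓛(𝓔(V), Γ)` of linear operators defined on the span of the exponential vectors that
have an adjoint which is also defined there. -/
structure ExpOperator where
  op : expSpan V →ₗ[ℂ] Fock V
  adj : expSpan V →ₗ[ℂ] Fock V
  adjoint_spec : ∀ f g : V,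
    inner ℂ (expVec f) (op (expSpanVec g)) = inner ℂ (adj (expSpanVec f)) (expVec g)

variable {V}

namespace ExpOperator

instance instOne : One (ExpOperator V) where
  one := ⟨(expSpan V).subtype, (expSpan V).subtype, fun _ _ => rfl⟩

instance instAdd : Add (ExpOperator V) where
  add X Y := ⟨X.op + Y.op, X.adj + Y.adj, fun f g => by
    simp [X.adjoint_spec, Y.adjoint_spec]⟩

instance instSub : Sub (ExpOperator V) where
  sub X Y := ⟨X.op - Y.op, X.adj - Y.adj, fun f g => by
    simp [X.adjoint_spec, Y.adjoint_spec]⟩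

instance instSMul : SMul ℂ (ExpOperator V) where
  smul c X := ⟨c • X.op, (starRingEnd ℂ) c • X.adj, fun f g => by
    simp [X.adjoint_spec, mul_comm]⟩

/-- The creation operator restricted to the exponential vectors. -/
def create (h : V) : ExpOperator V where
  op := (creation h).toFun ∘ₗ Submodule.inclusion (expSpan_le_creation_domain h)
  adj := (annihilation h).toFun ∘ₗ Submodule.inclusion (expSpan_le_annihilation_domain h)
  adjoint_spec f g := by
    have := inner_creation_left h
      (Submodule.inclusion (expSpan_le_creation_domain h) (expSpanVec g))
      (Submodule.inclusion (expSpan_le_annihilation_domain h) (expSpanVec f))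
    have h2 := congrArg (starRingEnd ℂ) this
    rw [inner_conj_symm, inner_conj_symm] at h2
    exact h2

/-- The annihilation operator restricted to the exponential vectors. -/
def annihilate (h : V) : ExpOperator V where
  op := (annihilation h).toFun ∘ₗ Submodule.inclusion (expSpan_le_annihilation_domain h)
  adj := (creation h).toFun ∘ₗ Submodule.inclusion (expSpan_le_creation_domain h)
  adjoint_spec f g :=
    (inner_creation_left h
      (Submodule.inclusion (expSpan_le_creation_domain h) (expSpanVec f))
      (Submodule.inclusion (expSpan_le_annihilation_domain h) (expSpanVec g))).symm

end ExpOperator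

/-- The matrix element `⟪X* 𝓔(f), B Y 𝓔(g)⟫` of the expression `X B Y`. -/
def productForm (X : ExpOperator V) (B : Fock V →L[ℂ] Fock V) (Y : ExpOperator V) (f g : V) : ℂ :=
  inner ℂ (X.adj (expSpanVec f)) (B (Y.op (expSpanVec g)))

/-- The matrix elements of the commutator `[T, B] = T B 1 - 1 B T`. -/
def commutatorForm (T : ExpOperator V) (B : Fock V →L[ℂ] Fock V) (f g : V) : ℂ :=
  productForm T B 1 f g - productForm 1 B T f g

/-- The matrix elements of the anticommutator `{T, B} = T B 1 + 1 B T`. -/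
def anticommutatorForm (T : ExpOperator V) (B : Fock V →L[ℂ] Fock V) (f g : V) : ℂ :=
  productForm T B 1 f g + productForm 1 B T f g

/-- The matrix element `⟪𝓔(f), M 𝓔(g)⟫` of a bounded operator. -/
def matrixElement (M : Fock V →L[ℂ] Fock V) (f g : V) : ℂ :=
  inner ℂ (expVec f) (M (expVec g))

/-- The expression with matrix elements `q f g` between exponential vectors defines a bounded
operator. -/
def DefinesBoundedOperator (q : V → V → ℂ) : Prop :=
  ∃ M : Fock V →L[ℂ] Fock V, ∀ f g : V, matrixElement M f g = q f g

open Classical in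
/-- The bounded operator defined by an expression (it is unique because the exponential vectors are
total); zero if there is none. -/
def boundedOperator (q : V → V → ℂ) : Fock V →L[ℂ] Fock V :=
  if h : DefinesBoundedOperator q then h.choose else 0

end ExpOperators

/-! ### Noncommutative Wiener space -/

section WienerSpace

variable (𝔥 : Type u) [NormedAddCommGroup 𝔥] [InnerProductSpace ℝ 𝔥]

/-- The symmetric Fock space over `𝔥_ℂ`. -/
abbrev WienerFock : Type u := Fock (Complexification 𝔥)

/-- The algebra of bounded operators on the Fock space. -/
abbrev BoundedOps : Type u := WienerFock 𝔥 →L[ℂ] WienerFock 𝔥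

/-- The space `𝔥_ℂ ⊗ ℂ²`, as pairs `(k₁, k₂)`. -/
abbrev DoubleSpace : Type u := Complexification 𝔥 × Complexification 𝔥

/-- The algebraic tensor product `𝓑(Γ) ⊗ 𝔥_ℂ ⊗ ℂ²`. -/
abbrev VectorFields : Type u := BoundedOps 𝔥 ⊗[ℂ] DoubleSpace 𝔥

variable {𝔥}

/-- The position operator `Q(h) = a(h̄) + a⁺(h)`. -/
def position (h : Complexification 𝔥) : ExpOperator (Complexification 𝔥) :=
  ExpOperator.annihilate h.conj + ExpOperator.create h

/-- The momentum operator `P(h) = i (a(h̄) - a⁺(h))`. -/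
def momentum (h : Complexification 𝔥) : ExpOperator (Complexification 𝔥) :=
  Complex.I • (ExpOperator.annihilate h.conj - ExpOperator.create h)

/-- The Weyl operator `U(h₁, h₂) = exp(i P(h₁) + i Q(h₂))`, `h₁, h₂` real, evaluated on the
exponential vector `𝓔(f)`. -/
def weylVec (h₁ h₂ : 𝔥) (f : Complexification 𝔥) : WienerFock 𝔥 :=
  Complex.exp (-inner ℂ (Complexification.ofReal h₁) f
      + Complex.I * inner ℂ (Complexification.ofReal h₂) f - ((‖h₁‖ ^ 2 + ‖h₂‖ ^ 2) / 2 : ℝ)) •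
    expVec (f + Complexification.ofReal h₁ + Complex.I • Complexification.ofReal h₂)

/-- `M = O_h(φ)`, i.e. `⟪𝓔(k₁), M 𝓔(k₂)⟫ = (2π)⁻¹ ∫ G(s, t) (𝓕⁻¹ φ)(s, t) ds dt` for all `k₁, k₂`,
where `G(s, t) = ⟪𝓔(k₁), U(s h₁, t h₂) 𝓔(k₂)⟫` and
`(𝓕⁻¹ φ)(s, t) = (2π)⁻¹ ∫ φ(x, y) exp(-i (s x + t y)) dx dy`. The inverse Fourier transform of `φ`
is meant in the sense of distributions, as it must be if `φ` is an exponential or a constant: the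
right hand side is the integral of `φ` against the complex measure `ρ m` of which `G` is the
Fourier transform. -/
def IsWeylQuantization (h : 𝔥 × 𝔥) (φ : ℝ × ℝ → ℂ) (M : BoundedOps 𝔥) : Prop :=
  ∀ k₁ k₂ : Complexification 𝔥, ∃ (m : MeasureTheory.Measure (ℝ × ℝ)) (ρ : ℝ × ℝ → ℂ),
    MeasureTheory.Integrable ρ m ∧
    (∀ s t : ℝ, inner ℂ (expVec k₁) (weylVec (s • h.1) (t • h.2) k₂) =
      ∫ p, Complex.exp (Complex.I * (s * p.1 + t * p.2)) * ρ p ∂m) ∧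
    MeasureTheory.Integrable (fun p => φ p * ρ p) m ∧
    matrixElement M k₁ k₂ = ∫ p, φ p * ρ p ∂m

/-- The partial derivative in the first variable. -/
def partialX (φ : ℝ × ℝ → ℂ) (p : ℝ × ℝ) : ℂ := fderiv ℝ φ p (1, 0)

/-- The partial derivative in the second variable. -/
def partialY (φ : ℝ × ℝ → ℂ) (p : ℝ × ℝ) : ℂ := fderiv ℝ φ p (0, 1)

/-- `φ` is smooth and all its partial derivatives lie in the domain of `O_h`. -/
def IsSmoothSymbol (h : 𝔥 × 𝔥) (φ : ℝ × ℝ → ℂ) : Prop :=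
  ContDiff ℝ ∞ φ ∧ ∀ κ₁ κ₂ : ℕ, ∃ M : BoundedOps 𝔥,
    IsWeylQuantization h (partialX^[κ₁] (partialY^[κ₂] φ)) M

variable (𝔥)

/-- The algebra `𝓢` of smooth functionals, generated by the operators `O_h(φ)` with smooth symbols
(it contains the unit `O_h(1)`). -/
def smoothFunctionals : Subalgebra ℂ (BoundedOps 𝔥) :=
  Algebra.adjoin ℂ {M | ∃ (h : 𝔥 × 𝔥) (φ : ℝ × ℝ → ℂ),
    IsSmoothSymbol h φ ∧ IsWeylQuantization h φ M}

variable {𝔥}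

/-- The left action `O ⬝ (A ⊗ k) = O A ⊗ k`. -/
def leftAction (O : BoundedOps 𝔥) : VectorFields 𝔥 →ₗ[ℂ] VectorFields 𝔥 :=
  LinearMap.rTensor (DoubleSpace 𝔥) (LinearMap.mulLeft ℂ O)

/-- The right action `(A ⊗ k) ⬝ O = A O ⊗ k`. -/
def rightAction (O : BoundedOps 𝔥) : VectorFields 𝔥 →ₗ[ℂ] VectorFields 𝔥 :=
  LinearMap.rTensor (DoubleSpace 𝔥) (LinearMap.mulRight ℂ O)

/-- The graph of the derivation operator `D : 𝓢 → 𝓑(Γ) ⊗ 𝔥_ℂ ⊗ ℂ²`: it is the derivation with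
`D O_h(φ) = (O_h(∂φ/∂x) ⊗ h₁, O_h(∂φ/∂y) ⊗ h₂)`. -/
inductive IsGradient : BoundedOps 𝔥 → VectorFields 𝔥 → Prop
  | weyl (h : 𝔥 × 𝔥) (φ : ℝ × ℝ → ℂ) (M Mx My : BoundedOps 𝔥) (hφ : IsSmoothSymbol h φ)
      (hM : IsWeylQuantization h φ M) (hx : IsWeylQuantization h (partialX φ) Mx)
      (hy : IsWeylQuantization h (partialY φ) My) :
      IsGradient M (Mx ⊗ₜ[ℂ] (Complexification.ofReal h.1, 0)
        + My ⊗ₜ[ℂ] (0, Complexification.ofReal h.2))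
  | scalar (c : ℂ) : IsGradient (algebraMap ℂ (BoundedOps 𝔥) c) 0
  | add (F G : BoundedOps 𝔥) (A B : VectorFields 𝔥) (hF : IsGradient F A) (hG : IsGradient G B) :
      IsGradient (F + G) (A + B)
  | mul (F G : BoundedOps 𝔥) (A B : VectorFields 𝔥) (hF : IsGradient F A) (hG : IsGradient G B) :
      IsGradient (F * G) (leftAction F B + rightAction G A)

open Classical in
/-- The derivation operator `D` on `𝓢`. -/
def gradient (F : BoundedOps 𝔥) : VectorFields 𝔥 :=
  if h : ∃ A, IsGradient F A then h.choose else 0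

/-- The matrix elements of `(i/2) [Q(k₁) - P(k₂), B]`. -/
def frechetForm (k : DoubleSpace 𝔥) (B : BoundedOps 𝔥) (f g : Complexification 𝔥) : ℂ :=
  Complex.I / 2 * commutatorForm (position k.1 - momentum k.2) B f g

/-- `B ∈ Dom D_k`. -/
def InFrechetDomain (k : DoubleSpace 𝔥) (B : BoundedOps 𝔥) : Prop :=
  DefinesBoundedOperator (frechetForm k B)

/-- `D_k B = (i/2) [Q(k₁) - P(k₂), B]`. -/
def frechet (k : DoubleSpace 𝔥) (B : BoundedOps 𝔥) : BoundedOps 𝔥 :=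
  boundedOperator (frechetForm k B)

/-- The operator `P(k₁) + Q(k₂)`. -/
def fieldOperator (k : DoubleSpace 𝔥) : ExpOperator (Complexification 𝔥) :=
  momentum k.1 + position k.2

/-- The bounded operator defined by the commutator `[P(k₁) + Q(k₂), B]`. -/
def fieldCommutator (k : DoubleSpace 𝔥) (B : BoundedOps 𝔥) : BoundedOps 𝔥 :=
  boundedOperator (commutatorForm (fieldOperator k) B)

/-- The vector field `∑ F_j ⊗ h^{(j)}`. -/
def elementary {n : ℕ} (F : Fin n → BoundedOps 𝔥) (h : Fin n → DoubleSpace 𝔥) : VectorFields 𝔥 :=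
  ∑ j, F j ⊗ₜ[ℂ] h j

/-- The matrix elements of `½ ∑ {P(h₁^{(j)}) + Q(h₂^{(j)}), F_j} - ∑ D_{h^{(j)}} F_j`. -/
def divergenceForm {n : ℕ} (F : Fin n → BoundedOps 𝔥) (h : Fin n → DoubleSpace 𝔥)
    (f g : Complexification 𝔥) : ℂ :=
  1 / 2 * ∑ j, anticommutatorForm (fieldOperator (h j)) (F j) f g
    - ∑ j, matrixElement (frechet (h j) (F j)) f g

variable (𝔥)

/-- The smooth elementary vector fields `𝓢_𝔥`. -/
def smoothFields : Set (VectorFields 𝔥) :=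
  {u | ∃ (n : ℕ) (F : Fin n → BoundedOps 𝔥) (h : Fin n → DoubleSpace 𝔥),
    (∀ j, F j ∈ smoothFunctionals 𝔥) ∧ u = elementary F h}

/-- The domain `𝓢_{𝔥,δ}` of the divergence operator. -/
def divergenceDomain : Set (VectorFields 𝔥) :=
  {u | ∃ (n : ℕ) (F : Fin n → BoundedOps 𝔥) (h : Fin n → DoubleSpace 𝔥),
    (∀ j, F j ∈ smoothFunctionals 𝔥) ∧ u = elementary F h ∧
      DefinesBoundedOperator (divergenceForm F h)}

variable {𝔥}

/-- `M = δ(u)`. -/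
def IsDivergence (u : VectorFields 𝔥) (M : BoundedOps 𝔥) : Prop :=
  ∃ (n : ℕ) (F : Fin n → BoundedOps 𝔥) (h : Fin n → DoubleSpace 𝔥),
    (∀ j, F j ∈ smoothFunctionals 𝔥) ∧ u = elementary F h ∧
      ∀ f g : Complexification 𝔥, matrixElement M f g = divergenceForm F h f g

open Classical in
/-- The divergence operator `δ` on `𝓢_{𝔥,δ}`. -/
def divergence (u : VectorFields 𝔥) : BoundedOps 𝔥 :=
  if h : ∃ M, IsDivergence u M then h.choose else 0

/-- The conjugation of `𝔥_ℂ ⊗ ℂ²`. -/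
def doubleConj (k : DoubleSpace 𝔥) : DoubleSpace 𝔥 := (k.1.conj, k.2.conj)

/-- The inner product of `𝔥_ℂ ⊗ ℂ²`, antilinear in the first variable. -/
def doubleInner (h k : DoubleSpace 𝔥) : ℂ := inner ℂ h.1 k.1 + inner ℂ h.2 k.2

variable [CompleteSpace 𝔥]

/-- The conjugation `O ⊗ k ↦ O* ⊗ k̄`. -/
def fieldConj : VectorFields 𝔥 →ₛₗ[starRingEnd ℂ] VectorFields 𝔥 :=
  TensorProduct.lift (LinearMap.mk₂'ₛₗ (starRingEnd ℂ) (starRingEnd ℂ)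
    (fun (O : BoundedOps 𝔥) (k : DoubleSpace 𝔥) => ContinuousLinearMap.adjoint O ⊗ₜ[ℂ] doubleConj k)
    (fun O₁ O₂ k => by rw [map_add, TensorProduct.add_tmul])
    (fun c O k => by rw [LinearIsometryEquiv.map_smulₛₗ, ← TensorProduct.smul_tmul'])
    (fun O k₁ k₂ => by
      rw [← TensorProduct.tmul_add]
      congr 1
      simp [doubleConj, Complexification.conj_add])
    (fun c O k => by
      rw [← TensorProduct.tmul_smul]
      congr 1
      simp [doubleConj, Complexification.conj_smul]))

/-- The linear map `O' ⊗ k' ↦ ⟪k, k'⟫ O* O'`. -/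
def fieldInnerAux (O : BoundedOps 𝔥) (k : DoubleSpace 𝔥) : VectorFields 𝔥 →ₗ[ℂ] BoundedOps 𝔥 :=
  TensorProduct.lift (LinearMap.mk₂ ℂ
    (fun (O' : BoundedOps 𝔥) (k' : DoubleSpace 𝔥) => doubleInner k k' • (ContinuousLinearMap.adjoint O * O'))
    (fun O₁ O₂ k' => by rw [mul_add, smul_add])
    (fun c O' k' => by rw [mul_smul_comm, smul_comm])
    (fun O' k₁ k₂ => by
      rw [← add_smul]
      congr 1
      simp [doubleInner]
      ring)
    (fun c O' k' => by
      rw [smul_smul]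
      congr 1
      simp [doubleInner]
      ring))

theorem fieldInnerAux_tmul (O O' : BoundedOps 𝔥) (k k' : DoubleSpace 𝔥) :
    fieldInnerAux O k (O' ⊗ₜ[ℂ] k') = doubleInner k k' • (ContinuousLinearMap.adjoint O * O') := rfl

/-- The operator valued inner product `⟨O ⊗ k, O' ⊗ k'⟩ = ⟪k, k'⟫ O* O'`, antilinear in the first
variable. -/
def fieldInner : VectorFields 𝔥 →ₛₗ[starRingEnd ℂ] VectorFields 𝔥 →ₗ[ℂ] BoundedOps 𝔥 :=
  TensorProduct.lift (LinearMap.mk₂'ₛₗ (starRingEnd ℂ) (starRingEnd ℂ)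
    (fun (O : BoundedOps 𝔥) (k : DoubleSpace 𝔥) => fieldInnerAux O k)
    (fun O₁ O₂ k => TensorProduct.ext' fun O' k' => by
      rw [LinearMap.add_apply, fieldInnerAux_tmul, fieldInnerAux_tmul, fieldInnerAux_tmul, map_add,
        add_mul, smul_add])
    (fun c O k => TensorProduct.ext' fun O' k' => by
      rw [LinearMap.smul_apply, fieldInnerAux_tmul, fieldInnerAux_tmul,
        LinearIsometryEquiv.map_smulₛₗ, smul_mul_assoc, smul_comm])
    (fun O k₁ k₂ => TensorProduct.ext' fun O' k' => by
      rw [LinearMap.add_apply, fieldInnerAux_tmul, fieldInnerAux_tmul, fieldInnerAux_tmul,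
        ← add_smul]
      congr 1
      simp [doubleInner]
      ring)
    (fun c O k => TensorProduct.ext' fun O' k' => by
      rw [LinearMap.smul_apply, fieldInnerAux_tmul, fieldInnerAux_tmul, smul_smul]
      congr 1
      simp [doubleInner]
      ring))

/-- The right gradient `⟨ū, D F⟩`. -/
def rightGradient (u : VectorFields 𝔥) (F : BoundedOps 𝔥) : BoundedOps 𝔥 :=
  fieldInner (fieldConj u) (gradient F)

/-- The left gradient `⟨conj(D F), u⟩`. -/
def leftGradient (u : VectorFields 𝔥) (F : BoundedOps 𝔥) : BoundedOps 𝔥 :=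
  fieldInner (fieldConj (gradient F)) u

/-- The operator `⟨h̄, u⟩`, where `h̄` is regarded as `id ⊗ h̄`. -/
def constInner (h : DoubleSpace 𝔥) (u : VectorFields 𝔥) : BoundedOps 𝔥 :=
  fieldInner ((1 : BoundedOps 𝔥) ⊗ₜ[ℂ] doubleConj h) u

end WienerSpace

end QuantumMalliavin

end

/-! Everything is read off the kernels ⟨E(f), B E(g)⟩. Exponential vectors are total, so the kernel
determines B. Moreover a(q) multiplies E(g) by ⟨q,g⟩, and a⁺(q) differentiates the entire map E at g
in direction q. Hence the kernel of [a(p)+a⁺(q), B] is the derivative of that of B along (p,-q),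
plus a multiplication by ⟨f,q⟩-⟨p,g⟩ (`commForm_eq`).

In ½{T_h,F} - D_hF the terms recombine to the Wick ordered expression a⁺F + Fa, where T_h = a + a⁺.
So the kernel of δ(u) is Σ ω_j(f,g)⟨E(f),F_jE(g)⟩ with ω_j the `fieldSymbol` of h_j
(`anticommutatorForm_sub_frechetForm`); it is linear in u and independent of the representation. The
Heisenberg relation is then the product rule for a derivative: ω_j has constant derivative, which
produces ⟨h̄,u⟩ (`commForm_of_matrixElement_eq`, `doubleInner_doubleConj`).

For the product rules, a⁺F + Fa is rewritten as FT + [a⁺,F] before multiplying by G from the left,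
and as TF - [a,F] before multiplying from the right. What remains is the Leibniz rule for [a⁺,GF]
and [a,FG], with [a⁺,G] = ½[T,G] - DG and [a,G] = ½[T,G] + DG. The gradient enters through
`constInner_gradient`: contracting DG with k gives D_kG.

Two analytic facts carry this. The Leibniz rule `HasCommutator.mul` is not formal, because C E(g)
leaves the span of the exponential vectors; it rests on essential self-adjointness of a(κ)+a⁺(κ)
there (`exists_seq_of_adjoint`). And elements of 𝓢 have bounded commutators, again in 𝓢
(`exists_hasCommutator`): by Fourier uniqueness the kernel of O_h(φ) is an integral of φ against a
complex Gaussian, and moving f and g together along -(i/2)κ translates that Gaussian by a real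
vector, so the commutator differentiates φ (`IsWeylQuantization.hasCommutator_self`). -/

noncomputable section

namespace QuantumMalliavin

universe u

/-! ### Analyticity and totality of the exponential vectors; action of creation and annihilation. -/

section ExponentialVectors

variable {V : Type u} [NormedAddCommGroup V] [InnerProductSpace ℂ V]

theorem tensorLeft_apply (n : ℕ) (v : V) (x : HilbertTensorPower V n) :
    tensorLeft n v x = (UniformSpace.Completion.toComplL :
      V ⊗[ℂ] HilbertTensorPower V n →L[ℂ] UniformSpace.Completion (V ⊗[ℂ] HilbertTensorPower V n))
        (v ⊗ₜ[ℂ] x) := rfl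

/-- The map `v ↦ (x ↦ v ⊗ x)`. -/
def tensorLeftCLM (n : ℕ) :
    V →L[ℂ] HilbertTensorPower V n →L[ℂ] HilbertTensorPower V (n + 1) :=
  LinearMap.mkContinuous
    { toFun := tensorLeft n
      map_add' := fun v w => by
        ext x
        rw [add_apply, tensorLeft_apply, TensorProduct.add_tmul, map_add]
        rfl
      map_smul' := fun c v => by
        ext x
        rw [RingHom.id_apply, smul_apply, tensorLeft_apply, ← TensorProduct.smul_tmul', map_smul]
        rfl }
    1 (fun v => by
      refine ContinuousLinearMap.opNorm_le_bound _ (by positivity) fun x => ?_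
      rw [one_mul]
      exact (norm_tensorLeft_apply n v x).le)

theorem inner_tensorLeft (n : ℕ) (v w : V) (x y : HilbertTensorPower V n) :
    inner ℂ (tensorLeft n v x) (tensorLeft n w y) = inner ℂ v w * inner ℂ x y := by
  have h : inner ℂ ((v ⊗ₜ[ℂ] x : V ⊗[ℂ] HilbertTensorPower V n) :
      UniformSpace.Completion (V ⊗[ℂ] HilbertTensorPower V n))
      ((w ⊗ₜ[ℂ] y : V ⊗[ℂ] HilbertTensorPower V n) :
      UniformSpace.Completion (V ⊗[ℂ] HilbertTensorPower V n)) = inner ℂ v w * inner ℂ x y := by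
    rw [UniformSpace.Completion.inner_coe, TensorProduct.inner_tmul]
  exact h

/-- The elementary tensor as a continuous multilinear map. -/
def elemTensorMultilinear :
    (n : ℕ) → ContinuousMultilinearMap ℂ (fun _ : Fin n => V) (HilbertTensorPower V n)
  | 0 => ContinuousMultilinearMap.constOfIsEmpty ℂ _ (elemTensor 0 Fin.elim0)
  | n + 1 => ContinuousLinearMap.uncurryLeft
      (((ContinuousLinearMap.compContinuousMultilinearMapL ℂ (fun _ : Fin n => V)
        (HilbertTensorPower V n) (HilbertTensorPower V (n + 1))).flip
          (elemTensorMultilinear n)) ∘L tensorLeftCLM n)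

theorem elemTensorMultilinear_apply (n : ℕ) (v : Fin n → V) :
    elemTensorMultilinear n v = elemTensor n v := by
  induction n with
  | zero => rfl
  | succ n ih => exact congrArg (tensorLeft n (v 0)) (ih (Fin.tail v))

theorem norm_elemTensor (n : ℕ) (v : Fin n → V) : ‖elemTensor n v‖ = ∏ i, ‖v i‖ := by
  induction n with
  | zero => exact (PiLp.norm_single 2 (fun _ => ℂ) _ _).trans (by simp)
  | succ n ih =>
    have : elemTensor (n + 1) v = tensorLeft n (v 0) (elemTensor n (Fin.tail v)) := rfl
    rw [this, norm_tensorLeft_apply, ih, Fin.prod_univ_succ]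
    rfl

theorem inner_elemTensor_const (n : ℕ) (f g : V) :
    inner ℂ (elemTensor n (fun _ => f)) (elemTensor n (fun _ => g)) = inner ℂ f g ^ n := by
  induction n with
  | zero =>
    have : inner ℂ (EuclideanSpace.single PUnit.unit (1 : ℂ) : EuclideanSpace ℂ PUnit.{u + 1})
      (EuclideanSpace.single PUnit.unit (1 : ℂ)) = 1 := by simp
    exact this.trans (pow_zero _).symm
  | succ n ih =>
    have h : ∀ k : V, elemTensor (n + 1) (fun _ => k) =
      tensorLeft n k (elemTensor n (fun _ => k)) := fun _ => rfl
    rw [h, h, inner_tensorLeft, ih, pow_succ']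

/-- The Taylor coefficients of the exponential vector. -/
def expSeries (V : Type u) [NormedAddCommGroup V] [InnerProductSpace ℂ V] :
    FormalMultilinearSeries ℂ V (Fock V) := fun n =>
  ((lp.singleContinuousLinearMap ℂ (fun n : ℕ => SymPower V n) 2 n) ∘L
    ((((Real.sqrt n.factorial)⁻¹ : ℝ) : ℂ) • (symSubspace V n).orthogonalProjectionOnto)
    ).compContinuousMultilinearMap (elemTensorMultilinear n)

theorem expSeries_apply (n : ℕ) (v : Fin n → V) :
    expSeries V n v = lp.single 2 n ((((Real.sqrt n.factorial)⁻¹ : ℝ) : ℂ) •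
      (symSubspace V n).orthogonalProjectionOnto (elemTensor n v)) := by
  rw [← elemTensorMultilinear_apply]
  rfl

theorem expSeries_apply_const (n : ℕ) (k : V) :
    expSeries V n (fun _ => k) = lp.single 2 n (expComponent k n) := by
  rw [expSeries_apply]
  congr 2
  exact Submodule.orthogonalProjectionOnto_mem_subspace_eq_self (symPow n k)

theorem norm_expSeries_le (n : ℕ) : ‖expSeries V n‖ ≤ (Real.sqrt n.factorial)⁻¹ := by
  refine ContinuousMultilinearMap.opNorm_le_bound (by positivity) fun v => ?_
  rw [expSeries_apply, lp.norm_single (by norm_num), norm_smul, Complex.norm_real,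
    Real.norm_of_nonneg (by positivity), ← norm_elemTensor]
  gcongr
  exact (symSubspace V n).norm_orthogonalProjectionOnto_apply_le _

theorem summable_pow_div_sqrt_factorial (r : ℝ) (hr : 0 ≤ r) :
    Summable fun n : ℕ => (Real.sqrt n.factorial)⁻¹ * r ^ n := by
  refine Summable.of_nonneg_of_le (fun n => by positivity) (fun n => ?_)
    ((Real.summable_pow_div_factorial (4 * r ^ 2)).add
      (summable_geometric_of_lt_one (r := 1 / 4) (by norm_num) (by norm_num)))
  -- Splitting r^n = (2r)^n · 2^(-n) and using xy ≤ x² + y² replaces the square root of the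
  -- factorial by the factorial itself.
  have h1 : (Real.sqrt n.factorial)⁻¹ * r ^ n = ((Real.sqrt n.factorial)⁻¹ * (2 * r) ^ n) * (1 / 2) ^ n := by
    rw [mul_assoc, ← mul_pow]; congr 2; ring
  have h2 : (4 * r ^ 2) ^ n / n.factorial = ((Real.sqrt n.factorial)⁻¹ * (2 * r) ^ n) ^ 2 := by
    rw [mul_pow (Real.sqrt _)⁻¹, inv_pow, Real.sq_sqrt (by positivity), ← pow_mul, mul_comm n 2,
      pow_mul (2 * r)]
    ring
  have h3 : ((1 : ℝ) / 4) ^ n = ((1 / 2) ^ n) ^ 2 := by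
    rw [← pow_mul, mul_comm n 2, pow_mul]; norm_num
  rw [h1, h2, h3]
  nlinarith [sq_nonneg (((Real.sqrt n.factorial)⁻¹ * (2 * r) ^ n) - (1 / 2) ^ n),
    sq_nonneg (((Real.sqrt n.factorial)⁻¹ * (2 * r) ^ n)), sq_nonneg (((1 : ℝ) / 2) ^ n)]

/-- The coefficients decay like 1/√(n!), so the radius is infinite. The expansion serves twice: its
coefficients at 0 give totality, and its differentiability gives the action of a⁺. -/
theorem hasFPowerSeriesOnBall_expVec :
    HasFPowerSeriesOnBall (expVec (V := V)) (expSeries V) 0 ⊤ where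
  r_le := by
    rw [FormalMultilinearSeries.radius_eq_top_of_summable_norm]
    intro r
    refine Summable.of_nonneg_of_le (fun n => by positivity) (fun n => ?_)
      (summable_pow_div_sqrt_factorial r r.2)
    gcongr
    exact norm_expSeries_le n
  r_pos := by simp
  hasSum := fun {y} _ => by
    simp only [expSeries_apply_const, zero_add]
    exact lp.hasSum_single (by norm_num) (expVec y)

theorem differentiable_expVec : Differentiable ℂ (expVec (V := V)) := fun x =>
  (hasFPowerSeriesOnBall_expVec.analyticAt_of_mem (by simp)).differentiableAt

theorem inner_expVec (f g : V) : inner ℂ (expVec f) (expVec g) = Complex.exp (inner ℂ f g) := by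
  rw [lp.inner_eq_tsum, Complex.exp_eq_exp_ℂ, NormedSpace.exp_eq_tsum_div]
  refine tsum_congr fun n => ?_
  have h : inner ℂ (expComponent f n) (expComponent g n) = inner ℂ f g ^ n / n.factorial := by
    rw [expComponent, expComponent, inner_smul_left, inner_smul_right, Complex.conj_ofReal,
      ← mul_assoc, ← Complex.ofReal_mul, ← mul_inv, Real.mul_self_sqrt (by positivity)]
    have : inner ℂ (symPow n f) (symPow n g) = inner ℂ f g ^ n := inner_elemTensor_const n f g
    rw [this]
    push_cast
    ring
  exact h

/-- The entire function k ↦ ⟨ψ, E(k)⟩ vanishes, hence so do its derivatives at 0; the n-th one pairs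
the n-particle component of ψ with all symmetric products, and these span a dense subspace. -/
theorem eq_zero_of_inner_expVec (ψ : Fock V) (hψ : ∀ k : V, inner ℂ ψ (expVec k) = 0) : ψ = 0 := by
  have h1 := (innerSL ℂ ψ).comp_hasFPowerSeriesOnBall (hasFPowerSeriesOnBall_expVec (V := V))
  have h0 : (innerSL ℂ ψ) ∘ (expVec (V := V)) = 0 := funext fun k => hψ k
  rw [h0] at h1
  refine lp.ext (funext fun n => ?_)
  have h2 : ∀ v : Fin n → V,
      inner ℂ ((ψ n : SymPower V n) : HilbertTensorPower V n) (symProduct n v) = 0 := by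
    intro v
    -- The iterated derivative sums the unsymmetrized coefficient over all permutations, which is
    -- the sum defining `symProduct`.
    have h3 := h1.iteratedFDeriv_eq_sum_of_completeSpace (n := n) (v := v)
    have h4 : iteratedFDeriv ℂ n (0 : V → ℂ) 0 v = 0 := by
      rw [Pi.zero_def, iteratedFDeriv_fun_zero]; rfl
    rw [h4] at h3
    have h5 : ∀ w : Fin n → V, (innerSL ℂ ψ).compFormalMultilinearSeries (expSeries V) n w =
        (((Real.sqrt n.factorial)⁻¹ : ℝ) : ℂ) *
          inner ℂ ((ψ n : SymPower V n) : HilbertTensorPower V n) (elemTensor n w) := by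
      intro w
      have : (innerSL ℂ ψ).compFormalMultilinearSeries (expSeries V) n w =
        inner ℂ ψ (expSeries V n w) := rfl
      rw [this, expSeries_apply, lp.inner_single_right, inner_smul_right]
      congr 1
      exact Submodule.inner_orthogonalProjectionOnto_eq_of_mem_left _ _
    simp only [h5] at h3
    rw [← Finset.mul_sum] at h3
    have h6 := (mul_eq_zero.1 h3.symm).resolve_left (by
      rw [← ne_eq, Complex.ofReal_ne_zero]; positivity)
    rw [symProduct, inner_smul_right, inner_sum]
    rw [mul_eq_zero]
    exact Or.inr h6
  have h3 : ∀ x ∈ symSubspace V n,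
      inner ℂ ((ψ n : SymPower V n) : HilbertTensorPower V n) x = 0 := by
    intro x hx
    have : symSubspace V n ≤ (ℂ ∙ ((ψ n : SymPower V n) : HilbertTensorPower V n))ᗮ := by
      refine Submodule.topologicalClosure_minimal _ ?_ (Submodule.isClosed_orthogonal _)
      rw [Submodule.span_le]
      rintro _ ⟨v, rfl⟩
      exact Submodule.mem_orthogonal_singleton_iff_inner_right.2 (h2 v)
    exact Submodule.mem_orthogonal_singleton_iff_inner_right.1 (this hx)
  exact Subtype.ext (inner_self_eq_zero.1 (h3 _ (ψ n).2))

theorem eq_of_inner_expVec {ψ φ : Fock V}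
    (h : ∀ k : V, inner ℂ (expVec k) ψ = inner ℂ (expVec k) φ) : ψ = φ := by
  rw [← sub_eq_zero]
  refine eq_zero_of_inner_expVec _ fun k => ?_
  rw [← inner_conj_symm, inner_sub_right, h k, sub_self, map_zero]

theorem dense_expSpan : Dense (expSpan V : Set (Fock V)) := by
  rw [Submodule.dense_iff_topologicalClosure_eq_top,
    Submodule.topologicalClosure_eq_top_iff, Submodule.eq_bot_iff]
  intro ψ hψ
  refine eq_zero_of_inner_expVec ψ fun k => ?_
  rw [← inner_conj_symm, (Submodule.mem_orthogonal _ _).1 hψ _ (expVec_mem_expSpan k), map_zero]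

theorem eq_of_matrixElement {M N : Fock V →L[ℂ] Fock V}
    (h : ∀ f g, matrixElement M f g = matrixElement N f g) : M = N := by
  refine ContinuousLinearMap.ext_on (s := Set.range (expVec (V := V))) dense_expSpan ?_
  rintro _ ⟨g, rfl⟩
  exact eq_of_inner_expVec fun f => h f g

theorem boundedOperator_eq {q : V → V → ℂ} {M : Fock V →L[ℂ] Fock V}
    (h : ∀ f g, matrixElement M f g = q f g) : boundedOperator q = M := by
  have hq : DefinesBoundedOperator q := ⟨M, h⟩
  rw [boundedOperator, dif_pos hq]
  exact eq_of_matrixElement fun f g => (hq.choose_spec f g).trans (h f g).symm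

theorem matrixElement_boundedOperator {q : V → V → ℂ} (hq : DefinesBoundedOperator q) (f g : V) :
    matrixElement (boundedOperator q) f g = q f g := by
  rw [boundedOperator, dif_pos hq]
  exact hq.choose_spec f g

/-- The derivative of the exponential vector at `g` in the direction `q`. -/
def expDeriv (g q : V) : Fock V := fderiv ℂ (expVec (V := V)) g q

theorem expDeriv_add (g p q : V) : expDeriv g (p + q) = expDeriv g p + expDeriv g q := map_add _ _ _

theorem expDeriv_smul (g : V) (c : ℂ) (q : V) : expDeriv g (c • q) = c • expDeriv g q :=
  map_smul _ _ _

/-- This is the derivative of the reproducing kernel exp⟨f,·⟩ at g. -/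
theorem inner_expVec_expDeriv (f g q : V) :
    inner ℂ (expVec f) (expDeriv g q) = inner ℂ f q * Complex.exp (inner ℂ f g) := by
  have h1 : HasFDerivAt (fun x : V => (innerSL ℂ (expVec f)) (expVec x))
      ((innerSL ℂ (expVec f)) ∘L fderiv ℂ (expVec (V := V)) g) g :=
    (innerSL ℂ (expVec f)).hasFDerivAt.comp g (differentiable_expVec g).hasFDerivAt
  have h2 : HasFDerivAt (fun x : V => Complex.exp ((innerSL ℂ f) x))
      (Complex.exp ((innerSL ℂ f) g) • innerSL ℂ f) g := (innerSL ℂ f).hasFDerivAt.cexp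
  have h3 : (fun x : V => (innerSL ℂ (expVec f)) (expVec x)) =
      fun x : V => Complex.exp ((innerSL ℂ f) x) := funext fun x => inner_expVec f x
  rw [h3] at h1
  have h4 := congrArg (fun L => L q) (h1.unique h2)
  refine Eq.trans h4 ?_
  simp [mul_comm]

/-- Moving the annihilator to the other side leaves ⟨q ⊗ ψ, f^{⊗(n+1)}⟩, where the symmetrizing
projection is invisible; the factor √(n+1) cancels against √((n+1)!) = √(n+1)·√(n!). -/
theorem annihilateComponents_expComponent (q f : V) (n : ℕ) :
    annihilateComponents q (expComponent f) n = inner ℂ q f • expComponent f n := by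
  refine ext_inner_left ℂ fun ψ => ?_
  rw [annihilateComponents, annihilateLevel, ContinuousLinearMap.adjoint_inner_right]
  have h1 : inner ℂ ψ (symPow n f) =
    inner ℂ (ψ : HilbertTensorPower V n) (elemTensor n (fun _ => f)) := rfl
  have h2 : inner ℂ (createLevel n q ψ) (symPow (n + 1) f) = ((Real.sqrt (n + 1) : ℝ) : ℂ) *
      (inner ℂ q f * inner ℂ ψ (symPow n f)) := by
    have h3 : createLevel n q ψ = ((Real.sqrt (n + 1) : ℝ) : ℂ) •
      (symSubspace V (n + 1)).orthogonalProjectionOnto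
        (tensorLeft n q (ψ : HilbertTensorPower V n)) := rfl
    rw [h3, inner_smul_left, Complex.conj_ofReal, h1, ← inner_tensorLeft]
    congr 1
    exact Submodule.inner_orthogonalProjectionOnto_eq_of_mem_right (symPow (n + 1) f) _
  rw [expComponent, expComponent, inner_smul_right, h2, inner_smul_right, inner_smul_right,
    Nat.factorial_succ, Nat.cast_mul, Real.sqrt_mul (by positivity)]
  have h4 : ((Real.sqrt (n + 1) : ℝ) : ℂ) ≠ 0 := by
    rw [Complex.ofReal_ne_zero]; positivity
  push_cast
  field_simp

theorem annihilate_op_expVec (q f : V) :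
    (ExpOperator.annihilate q).op (expSpanVec f) = inner ℂ q f • expVec f :=
  lp.ext (funext fun n => annihilateComponents_expComponent q f n)

theorem create_adj_expVec (q f : V) :
    (ExpOperator.create q).adj (expSpanVec f) = inner ℂ q f • expVec f :=
  annihilate_op_expVec q f

/-- No computation with components is needed: adjointness turns a⁺(q) into the eigenvalue of a(q) on
E(f), and totality identifies the vector. -/
theorem create_op_expVec (q g : V) :
    (ExpOperator.create q).op (expSpanVec g) = expDeriv g q := by
  refine eq_of_inner_expVec fun f => ?_
  rw [(ExpOperator.create q).adjoint_spec, create_adj_expVec, inner_smul_left, inner_conj_symm,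
    inner_expVec, inner_expVec_expDeriv]

theorem annihilate_adj_expVec (q f : V) :
    (ExpOperator.annihilate q).adj (expSpanVec f) = expDeriv f q :=
  create_op_expVec q f

end ExponentialVectors

/-! ### Commutators with field operators; essential self-adjointness and the Leibniz rule. -/

section Commutators

variable {V : Type u} [NormedAddCommGroup V] [InnerProductSpace ℂ V]

/-- The field operator `a(κ) + a⁺(κ)` on the span of the exponential vectors. -/
def segalOp (κ : V) : expSpan V →ₗ[ℂ] Fock V :=
  (ExpOperator.annihilate κ).op + (ExpOperator.create κ).op

theorem segalOp_expSpanVec (κ g : V) :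
    segalOp κ (expSpanVec g) = inner ℂ κ g • expVec g + expDeriv g κ := by
  rw [segalOp, LinearMap.add_apply, annihilate_op_expVec, create_op_expVec]

theorem expSpan_induction {p : expSpan V → Prop} (hv : ∀ g, p (expSpanVec g))
    (hadd : ∀ x y, p x → p y → p (x + y)) (hsmul : ∀ (c : ℂ) x, p x → p (c • x))
    (x : expSpan V) : p x := by
  have h0 : p 0 := by simpa using hsmul 0 _ (hv 0)
  obtain ⟨x, hx⟩ := x
  induction hx using Submodule.span_induction with
  | mem x hx => obtain ⟨g, rfl⟩ := hx; exact hv g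
  | zero => exact h0
  | add x y hx hy h1 h2 => exact hadd ⟨x, hx⟩ ⟨y, hy⟩ h1 h2
  | smul c x hx h => exact hsmul c ⟨x, hx⟩ h

/-- Taking adjoints exchanges a(κ) and a⁺(κ). Symmetry therefore depends on both parts carrying the
same label. -/
theorem segalOp_symmetric (κ : V) (x y : expSpan V) :
    inner ℂ (segalOp κ x) (y : Fock V) = inner ℂ (x : Fock V) (segalOp κ y) := by
  induction x using expSpan_induction with
  | hv f =>
    induction y using expSpan_induction with
    | hv g =>
      have h := (ExpOperator.annihilate κ + ExpOperator.create κ).adjoint_spec f g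
      refine Eq.trans ?_ h.symm
      congr 1
      exact add_comm _ _
    | hadd x y hx hy => rw [map_add, Submodule.coe_add, inner_add_right, inner_add_right, hx, hy]
    | hsmul c x hx => rw [map_smul, Submodule.coe_smul, inner_smul_right, inner_smul_right, hx]
  | hadd x y hx hy => rw [map_add, Submodule.coe_add, inner_add_left, inner_add_left, hx, hy]
  | hsmul c x hx => rw [map_smul, Submodule.coe_smul, inner_smul_left, inner_smul_left, hx]

/-- The orbit of an exponential vector under the unitary group generated by `a(κ) + a⁺(κ)`. -/
def weylOrbit (κ g : V) (t : ℝ) : expSpan V :=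
  Complex.exp (Complex.I * t * inner ℂ κ g - t ^ 2 * ‖κ‖ ^ 2 / 2) •
    expSpanVec (g + (Complex.I * t) • κ)

theorem hasDerivAt_expVec_line (g κ : V) (c : ℂ) (t : ℝ) :
    HasDerivAt (fun t : ℝ => expVec (g + (c * t) • κ)) (expDeriv (g + (c * t) • κ) (c • κ)) t := by
  have h1 : HasDerivAt (fun t : ℝ => c * (t : ℂ)) c t := by
    simpa using (Complex.ofRealCLM.hasDerivAt (x := t)).const_mul c
  have h2 : HasDerivAt (fun t : ℝ => g + (c * (t : ℂ)) • κ) (c • κ) t :=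
    (h1.smul_const κ).const_add g
  exact ((differentiable_expVec (g + (c * t) • κ)).hasFDerivAt.restrictScalars ℝ).comp_hasDerivAt t h2

theorem hasDerivAt_weylOrbit (κ g : V) (t : ℝ) :
    HasDerivAt (fun t => (weylOrbit κ g t : Fock V))
      (Complex.I • segalOp κ (weylOrbit κ g t)) t := by
  have h1 : HasDerivAt (fun t : ℝ => Complex.I * t * inner ℂ κ g - t ^ 2 * ‖κ‖ ^ 2 / 2)
      (Complex.I * inner ℂ κ g - t * ‖κ‖ ^ 2) t := by
    have hid : HasDerivAt (fun t : ℝ => (t : ℂ)) 1 t := Complex.ofRealCLM.hasDerivAt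
    have h := ((hid.const_mul Complex.I).mul_const (inner ℂ κ g)).sub
      (((hid.pow 2).mul_const ((‖κ‖ : ℂ) ^ 2)).div_const 2)
    refine h.congr_deriv ?_
    simp
    ring
  refine (h1.cexp.smul (hasDerivAt_expVec_line g κ Complex.I t)).congr_deriv ?_
  rw [weylOrbit, map_smul, segalOp_expSpanVec, inner_add_right, inner_smul_right,
    inner_self_eq_norm_sq_to_K, expDeriv_smul]
  have hI := Complex.I_mul_I
  have : Complex.I * (Complex.I * t * (‖κ‖ : ℂ) ^ 2) = - (t * ‖κ‖ ^ 2) := by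
    linear_combination t * (‖κ‖ : ℂ) ^ 2 * hI
  simp only [Complex.coe_algebraMap, smul_add, smul_smul]
  rw [add_comm]
  congr 1
  · congr 1
    linear_combination -Complex.exp (Complex.I * t * inner ℂ κ g - t ^ 2 * ‖κ‖ ^ 2 / 2) * this
  · rw [mul_comm]

/-- With ‖E(k)‖² = exp ‖k‖², the real part of the scalar exponent compensates the growth of ‖g +
itκ‖². This is unitarity of the group, checked on exponential vectors only. -/
theorem norm_weylOrbit (κ g : V) (t : ℝ) : ‖(weylOrbit κ g t : Fock V)‖ = ‖expVec g‖ := by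
  have hexp : ∀ k : V, ‖expVec k‖ ^ 2 = Real.exp (‖k‖ ^ 2) := fun k => by
    have h := inner_expVec k k
    rw [inner_self_eq_norm_sq_to_K, inner_self_eq_norm_sq_to_K] at h
    simp only [Complex.coe_algebraMap] at h
    exact_mod_cast h
  have h1 : (weylOrbit κ g t : Fock V) =
    Complex.exp (Complex.I * t * inner ℂ κ g - t ^ 2 * ‖κ‖ ^ 2 / 2) •
      expVec (g + (Complex.I * t) • κ) := rfl
  rw [← sq_eq_sq₀ (norm_nonneg _) (norm_nonneg _), h1, norm_smul, mul_pow, hexp, hexp,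
    Complex.norm_exp, ← Real.exp_nat_mul, ← Real.exp_add]
  congr 1
  rw [@norm_add_sq ℂ, inner_smul_right, norm_smul, norm_mul, Complex.norm_I, one_mul,
    Complex.norm_real, mul_pow, Real.norm_eq_abs, sq_abs]
  have : ((t : ℂ) ^ 2 * (‖κ‖ : ℂ) ^ 2 / 2) = ((t ^ 2 * ‖κ‖ ^ 2 / 2 : ℝ) : ℂ) := by push_cast; ring
  rw [this, Complex.sub_re, Complex.ofReal_re]
  have hsymm : (inner ℂ g κ).im = -(inner ℂ κ g).im := inner_im_symm (𝕜 := ℂ) g κ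
  simp [hsymm]
  ring

/-- Triviality of the deficiency spaces for both signs. Along the orbit e^{itT}E(g), which stays in
the span, the pairing with χ solves F' = σF; it is also bounded, so it vanishes. -/
theorem eq_zero_of_orthogonal_range (κ : V) (σ : ℝ) (hσ : σ ^ 2 = 1) (χ : Fock V)
    (hχ : ∀ y : expSpan V, inner ℂ χ (segalOp κ y + (Complex.I * σ) • (y : Fock V)) = 0) :
    χ = 0 := by
  refine eq_zero_of_inner_expVec χ fun g => ?_
  set F : ℝ → ℂ := fun t => inner ℂ χ (weylOrbit κ g t : Fock V) with hF
  have hd : ∀ t, HasDerivAt F (σ * F t) t := by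
    intro t
    refine (((innerSL ℂ χ).restrictScalars ℝ).hasFDerivAt.comp_hasDerivAt t
      (hasDerivAt_weylOrbit κ g t)).congr_deriv ?_
    have h := hχ (weylOrbit κ g t)
    rw [inner_add_right, inner_smul_right] at h
    change inner ℂ χ (Complex.I • segalOp κ (weylOrbit κ g t)) = σ * inner ℂ χ _
    rw [inner_smul_right]
    linear_combination Complex.I * h - σ * inner ℂ χ (weylOrbit κ g t : Fock V) * Complex.I_mul_I
  have hconst : ∀ t, Complex.exp (-(σ * t : ℝ)) * F t = F 0 := by
    intro t
    have hd2 : ∀ t, HasDerivAt (fun t : ℝ => Complex.exp (-(σ * t : ℝ)) * F t) 0 t := by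
      intro t
      have h1 : HasDerivAt (fun t : ℝ => (-(σ * t : ℝ) : ℂ)) (-σ) t := by
        simpa using (Complex.ofRealCLM.hasDerivAt (x := t)).const_mul (-(σ : ℂ))
      refine (h1.cexp.mul (hd t)).congr_deriv ?_
      ring
    have := is_const_of_deriv_eq_zero (fun t => (hd2 t).differentiableAt)
      (fun t => (hd2 t).deriv) t 0
    simpa using this
  have hbound : ∀ t, ‖F t‖ ≤ ‖χ‖ * ‖expVec g‖ := fun t => by
    rw [← norm_weylOrbit κ g t]
    exact norm_inner_le_norm _ _
  have hF0 : F 0 = inner ℂ χ (expVec g) := by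
    simp [hF, weylOrbit, expSpanVec]
  rw [← hF0]
  have hle : ∀ s : ℝ, ‖F 0‖ ≤ Real.exp (-s) * (‖χ‖ * ‖expVec g‖) := by
    intro s
    -- The time σs is chosen because σ·(σs) = s, so letting s tend to +∞ handles both signs.
    rw [← hconst (σ * s), norm_mul, Complex.norm_exp]
    have : (-((σ * (σ * s) : ℝ) : ℂ)).re = -s := by
      rw [Complex.neg_re, Complex.ofReal_re, ← mul_assoc, ← pow_two, hσ, one_mul]
    rw [this]
    gcongr
    exact hbound _
  have hlim : Filter.Tendsto (fun s : ℝ => Real.exp (-s) * (‖χ‖ * ‖expVec g‖)) Filter.atTop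
      (nhds 0) := by
    simpa using Real.tendsto_exp_neg_atTop_nhds_zero.mul_const (‖χ‖ * ‖expVec g‖)
  exact norm_le_zero_iff.1 (ge_of_tendsto' hlim hle)

/-- Since ⟨Ty, y⟩ is real, ‖(T+i)y‖² = ‖Ty‖² + ‖y‖². -/
theorem norm_le_norm_segalOp_add (κ : V) (y : expSpan V) :
    ‖(y : Fock V)‖ ≤ ‖segalOp κ y + Complex.I • (y : Fock V)‖ := by
  have hre : (inner ℂ (segalOp κ y) (y : Fock V)).im = 0 := by
    rw [← Complex.conj_eq_iff_im, inner_conj_symm, segalOp_symmetric]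
  have h : ‖segalOp κ y + Complex.I • (y : Fock V)‖ ^ 2 = ‖segalOp κ y‖ ^ 2 + ‖(y : Fock V)‖ ^ 2 := by
    rw [@norm_add_sq ℂ, inner_smul_right, norm_smul, Complex.norm_I, one_mul]
    simp [hre]
  refine le_of_sq_le_sq ?_ (norm_nonneg _)
  rw [h]
  nlinarith [sq_nonneg ‖segalOp κ y‖]

/-- Essential self-adjointness of `a(κ) + a⁺(κ)` on the exponential vectors. -/
theorem exists_seq_of_adjoint (κ : V) (χ η : Fock V)
    (h : ∀ y : expSpan V, inner ℂ χ (segalOp κ y) = inner ℂ η (y : Fock V)) :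
    ∃ y : ℕ → expSpan V, Filter.Tendsto (fun n => (y n : Fock V)) Filter.atTop (nhds χ) ∧
      Filter.Tendsto (fun n => segalOp κ (y n)) Filter.atTop (nhds η) := by
  set R : expSpan V →ₗ[ℂ] Fock V := segalOp κ + Complex.I • (expSpan V).subtype with hR
  have hRy : ∀ y, R y = segalOp κ y + Complex.I • (y : Fock V) := fun y => rfl
  -- The deficiency space of one sign gives density of the range of T + i, so η + iχ can be
  -- approximated; the other sign is used below to identify the limit with χ.
  have hdense : Dense (LinearMap.range R : Set (Fock V)) := by
    rw [Submodule.dense_iff_topologicalClosure_eq_top,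
      Submodule.topologicalClosure_eq_top_iff, Submodule.eq_bot_iff]
    intro ψ hψ
    refine eq_zero_of_orthogonal_range κ 1 (one_pow 2) ψ fun y => ?_
    rw [← inner_conj_symm, Complex.ofReal_one, mul_one, ← hRy,
      (Submodule.mem_orthogonal _ _).1 hψ _ ⟨y, rfl⟩, map_zero]
  obtain ⟨z, hz, hlim⟩ := mem_closure_iff_seq_limit.1 (hdense (η + Complex.I • χ))
  choose y hy using hz
  have hcauchy : CauchySeq fun n => (y n : Fock V) := by
    rw [Metric.cauchySeq_iff']
    intro ε hε
    obtain ⟨N, hN⟩ := Metric.cauchySeq_iff'.1 hlim.cauchySeq ε hε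
    refine ⟨N, fun n hn => lt_of_le_of_lt ?_ (hN n hn)⟩
    rw [dist_eq_norm, dist_eq_norm, ← hy n, ← hy N, ← map_sub, hRy]
    exact norm_le_norm_segalOp_add κ (y n - y N)
  obtain ⟨w, hw⟩ := cauchySeq_tendsto_of_complete hcauchy
  have hT : Filter.Tendsto (fun n => segalOp κ (y n)) Filter.atTop
      (nhds (η + Complex.I • χ - Complex.I • w)) := by
    have h1 : (fun n => segalOp κ (y n)) = fun n => z n - Complex.I • (y n : Fock V) := by
      funext n
      rw [← hy n, hRy, add_sub_cancel_right]
    rw [h1]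
    exact hlim.sub (hw.const_smul Complex.I)
  -- Both χ and the limit w satisfy the adjoint relation with the same value of T* + i, so χ - w is
  -- orthogonal to the range of T - i.
  have hd : χ - w = 0 := by
    refine eq_zero_of_orthogonal_range κ (-1) (by norm_num) _ fun v => ?_
    have h1 : inner ℂ w (segalOp κ v) =
        inner ℂ (η + Complex.I • χ - Complex.I • w) (v : Fock V) := by
      refine tendsto_nhds_unique (hw.inner tendsto_const_nhds) ?_
      refine (hT.inner (tendsto_const_nhds (x := (v : Fock V)))).congr fun n => ?_
      exact segalOp_symmetric κ (y n) v
    rw [inner_add_right, inner_smul_right, inner_sub_left, inner_sub_left, h v, h1]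
    simp only [inner_sub_left, inner_add_left, inner_smul_left, Complex.conj_I]
    push_cast
    ring
  rw [sub_eq_zero] at hd
  subst hd
  exact ⟨y, hw, by simpa using hT⟩

/-- The matrix elements of the commutator `[a(p) + a⁺(q), B]`. -/
def commForm (p q : V) (B : Fock V →L[ℂ] Fock V) (f g : V) : ℂ :=
  inner ℂ (expDeriv f p + inner ℂ q f • expVec f) (B (expVec g)) -
    inner ℂ (expVec f) (B (inner ℂ p g • expVec g + expDeriv g q))

/-- `N` is the bounded operator defined by the commutator `[a(p) + a⁺(q), B]`. -/
def HasCommutator (p q : V) (B N : Fock V →L[ℂ] Fock V) : Prop :=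
  ∀ f g : V, matrixElement N f g = commForm p q B f g

/-- The commutator is a first order differential operator on kernels: a derivative in the direction
(p,-q) plus multiplication by a scalar function. -/
theorem commForm_eq (p q : V) (B : Fock V →L[ℂ] Fock V) (f g : V) :
    commForm p q B f g = inner ℂ (expDeriv f p) (B (expVec g))
      - inner ℂ (expVec f) (B (expDeriv g q))
      + (inner ℂ f q - inner ℂ p g) * matrixElement B f g := by
  simp only [commForm, inner_add_left, inner_smul_left, inner_conj_symm, map_add, map_smul,
    inner_add_right, inner_smul_right, matrixElement]
  ring

theorem commForm_add_label (p q p' q' : V) (B : Fock V →L[ℂ] Fock V) (f g : V) :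
    commForm (p + p') (q + q') B f g = commForm p q B f g + commForm p' q' B f g := by
  simp only [commForm_eq, expDeriv_add, inner_add_left, inner_add_right, map_add]
  ring

theorem commForm_smul_label (c : ℂ) (p q : V) (B : Fock V →L[ℂ] Fock V) (f g : V) :
    commForm ((starRingEnd ℂ) c • p) (c • q) B f g = c * commForm p q B f g := by
  simp only [commForm_eq, expDeriv_smul, inner_smul_left, inner_smul_right, map_smul,
    Complex.conj_conj]
  ring

theorem matrixElement_add (M N : Fock V →L[ℂ] Fock V) (f g : V) :
    matrixElement (M + N) f g = matrixElement M f g + matrixElement N f g :=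
  inner_add_right _ _ _

theorem matrixElement_smul (c : ℂ) (M : Fock V →L[ℂ] Fock V) (f g : V) :
    matrixElement (c • M) f g = c * matrixElement M f g :=
  inner_smul_right _ _ _

theorem commForm_add (p q : V) (M N : Fock V →L[ℂ] Fock V) (f g : V) :
    commForm p q (M + N) f g = commForm p q M f g + commForm p q N f g := by
  simp only [commForm, add_apply, inner_add_right]
  ring

theorem commForm_smul (p q : V) (c : ℂ) (M : Fock V →L[ℂ] Fock V) (f g : V) :
    commForm p q (c • M) f g = c * commForm p q M f g := by
  simp only [commForm, smul_apply, inner_smul_right]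
  ring

/-- The kernel of the identity is exp⟨f,g⟩, on which the derivative and the multiplication term
cancel. -/
theorem commForm_one (p q : V) (f g : V) : commForm p q 1 f g = 0 := by
  have h := inner_expVec_expDeriv f g q
  have h' := congrArg (starRingEnd ℂ) (inner_expVec_expDeriv g f p)
  rw [inner_conj_symm, map_mul, inner_conj_symm, ← Complex.exp_conj, inner_conj_symm] at h'
  rw [commForm_eq, matrixElement]
  simp only [one_apply_eq_self]
  rw [h, h', inner_expVec]
  ring

/-- Every label is a complex combination of labels of symmetric field operators. -/
theorem exists_label_decomposition (p q : V) :
    ∃ κ₁ κ₂ : V, p = κ₁ + (starRingEnd ℂ) Complex.I • κ₂ ∧ q = κ₁ + Complex.I • κ₂ := by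
  set κ₁ : V := (1 / 2 : ℂ) • (p + q) with hκ₁
  set κ₂ : V := (-Complex.I / 2) • (q - p) with hκ₂
  have hp : p = κ₁ + (starRingEnd ℂ) Complex.I • κ₂ := by
    rw [hκ₁, hκ₂, smul_smul, Complex.conj_I]
    have : -Complex.I * (-Complex.I / 2) = -1 / 2 := by
      linear_combination (1 / 2 : ℂ) * Complex.I_mul_I
    rw [this]
    module
  have hq : q = κ₁ + Complex.I • κ₂ := by
    rw [hκ₁, hκ₂, smul_smul]
    have : Complex.I * (-Complex.I / 2) = 1 / 2 := by
      linear_combination (-1 / 2 : ℂ) * Complex.I_mul_I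
    rw [this]
    module
  exact ⟨κ₁, κ₂, hp, hq⟩

namespace HasCommutator

theorem unique {p q : V} {B N N' : Fock V →L[ℂ] Fock V} (h : HasCommutator p q B N)
    (h' : HasCommutator p q B N') : N = N' :=
  eq_of_matrixElement fun f g => (h f g).trans (h' f g).symm

theorem add_label {p q p' q' : V} {B N N' : Fock V →L[ℂ] Fock V} (h : HasCommutator p q B N)
    (h' : HasCommutator p' q' B N') : HasCommutator (p + p') (q + q') B (N + N') := fun f g => by
  rw [matrixElement_add, commForm_add_label, h f g, h' f g]

theorem smul_label {p q : V} {B N : Fock V →L[ℂ] Fock V} (h : HasCommutator p q B N) (c : ℂ) :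
    HasCommutator ((starRingEnd ℂ) c • p) (c • q) B (c • N) := fun f g => by
  rw [matrixElement_smul, commForm_smul_label, h f g]

theorem add {p q : V} {B C N N' : Fock V →L[ℂ] Fock V} (h : HasCommutator p q B N)
    (h' : HasCommutator p q C N') : HasCommutator p q (B + C) (N + N') := fun f g => by
  rw [matrixElement_add, commForm_add, h f g, h' f g]

theorem algebraMap (p q : V) (c : ℂ) :
    HasCommutator p q (algebraMap ℂ (Fock V →L[ℂ] Fock V) c) 0 := fun f g => by
  rw [Algebra.algebraMap_eq_smul_one, commForm_smul, commForm_one, mul_zero]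
  exact inner_zero_right _

/-- The right argument is extended from single exponential vectors to their span, where the
approximating sequences of the Leibniz rule live. -/
theorem apply_expSpan {κ : V} {B N : Fock V →L[ℂ] Fock V} (h : HasCommutator κ κ B N) (f : V)
    (y : expSpan V) : inner ℂ (segalOp κ (expSpanVec f)) (B (y : Fock V)) -
      inner ℂ (expVec f) (B (segalOp κ y)) = inner ℂ (expVec f) (N (y : Fock V)) := by
  induction y using expSpan_induction with
  | hv g =>
    rw [segalOp_expSpanVec, segalOp_expSpanVec, add_comm (inner ℂ κ f • expVec f)]
    exact (h f g).symm
  | hadd x y hx hy =>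
    simp only [map_add, Submodule.coe_add, inner_add_right, ← hx, ← hy]
    ring
  | hsmul c x hx =>
    simp only [map_smul, Submodule.coe_smul, inner_smul_right, ← hx]
    ring

/-- Formally [T,BC] = [T,B]C + B[T,C], but the commutator of B has to be evaluated at C E(g), which
need not lie in the span. It does lie in the domain of the closure of T, so the identity for B
passes to the limit. -/
theorem mul_self_label {κ : V} {B C N N' : Fock V →L[ℂ] Fock V} (h : HasCommutator κ κ B N)
    (h' : HasCommutator κ κ C N') : HasCommutator κ κ (B * C) (N * C + B * N') := by
  intro f g
  -- Boundedness of [T,C] puts C E(g) in the domain of T*, with T* C E(g) = C T E(g) + [T,C] E(g).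
  have hadj : ∀ y : expSpan V, inner ℂ (C (expVec g)) (segalOp κ y) =
      inner ℂ (C (segalOp κ (expSpanVec g)) + N' (expVec g)) (y : Fock V) := by
    intro y
    induction y using expSpan_induction with
    | hv k =>
      have h1 := congrArg (starRingEnd ℂ) (h'.apply_expSpan k (expSpanVec g))
      rw [map_sub, inner_conj_symm, inner_conj_symm, inner_conj_symm, sub_eq_iff_eq_add] at h1
      rw [inner_add_left, add_comm]
      exact h1
    | hadd x y hx hy => simp only [map_add, Submodule.coe_add, inner_add_right, hx, hy]
    | hsmul c x hx => simp only [map_smul, Submodule.coe_smul, inner_smul_right, hx]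
  obtain ⟨y, hy, hTy⟩ := exists_seq_of_adjoint κ _ _ hadj
  have hlim : inner ℂ (segalOp κ (expSpanVec f)) (B (C (expVec g))) -
      inner ℂ (expVec f) (B (C (segalOp κ (expSpanVec g)) + N' (expVec g))) =
      inner ℂ (expVec f) (N (C (expVec g))) := by
    refine tendsto_nhds_unique
      (((tendsto_const_nhds (x := segalOp κ (expSpanVec f))).inner
        ((B.continuous.tendsto _).comp hy)).sub
        ((tendsto_const_nhds (x := expVec f)).inner ((B.continuous.tendsto _).comp hTy))) ?_
    refine ((tendsto_const_nhds (x := expVec f)).inner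
      ((N.continuous.tendsto _).comp hy)).congr fun n => ?_
    exact (h.apply_expSpan f (y n)).symm
  rw [segalOp_expSpanVec, segalOp_expSpanVec, add_comm (inner ℂ κ f • expVec f), map_add,
    inner_add_right] at hlim
  rw [matrixElement_add]
  change inner ℂ (expVec f) (N (C (expVec g))) + inner ℂ (expVec f) (B (N' (expVec g))) =
    inner ℂ _ (B (C (expVec g))) - inner ℂ _ (B (C _))
  rw [← hlim]
  ring

/-- The Leibniz rule for commutators with `a(p) + a⁺(q)`. -/
theorem mul {p q : V} {B C N N' : Fock V →L[ℂ] Fock V}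
    (hB : ∀ κ, ∃ N, HasCommutator κ κ B N) (hC : ∀ κ, ∃ N, HasCommutator κ κ C N)
    (h : HasCommutator p q B N) (h' : HasCommutator p q C N') :
    HasCommutator p q (B * C) (N * C + B * N') := by
  obtain ⟨κ₁, κ₂, hp, hq⟩ := exists_label_decomposition p q
  obtain ⟨N₁, h₁⟩ := hB κ₁
  obtain ⟨N₂, h₂⟩ := hB κ₂
  obtain ⟨N₁', h₁'⟩ := hC κ₁
  obtain ⟨N₂', h₂'⟩ := hC κ₂
  rw [hp, hq] at h h' ⊢
  -- The given commutators must be the combinations N₁ + iN₂ of those with the two symmetric fields,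
  -- so the symmetric case suffices.
  rw [h.unique (h₁.add_label (h₂.smul_label Complex.I)),
    h'.unique (h₁'.add_label (h₂'.smul_label Complex.I))]
  have hmul := (h₁.mul_self_label h₁').add_label ((h₂.mul_self_label h₂').smul_label Complex.I)
  convert hmul using 1
  simp only [add_mul, mul_add, smul_mul_assoc, mul_smul_comm, smul_add]
  abel

end HasCommutator

/-- Kernels are antiholomorphic in f and holomorphic in g, so only real parameters t are used when
both arguments move. -/
theorem hasDerivAt_matrixElement (B : Fock V →L[ℂ] Fock V) (f g v w : V) (t : ℝ) :
    HasDerivAt (fun t : ℝ => matrixElement B (f + (t : ℂ) • v) (g + (t : ℂ) • w))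
      (inner ℂ (expDeriv (f + (t : ℂ) • v) v) (B (expVec (g + (t : ℂ) • w))) +
        inner ℂ (expVec (f + (t : ℂ) • v)) (B (expDeriv (g + (t : ℂ) • w) w))) t := by
  have h1 := hasDerivAt_expVec_line f v 1 t
  have h2 := (B.restrictScalars ℝ).hasFDerivAt.comp_hasDerivAt t (hasDerivAt_expVec_line g w 1 t)
  simp only [one_mul, one_smul] at h1 h2
  refine (HasDerivAt.inner ℂ h1 h2).congr_deriv ?_
  rw [add_comm]
  rfl

end Commutators

/-! ### Uniqueness of complex measures on the plane with a given Fourier transform. -/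

section FourierUniqueness

open MeasureTheory

/-- The character `(x, y) ↦ exp (i (s x + t y))` of the plane. -/
def planeChar (s t : ℝ) (p : ℝ × ℝ) : ℂ := Complex.exp (Complex.I * (s * p.1 + t * p.2))

theorem norm_planeChar (s t : ℝ) (p : ℝ × ℝ) : ‖planeChar s t p‖ = 1 := by
  rw [planeChar, Complex.norm_exp]
  simp

theorem continuous_planeChar (s t : ℝ) : Continuous (planeChar s t) := by
  unfold planeChar
  fun_prop

theorem conj_planeChar (s t : ℝ) (p : ℝ × ℝ) :
    (starRingEnd ℂ) (planeChar s t p) = planeChar (-s) (-t) p := by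
  rw [planeChar, planeChar, ← Complex.exp_conj]
  congr 1
  simp
  ring

theorem integrable_planeChar_mul {m : Measure (ℝ × ℝ)} {ρ : ℝ × ℝ → ℂ} (hρ : Integrable ρ m)
    (s t : ℝ) : Integrable (fun p => planeChar s t p * ρ p) m :=
  hρ.bdd_mul (c := 1) (continuous_planeChar s t).aestronglyMeasurable
    (Filter.Eventually.of_forall fun p => (norm_planeChar s t p).le)

/-- The positive and negative parts of u are densities of two finite measures with the same
characteristic function. These measures agree, and at each point at least one of the two parts is
zero. -/
theorem ae_eq_zero_of_fourier_eq_zero_real {m : Measure (ℝ × ℝ)} {u : ℝ × ℝ → ℝ}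
    (hu : Integrable u m) (h : ∀ s t : ℝ, ∫ p, planeChar s t p * (u p : ℂ) ∂m = 0) :
    u =ᵐ[m] 0 := by
  have hmeas : AEMeasurable (fun p => ENNReal.ofReal (u p)) m := hu.aemeasurable.ennreal_ofReal
  have hmeas' : AEMeasurable (fun p => ENNReal.ofReal (-u p)) m :=
    hu.aemeasurable.neg.ennreal_ofReal
  have hfin : ∫⁻ p, ENNReal.ofReal (u p) ∂m ≠ ⊤ := hu.lintegral_lt_top.ne
  have hfin' : ∫⁻ p, ENNReal.ofReal (-u p) ∂m ≠ ⊤ := hu.neg.lintegral_lt_top.ne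
  have := isFiniteMeasure_withDensity hfin
  have := isFiniteMeasure_withDensity hfin'
  have heq : m.withDensity (fun p => ENNReal.ofReal (u p)) =
      m.withDensity (fun p => ENNReal.ofReal (-u p)) := by
    refine Measure.ext_of_charFunDual (funext fun L => ?_)
    have hL : ∀ p : ℝ × ℝ, Complex.exp (L p * Complex.I) = planeChar (L (1, 0)) (L (0, 1)) p := by
      intro p
      have hp : p = p.1 • ((1, 0) : ℝ × ℝ) + p.2 • ((0, 1) : ℝ × ℝ) := by ext <;> simp
      rw [planeChar]
      congr 1
      conv_lhs => rw [hp, map_add, map_smul, map_smul]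
      simp
      ring
    rw [charFunDual_apply, charFunDual_apply,
      integral_withDensity_eq_integral_toReal_smul₀ hmeas (by simp),
      integral_withDensity_eq_integral_toReal_smul₀ hmeas' (by simp), ← sub_eq_zero]
    have hint : ∀ v : ℝ × ℝ → ℝ, Integrable v m → Integrable
        (fun p => (ENNReal.ofReal (v p)).toReal • Complex.exp (L p * Complex.I)) m := by
      intro v hv
      have h1 : Integrable (fun p => (((ENNReal.ofReal (v p)).toReal : ℝ) : ℂ)) m := by
        refine (hv.pos_part).ofReal.congr (Filter.Eventually.of_forall fun p => ?_)
        simp only [ENNReal.toReal_ofReal']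
        rfl
      refine (integrable_planeChar_mul h1 (L (1, 0)) (L (0, 1))).congr
        (Filter.Eventually.of_forall fun p => ?_)
      simp only [hL, Complex.real_smul]
      rw [mul_comm]
    rw [← integral_sub (hint u hu) (hint (fun p => -u p) hu.neg), ← h (L (1, 0)) (L (0, 1))]
    refine integral_congr_ae (Filter.Eventually.of_forall fun p => ?_)
    simp only [hL, Complex.real_smul, ENNReal.toReal_ofReal']
    have : ((max (u p) 0 : ℝ) : ℂ) - ((max (-u p) 0 : ℝ) : ℂ) = (u p : ℂ) := by
      rw [← Complex.ofReal_sub, max_zero_sub_max_neg_zero_eq_self]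
    linear_combination planeChar (L (1, 0)) (L (0, 1)) p * this
  have hae := (withDensity_eq_iff hmeas hmeas' hfin).1 heq
  filter_upwards [hae] with p hp
  rcases le_total (u p) 0 with h1 | h1
  · rw [ENNReal.ofReal_of_nonpos h1, eq_comm, ENNReal.ofReal_eq_zero] at hp
    exact le_antisymm h1 (neg_nonpos.1 hp)
  · rw [ENNReal.ofReal_of_nonpos (neg_nonpos.2 h1), ENNReal.ofReal_eq_zero] at hp
    exact le_antisymm hp h1

/-- Conjugating the hypothesis at (-s,-t) shows that the conjugate density also has zero transform,
hence so do the real and imaginary parts. -/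
theorem ae_eq_zero_of_fourier_eq_zero {m : Measure (ℝ × ℝ)} {ρ : ℝ × ℝ → ℂ}
    (hρ : Integrable ρ m) (h : ∀ s t : ℝ, ∫ p, planeChar s t p * ρ p ∂m = 0) : ρ =ᵐ[m] 0 := by
  have hconj : ∀ s t : ℝ, ∫ p, planeChar s t p * (starRingEnd ℂ) (ρ p) ∂m = 0 := by
    intro s t
    have h1 := congrArg (starRingEnd ℂ) (h (-s) (-t))
    rw [← integral_conj, map_zero] at h1
    simpa only [map_mul, conj_planeChar, neg_neg] using h1
  have hρc : Integrable (fun p => (starRingEnd ℂ) (ρ p)) m :=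
    (LinearIsometryEquiv.integrable_comp_iff Complex.conjLIE).2 hρ
  have hre : (fun p => (ρ p).re) =ᵐ[m] 0 := by
    refine ae_eq_zero_of_fourier_eq_zero_real hρ.re fun s t => ?_
    have : ∀ p, planeChar s t p * ((ρ p).re : ℂ) = (1 / 2 : ℂ) * (planeChar s t p * ρ p +
        planeChar s t p * (starRingEnd ℂ) (ρ p)) := by
      intro p
      rw [Complex.re_eq_add_conj]
      ring
    simp only [this]
    rw [integral_const_mul, integral_add (integrable_planeChar_mul hρ s t)
      (integrable_planeChar_mul hρc s t), h, hconj, add_zero, mul_zero]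
  have him : (fun p => (ρ p).im) =ᵐ[m] 0 := by
    refine ae_eq_zero_of_fourier_eq_zero_real hρ.im fun s t => ?_
    have : ∀ p, planeChar s t p * ((ρ p).im : ℂ) = (-Complex.I / 2 : ℂ) * (planeChar s t p * ρ p -
        planeChar s t p * (starRingEnd ℂ) (ρ p)) := by
      intro p
      rw [Complex.im_eq_sub_conj]
      field_simp
      linear_combination (planeChar s t p * ρ p - planeChar s t p * (starRingEnd ℂ) (ρ p)) *
        Complex.I_sq
    simp only [this]
    rw [integral_const_mul, integral_sub (integrable_planeChar_mul hρ s t)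
      (integrable_planeChar_mul hρc s t), h, hconj, sub_zero, mul_zero]
  filter_upwards [hre, him] with p h1 h2
  exact Complex.ext h1 h2

/-- The measure m is arbitrary, so Radon-Nikodym is applied to the finite measure |ρ|m instead; the
phase ρ/|ρ| is put back into the density. -/
theorem exists_density_of_absolutelyContinuous {m l : Measure (ℝ × ℝ)} [IsFiniteMeasure l]
    {ρ : ℝ × ℝ → ℂ} (hρ : Integrable ρ m) (hl : m.withDensity (fun p => ‖ρ p‖ₑ) ≪ l) :
    ∃ r : ℝ × ℝ → ℂ, ∀ ψ : ℝ × ℝ → ℂ,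
      (Integrable (fun p => ψ p * r p) l ↔ Integrable (fun p => ψ p * ρ p) m) ∧
      ∫ p, ψ p * r p ∂l = ∫ p, ψ p * ρ p ∂m := by
  set ν := m.withDensity (fun p => ‖ρ p‖ₑ) with hν
  have : IsFiniteMeasure ν := isFiniteMeasure_withDensity hρ.2.ne
  have hsgn : ∀ (ψ : ℝ × ℝ → ℂ) p,
      ψ p * ρ p = (‖ρ p‖ₑ).toReal • (ψ p * (ρ p / ‖ρ p‖)) := by
    intro ψ p
    rw [toReal_enorm, Complex.real_smul]
    rcases eq_or_ne (ρ p) 0 with h0 | h0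
    · simp [h0]
    · have : (‖ρ p‖ : ℂ) ≠ 0 := by simpa using h0
      field_simp
  refine ⟨fun p => (ν.rnDeriv l p).toReal • (ρ p / ‖ρ p‖), fun ψ => ?_⟩
  have h1 : (fun p => ψ p * (ν.rnDeriv l p).toReal • (ρ p / ‖ρ p‖)) =
      fun p => (ν.rnDeriv l p).toReal • (ψ p * (ρ p / ‖ρ p‖)) :=
    funext fun p => mul_smul_comm _ _ _
  have hmeas : AEMeasurable (fun p => ‖ρ p‖ₑ) m := hρ.1.enorm
  simp only [h1, hsgn ψ]
  rw [integrable_rnDeriv_smul_iff hl, integral_rnDeriv_smul hl, hν,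
    integrable_withDensity_iff_integrable_smul₀' hmeas (by simp),
    integral_withDensity_eq_integral_toReal_smul₀ hmeas (by simp)]
  exact ⟨Iff.rfl, rfl⟩

/-- A complex measure on the plane is determined by its Fourier transform. -/
theorem integral_eq_of_fourier_eq {m m' : Measure (ℝ × ℝ)} {ρ ρ' : ℝ × ℝ → ℂ}
    (hρ : Integrable ρ m) (hρ' : Integrable ρ' m')
    (h : ∀ s t : ℝ, ∫ p, planeChar s t p * ρ p ∂m = ∫ p, planeChar s t p * ρ' p ∂m')
    (ψ : ℝ × ℝ → ℂ) :
    (Integrable (fun p => ψ p * ρ p) m ↔ Integrable (fun p => ψ p * ρ' p) m') ∧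
      ∫ p, ψ p * ρ p ∂m = ∫ p, ψ p * ρ' p ∂m' := by
  have : IsFiniteMeasure (m.withDensity (fun p => ‖ρ p‖ₑ)) :=
    isFiniteMeasure_withDensity hρ.2.ne
  have : IsFiniteMeasure (m'.withDensity (fun p => ‖ρ' p‖ₑ)) :=
    isFiniteMeasure_withDensity hρ'.2.ne
  -- A common finite dominating measure, over which the two complex measures can be compared as
  -- densities.
  set l := m.withDensity (fun p => ‖ρ p‖ₑ) + m'.withDensity (fun p => ‖ρ' p‖ₑ) with hl
  obtain ⟨r, hr⟩ := exists_density_of_absolutelyContinuous (l := l) hρ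
    (Measure.AbsolutelyContinuous.rfl.add_right _)
  obtain ⟨r', hr'⟩ := exists_density_of_absolutelyContinuous (l := l) hρ'
    (by rw [hl, add_comm]; exact Measure.AbsolutelyContinuous.rfl.add_right _)
  have hrint : Integrable r l := by
    simpa using (hr 1).1.2 (by simpa using hρ)
  have hrint' : Integrable r' l := by
    simpa using (hr' 1).1.2 (by simpa using hρ')
  have hae : r - r' =ᵐ[l] 0 := by
    refine ae_eq_zero_of_fourier_eq_zero (hrint.sub hrint') fun s t => ?_
    simp only [Pi.sub_apply, mul_sub]
    rw [integral_sub (integrable_planeChar_mul hrint s t) (integrable_planeChar_mul hrint' s t),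
      (hr _).2, (hr' _).2, h, sub_self]
  have hψ : (fun p => ψ p * r p) =ᵐ[l] fun p => ψ p * r' p := by
    filter_upwards [hae] with p hp
    rw [sub_eq_zero.1 hp]
  exact ⟨by rw [← (hr ψ).1, ← (hr' ψ).1, integrable_congr hψ],
    by rw [← (hr ψ).2, ← (hr' ψ).2, integral_congr_ae hψ]⟩

end FourierUniqueness

/-! ### Complex Gaussian densities, their shifts, and differentiation along shifts. -/

section GaussianDensities

open MeasureTheory ProbabilityTheory Complexification

variable {𝔥 : Type u} [NormedAddCommGroup 𝔥] [InnerProductSpace ℝ 𝔥]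

/-- The product of the centered Gaussian measures with variances `‖h₁‖²` and `‖h₂‖²`. -/
def gaussPlane (h : 𝔥 × 𝔥) : Measure (ℝ × ℝ) :=
  (gaussianReal 0 (‖h.1‖₊ ^ 2)).prod (gaussianReal 0 (‖h.2‖₊ ^ 2))

instance (h : 𝔥 × 𝔥) : IsProbabilityMeasure (gaussPlane h) := by
  unfold gaussPlane
  infer_instance

/-- The quadratic form `‖h₁‖² ζ₁² + ‖h₂‖² ζ₂²`. -/
def gaussQuad (h : 𝔥 × 𝔥) (ζ : ℂ × ℂ) : ℂ := (‖h.1‖ : ℂ) ^ 2 * ζ.1 ^ 2 + (‖h.2‖ : ℂ) ^ 2 * ζ.2 ^ 2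

/-- The density of the Gaussian measure with mean `(‖h₁‖² ζ₁, ‖h₂‖² ζ₂)` with respect to the
centered one. -/
def gaussDensity (h : 𝔥 × 𝔥) (ζ : ℂ × ℂ) (p : ℝ × ℝ) : ℂ :=
  Complex.exp (-(gaussQuad h ζ / 2)) * (Complex.exp (ζ.1 * p.1) * Complex.exp (ζ.2 * p.2))

theorem continuous_gaussDensity (h : 𝔥 × 𝔥) (ζ : ℂ × ℂ) : Continuous (gaussDensity h ζ) := by
  unfold gaussDensity
  fun_prop

theorem integrable_cexp_gaussianReal (v : NNReal) (z : ℂ) :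
    Integrable (fun x : ℝ => Complex.exp (z * x)) (gaussianReal 0 v) := by
  refine (integrable_exp_mul_gaussianReal (μ := 0) (v := v) z.re).mono'
    (by fun_prop) (Filter.Eventually.of_forall fun x => ?_)
  rw [Complex.norm_exp]
  simp

theorem integral_cexp_gaussianReal (v : NNReal) (z : ℂ) :
    ∫ x : ℝ, Complex.exp (z * x) ∂(gaussianReal 0 v) = Complex.exp (v * z ^ 2 / 2) := by
  have := complexMGF_id_gaussianReal (μ := 0) (v := v) z
  simpa [complexMGF] using this

theorem integrable_gaussDensity (h : 𝔥 × 𝔥) (ζ : ℂ × ℂ) :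
    Integrable (gaussDensity h ζ) (gaussPlane h) :=
  ((integrable_cexp_gaussianReal _ ζ.1).mul_prod (integrable_cexp_gaussianReal _ ζ.2)).const_mul _

theorem fourier_gaussDensity (h : 𝔥 × 𝔥) (ζ : ℂ × ℂ) (s t : ℝ) :
    ∫ p, planeChar s t p * gaussDensity h ζ p ∂(gaussPlane h) =
      Complex.exp (Complex.I * (s * ((‖h.1‖ : ℂ) ^ 2 * ζ.1) + t * ((‖h.2‖ : ℂ) ^ 2 * ζ.2))
        - (s ^ 2 * (‖h.1‖ : ℂ) ^ 2 + t ^ 2 * (‖h.2‖ : ℂ) ^ 2) / 2) := by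
  have h1 : ∀ p : ℝ × ℝ, planeChar s t p * gaussDensity h ζ p =
      Complex.exp (-(gaussQuad h ζ / 2)) * (Complex.exp ((Complex.I * s + ζ.1) * p.1) *
        Complex.exp ((Complex.I * t + ζ.2) * p.2)) := by
    intro p
    simp only [planeChar, gaussDensity, ← Complex.exp_add]
    congr 1
    ring
  simp only [h1]
  rw [integral_const_mul, gaussPlane, integral_prod_mul
    (fun x : ℝ => Complex.exp ((Complex.I * s + ζ.1) * x))
    (fun x : ℝ => Complex.exp ((Complex.I * t + ζ.2) * x)),
    integral_cexp_gaussianReal, integral_cexp_gaussianReal, ← Complex.exp_add, ← Complex.exp_add]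
  congr 1
  simp only [gaussQuad, NNReal.coe_pow, coe_nnnorm, Complex.ofReal_pow]
  linear_combination (s ^ 2 * (‖h.1‖ : ℂ) ^ 2 / 2 + t ^ 2 * (‖h.2‖ : ℂ) ^ 2 / 2) * Complex.I_sq

/-- The Cameron-Martin shift of a complex Gaussian density. -/
theorem integral_gaussDensity_shift (h : 𝔥 × 𝔥) (ζ : ℂ × ℂ) (κ : ℝ × ℝ) (ψ : ℝ × ℝ → ℂ) :
    (Integrable (fun p => ψ (p + (‖h.1‖ ^ 2 * κ.1, ‖h.2‖ ^ 2 * κ.2)) * gaussDensity h ζ p)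
        (gaussPlane h) ↔
      Integrable (fun p => ψ p * gaussDensity h (ζ + ((κ.1 : ℂ), (κ.2 : ℂ))) p) (gaussPlane h)) ∧
    ∫ p, ψ (p + (‖h.1‖ ^ 2 * κ.1, ‖h.2‖ ^ 2 * κ.2)) * gaussDensity h ζ p ∂(gaussPlane h) =
      ∫ p, ψ p * gaussDensity h (ζ + ((κ.1 : ℂ), (κ.2 : ℂ))) p ∂(gaussPlane h) := by
  set r : ℝ × ℝ := (‖h.1‖ ^ 2 * κ.1, ‖h.2‖ ^ 2 * κ.2) with hr
  have he : MeasurableEmbedding (fun p : ℝ × ℝ => p + r) :=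
    (Homeomorph.addRight r).measurableEmbedding
  have hmap : ∀ χ : ℝ × ℝ → ℂ,
      (Integrable (fun p => χ p * gaussDensity h ζ (p - r)) ((gaussPlane h).map (· + r)) ↔
        Integrable (fun p => χ (p + r) * gaussDensity h ζ p) (gaussPlane h)) ∧
      ∫ p, χ p * gaussDensity h ζ (p - r) ∂((gaussPlane h).map (· + r)) =
        ∫ p, χ (p + r) * gaussDensity h ζ p ∂(gaussPlane h) := by
    intro χ
    rw [he.integrable_map_iff, he.integral_map]
    simp only [Function.comp_def, add_sub_cancel_right]
    exact ⟨trivial, trivial⟩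
  rw [← (hmap ψ).1, ← (hmap ψ).2]
  -- Comparing Fourier transforms instead of densities also covers vanishing variances, where a
  -- Gaussian factor is a Dirac mass.
  refine integral_eq_of_fourier_eq ?_ (integrable_gaussDensity h _) (fun s t => ?_) ψ
  · simpa using (hmap 1).1.2 (by simpa using integrable_gaussDensity h ζ)
  · rw [(hmap _).2, fourier_gaussDensity]
    have h1 : ∀ p : ℝ × ℝ, planeChar s t (p + r) * gaussDensity h ζ p =
        planeChar s t r * (planeChar s t p * gaussDensity h ζ p) := by
      intro p
      rw [← mul_assoc]
      congr 1
      rw [planeChar, planeChar, planeChar, ← Complex.exp_add]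
      congr 1
      simp
      ring
    simp only [h1]
    rw [integral_const_mul, fourier_gaussDensity, planeChar, ← Complex.exp_add]
    congr 1
    simp [hr]
    ring

theorem norm_gaussDensity (h : 𝔥 × 𝔥) (ζ : ℂ × ℂ) (p : ℝ × ℝ) :
    ‖gaussDensity h ζ p‖ =
      Real.exp (-((gaussQuad h ζ).re / 2)) * Real.exp (ζ.1.re * p.1 + ζ.2.re * p.2) := by
  rw [gaussDensity, norm_mul, norm_mul, Complex.norm_exp, Complex.norm_exp, Complex.norm_exp,
    ← Real.exp_add]
  congr 2
  · simp
  · simp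

/-- The exponential is monotone along the segment, so one of the endpoints dominates. -/
theorem exp_segment_le (A B s c : ℝ) (hs : 0 ≤ s) (hsc : s ≤ c) :
    Real.exp (A + s * B) ≤ Real.exp A + Real.exp (A + c * B) := by
  rcases le_total B 0 with hB | hB
  · have : Real.exp (A + s * B) ≤ Real.exp A := Real.exp_le_exp.2 (by nlinarith)
    linarith [Real.exp_pos (A + c * B)]
  · have : Real.exp (A + s * B) ≤ Real.exp (A + c * B) := Real.exp_le_exp.2 (by nlinarith)
    linarith [Real.exp_pos A]

theorem gaussQuad_ofReal (h : 𝔥 × 𝔥) (κ : ℝ × ℝ) :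
    gaussQuad h ((κ.1 : ℂ), (κ.2 : ℂ)) =
      ((‖h.1‖ ^ 2 * κ.1 ^ 2 + ‖h.2‖ ^ 2 * κ.2 ^ 2 : ℝ) : ℂ) := by
  simp [gaussQuad]

/-- A uniform bound that makes Fubini applicable. The modulus of the density with parameter ζ is a
multiple of the one with parameter Re ζ; after the shift the parameter is Re ζ + sκ, and its
exponential is controlled by the two endpoints s = 0 and s = c. -/
theorem norm_integral_shift_le (h : 𝔥 × 𝔥) (ζ : ℂ × ℂ) (κ : ℝ × ℝ) (c : ℝ) (ψ : ℝ × ℝ → ℂ)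
    (h0 : Integrable (fun p => ψ p * gaussDensity h ζ p) (gaussPlane h))
    (hc : Integrable (fun p => ψ p * gaussDensity h (ζ + (((c * κ.1 : ℝ) : ℂ), ((c * κ.2 : ℝ) : ℂ))) p)
      (gaussPlane h)) :
    ∃ K : ℝ, ∀ s, 0 ≤ s → s ≤ c →
      ∫ p, ‖ψ (p + (‖h.1‖ ^ 2 * (s * κ.1), ‖h.2‖ ^ 2 * (s * κ.2))) * gaussDensity h ζ p‖
        ∂(gaussPlane h) ≤ K := by
  set w : ℝ × ℝ := (ζ.1.re, ζ.2.re) with hw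
  set e : ℝ → ℝ × ℝ → ℝ := fun s p =>
    Real.exp ((w.1 * p.1 + w.2 * p.2) + s * (κ.1 * p.1 + κ.2 * p.2)) with he
  have hint : ∀ s : ℝ, Integrable (fun p => ψ p * gaussDensity h
      (ζ + (((s * κ.1 : ℝ) : ℂ), ((s * κ.2 : ℝ) : ℂ))) p) (gaussPlane h) →
      Integrable (fun p => ‖ψ p‖ * e s p) (gaussPlane h) := by
    intro s hs
    refine (hs.norm.const_mul (Real.exp ((gaussQuad h
      (ζ + (((s * κ.1 : ℝ) : ℂ), ((s * κ.2 : ℝ) : ℂ)))).re / 2))).congr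
        (Filter.Eventually.of_forall fun p => ?_)
    simp only [norm_mul, norm_gaussDensity]
    have h1 : ∀ x y z : ℝ, Real.exp x * (y * (Real.exp (-x) * z)) = y * z := by
      intro x y z
      rw [Real.exp_neg]
      field_simp
    rw [h1, he]
    congr 2
    simp [hw]
    ring
  have hi0 : Integrable (fun p => ‖ψ p‖ * e 0 p) (gaussPlane h) := hint 0 (by simpa [Prod.mk_zero_zero] using h0)
  have hic := hint c hc
  -- The ratio of the normalizing factors of the densities with parameters ζ and Re ζ.
  set C : ℝ := Real.exp (-((gaussQuad h ζ).re / 2)) *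
    Real.exp ((gaussQuad h ((w.1 : ℂ), (w.2 : ℂ))).re / 2) with hC
  refine ⟨C * ∫ p, (‖ψ p‖ * e 0 p + ‖ψ p‖ * e c p) ∂(gaussPlane h), fun s hs hsc => ?_⟩
  have hdens : ∀ p, ((‖gaussDensity h ζ p‖ : ℝ) : ℂ) =
      C * gaussDensity h ((w.1 : ℂ), (w.2 : ℂ)) p := by
    intro p
    rw [norm_gaussDensity, hC, gaussDensity, gaussQuad_ofReal, ← Complex.exp_add]
    rw [Complex.ofReal_re]
    push_cast
    simp only [← Complex.exp_add]
    congr 1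
    simp only [hw]
    ring
  have hnorm : ∀ q, ‖gaussDensity h (((w.1 : ℂ), (w.2 : ℂ)) +
      (((s * κ.1 : ℝ) : ℂ), ((s * κ.2 : ℝ) : ℂ))) q‖ ≤ e s q := by
    intro q
    have h1 : (((w.1 : ℂ), (w.2 : ℂ)) + (((s * κ.1 : ℝ) : ℂ), ((s * κ.2 : ℝ) : ℂ)) : ℂ × ℂ) =
      (((w.1 + s * κ.1 : ℝ) : ℂ), ((w.2 + s * κ.2 : ℝ) : ℂ)) := by
      ext <;> simp
    rw [norm_gaussDensity, h1, gaussQuad_ofReal h (w.1 + s * κ.1, w.2 + s * κ.2)]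
    have h2 : Real.exp (-((((‖h.1‖ ^ 2 * (w.1 + s * κ.1) ^ 2 + ‖h.2‖ ^ 2 * (w.2 + s * κ.2) ^ 2 : ℝ)
        : ℂ)).re / 2)) ≤ 1 := by
      rw [Real.exp_le_one_iff, Complex.ofReal_re]
      have : 0 ≤ ‖h.1‖ ^ 2 * (w.1 + s * κ.1) ^ 2 + ‖h.2‖ ^ 2 * (w.2 + s * κ.2) ^ 2 := by positivity
      linarith
    refine (mul_le_of_le_one_left (Real.exp_pos _).le h2).trans_eq ?_
    rw [he]
    congr 1
    simp only [Complex.ofReal_re]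
    ring
  have hshift := (integral_gaussDensity_shift h ((w.1 : ℂ), (w.2 : ℂ)) (s * κ.1, s * κ.2)
    (fun p => (‖ψ p‖ : ℂ))).2
  have hreal : ((∫ p, ‖ψ (p + (‖h.1‖ ^ 2 * (s * κ.1), ‖h.2‖ ^ 2 * (s * κ.2))) *
      gaussDensity h ζ p‖ ∂(gaussPlane h) : ℝ) : ℂ) =
      C * ∫ p, (‖ψ p‖ : ℂ) * gaussDensity h (((w.1 : ℂ), (w.2 : ℂ)) +
        (((s * κ.1 : ℝ) : ℂ), ((s * κ.2 : ℝ) : ℂ))) p ∂(gaussPlane h) := by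
    rw [← integral_complex_ofReal, ← hshift, ← integral_const_mul]
    refine integral_congr_ae (Filter.Eventually.of_forall fun p => ?_)
    simp only [norm_mul, Complex.ofReal_mul, hdens]
    ring
  have hpos : 0 ≤ C := by positivity
  have hle : ‖∫ p, (‖ψ p‖ : ℂ) * gaussDensity h (((w.1 : ℂ), (w.2 : ℂ)) +
        (((s * κ.1 : ℝ) : ℂ), ((s * κ.2 : ℝ) : ℂ))) p ∂(gaussPlane h)‖ ≤
      ∫ p, (‖ψ p‖ * e 0 p + ‖ψ p‖ * e c p) ∂(gaussPlane h) := by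
    refine norm_integral_le_of_norm_le (hi0.add hic) (Filter.Eventually.of_forall fun p => ?_)
    rw [norm_mul, Complex.norm_real, norm_norm, ← mul_add]
    refine mul_le_mul_of_nonneg_left ((hnorm p).trans ?_) (norm_nonneg _)
    simp only [he, zero_mul, add_zero]
    exact exp_segment_le _ _ _ _ hs hsc
  calc ∫ p, ‖ψ (p + (‖h.1‖ ^ 2 * (s * κ.1), ‖h.2‖ ^ 2 * (s * κ.2))) *
        gaussDensity h ζ p‖ ∂(gaussPlane h) ≤ ‖((∫ p, ‖ψ (p + (‖h.1‖ ^ 2 * (s * κ.1),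
          ‖h.2‖ ^ 2 * (s * κ.2))) * gaussDensity h ζ p‖ ∂(gaussPlane h) : ℝ) : ℂ)‖ := by
        rw [Complex.norm_real]
        exact le_abs_self _
    _ ≤ _ := by
        rw [hreal, norm_mul, Complex.norm_real, Real.norm_of_nonneg hpos]
        gcongr

/-- The derivative of the Gaussian average of a smooth function along a shift. -/
theorem integral_shift_sub_eq (h : 𝔥 × 𝔥) (ζ : ℂ × ℂ) (κ : ℝ × ℝ) (c : ℝ) (hc : 0 ≤ c)
    (φ ψ : ℝ × ℝ → ℂ) (hψ : Continuous ψ)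
    (hφ : ∀ (p : ℝ × ℝ) (s : ℝ), HasDerivAt
      (fun s : ℝ => φ (p + (‖h.1‖ ^ 2 * (s * κ.1), ‖h.2‖ ^ 2 * (s * κ.2))))
      (ψ (p + (‖h.1‖ ^ 2 * (s * κ.1), ‖h.2‖ ^ 2 * (s * κ.2)))) s)
    (hφi : ∀ s : ℝ, Integrable (fun p => φ p * gaussDensity h
      (ζ + (((s * κ.1 : ℝ) : ℂ), ((s * κ.2 : ℝ) : ℂ))) p) (gaussPlane h))
    (hψi : ∀ s : ℝ, Integrable (fun p => ψ p * gaussDensity h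
      (ζ + (((s * κ.1 : ℝ) : ℂ), ((s * κ.2 : ℝ) : ℂ))) p) (gaussPlane h)) :
    ∫ p, φ p * gaussDensity h (ζ + (((c * κ.1 : ℝ) : ℂ), ((c * κ.2 : ℝ) : ℂ))) p ∂(gaussPlane h) -
      ∫ p, φ p * gaussDensity h ζ p ∂(gaussPlane h) =
    ∫ s in (0 : ℝ)..c, ∫ p, ψ p * gaussDensity h
      (ζ + (((s * κ.1 : ℝ) : ℂ), ((s * κ.2 : ℝ) : ℂ))) p ∂(gaussPlane h) := by
  set r : ℝ → ℝ × ℝ := fun s => (‖h.1‖ ^ 2 * (s * κ.1), ‖h.2‖ ^ 2 * (s * κ.2)) with hr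
  have hrc : Continuous r := by fun_prop
  have hF : Continuous (Function.uncurry fun (s : ℝ) (p : ℝ × ℝ) =>
      ψ (p + r s) * gaussDensity h ζ p) :=
    (hψ.comp (continuous_snd.add (hrc.comp continuous_fst))).mul
      ((continuous_gaussDensity h ζ).comp continuous_snd)
  obtain ⟨K, hK⟩ := norm_integral_shift_le h ζ κ c ψ (by simpa [Prod.mk_zero_zero] using hψi 0) (hψi c)
  have hInt : Integrable (Function.uncurry fun (s : ℝ) (p : ℝ × ℝ) =>
      ψ (p + r s) * gaussDensity h ζ p) ((volume.restrict (Set.uIoc 0 c)).prod (gaussPlane h)) := by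
    have hmeas := hF.aestronglyMeasurable
      (μ := (volume.restrict (Set.uIoc 0 c)).prod (gaussPlane h))
    refine (integrable_prod_iff hmeas).2 ⟨Filter.Eventually.of_forall fun s => ?_, ?_⟩
    · exact (integral_gaussDensity_shift h ζ (s * κ.1, s * κ.2) ψ).1.2 (hψi s)
    · refine Integrable.mono' (g := fun _ => K) (integrableOn_const (by simp)) hmeas.norm.integral_prod_right' ?_
      rw [Set.uIoc_of_le hc]
      refine (ae_restrict_mem measurableSet_Ioc).mono fun s hs => ?_
      rw [Real.norm_of_nonneg (integral_nonneg fun p => norm_nonneg _)]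
      exact hK s hs.1.le hs.2
  have h1 : ∀ s, ∫ p, ψ p * gaussDensity h
      (ζ + (((s * κ.1 : ℝ) : ℂ), ((s * κ.2 : ℝ) : ℂ))) p ∂(gaussPlane h) =
      ∫ p, ψ (p + r s) * gaussDensity h ζ p ∂(gaussPlane h) := fun s =>
    ((integral_gaussDensity_shift h ζ (s * κ.1, s * κ.2) ψ).2).symm
  simp only [h1]
  -- With the shift moved onto the functions, Fubini reduces the claim to the fundamental theorem of
  -- calculus for φ at each point p.
  rw [intervalIntegral_integral_swap hInt,
    ← (integral_gaussDensity_shift h ζ (c * κ.1, c * κ.2) φ).2, ← integral_sub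
      ((integral_gaussDensity_shift h ζ (c * κ.1, c * κ.2) φ).1.2 (hφi c))
      (by simpa [Prod.mk_zero_zero] using hφi 0)]
  refine integral_congr_ae (Filter.Eventually.of_forall fun p => ?_)
  simp only
  rw [intervalIntegral.integral_mul_const,
    intervalIntegral.integral_eq_sub_of_hasDerivAt (fun s _ => hφ p s)
      ((hψ.comp (continuous_const.add hrc)).intervalIntegrable _ _)]
  simp [Prod.mk_zero_zero]
  ring

end GaussianDensities

/-! ### Matrix elements of O_h(φ) and their commutators with symmetric field operators. -/

section WeylQuantization

open MeasureTheory Complexification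

variable {𝔥 : Type u} [NormedAddCommGroup 𝔥] [InnerProductSpace ℝ 𝔥]

theorem ofReal_smul (s : ℝ) (a : 𝔥) : ofReal (s • a) = (s : ℂ) • ofReal a :=
  ext' (by simp only [ofReal, re_mk, im_mk, re_smul, Complex.ofReal_re, Complex.ofReal_im,
      smul_zero, sub_zero])
    (by simp only [ofReal, re_mk, im_mk, im_smul, Complex.ofReal_re, Complex.ofReal_im,
      smul_zero, zero_smul, add_zero])

/-- The parameter of the Gaussian density of the law of `(P(h₁), Q(h₂))` between the exponential
vectors of `f` and `g`. -/
def weylArg (h : 𝔥 × 𝔥) (f g : Complexification 𝔥) : ℂ × ℂ :=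
  (-Complex.I * (inner ℂ f (ofReal h.1) - inner ℂ (ofReal h.1) g) / (‖h.1‖ : ℂ) ^ 2,
    (inner ℂ f (ofReal h.2) + inner ℂ (ofReal h.2) g) / (‖h.2‖ : ℂ) ^ 2)

theorem norm_sq_mul_div {a : 𝔥} {z : ℂ} (hz : a = 0 → z = 0) :
    (‖a‖ : ℂ) ^ 2 * (z / (‖a‖ : ℂ) ^ 2) = z := by
  rcases eq_or_ne a 0 with h | h
  · simp [hz h]
  · have : (‖a‖ : ℂ) ≠ 0 := by simpa using h
    field_simp

theorem ofReal_zero : ofReal (0 : 𝔥) = 0 := ext' rfl rfl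

theorem inner_weylVec (h : 𝔥 × 𝔥) (f g : Complexification 𝔥) (s t : ℝ) :
    inner ℂ (expVec f) (weylVec (s • h.1) (t • h.2) g) = Complex.exp (inner ℂ f g) *
      ∫ p, planeChar s t p * gaussDensity h (weylArg h f g) p ∂(gaussPlane h) := by
  rw [fourier_gaussDensity, weylVec, inner_smul_right, inner_expVec, ← Complex.exp_add,
    ← Complex.exp_add]
  congr 1
  have h1 : (‖h.1‖ : ℂ) ^ 2 * (weylArg h f g).1 =
      -Complex.I * (inner ℂ f (ofReal h.1) - inner ℂ (ofReal h.1) g) :=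
    norm_sq_mul_div fun h0 => by simp [h0, ofReal_zero]
  have h2 : (‖h.2‖ : ℂ) ^ 2 * (weylArg h f g).2 =
      inner ℂ f (ofReal h.2) + inner ℂ (ofReal h.2) g :=
    norm_sq_mul_div fun h0 => by simp [h0, ofReal_zero]
  rw [h1, h2, ofReal_smul, ofReal_smul, inner_add_right, inner_add_right, inner_smul_right,
    inner_smul_right, inner_smul_right, inner_smul_left, inner_smul_left, norm_smul, norm_smul]
  simp only [Complex.conj_ofReal, mul_pow, Real.norm_eq_abs, sq_abs]
  push_cast
  linear_combination (s * (inner ℂ f (ofReal h.1) - inner ℂ (ofReal h.1) g)) * Complex.I_sq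

/-- The definition only supplies some complex measure with the right Fourier transform; by
uniqueness it may be replaced by the explicit Gaussian one, which varies tractably with f and g. -/
theorem IsWeylQuantization.explicit {h : 𝔥 × 𝔥} {φ : ℝ × ℝ → ℂ} {M : BoundedOps 𝔥}
    (hM : IsWeylQuantization h φ M) (f g : Complexification 𝔥) :
    Integrable (fun p => φ p * gaussDensity h (weylArg h f g) p) (gaussPlane h) ∧
      matrixElement M f g = Complex.exp (inner ℂ f g) *
        ∫ p, φ p * gaussDensity h (weylArg h f g) p ∂(gaussPlane h) := by
  obtain ⟨m, ρ, hρ, hchar, hint, hmat⟩ := hM f g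
  have h1 := integral_eq_of_fourier_eq (m := m) (m' := gaussPlane h) hρ
    ((integrable_gaussDensity h (weylArg h f g)).const_mul (Complex.exp (inner ℂ f g)))
    (fun s t => by
      refine (hchar s t).symm.trans ?_
      rw [inner_weylVec, ← integral_const_mul]
      refine integral_congr_ae (Filter.Eventually.of_forall fun p => ?_)
      simp only
      ring) φ
  have h2 : ∀ p, φ p * (Complex.exp (inner ℂ f g) * gaussDensity h (weylArg h f g) p) =
      Complex.exp (inner ℂ f g) * (φ p * gaussDensity h (weylArg h f g) p) := fun p => by ring
  simp only [h2] at h1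
  rw [integral_const_mul] at h1
  refine ⟨?_, hmat.trans h1.2⟩
  refine ((h1.1.1 hint).const_mul (Complex.exp (-inner ℂ f g))).congr
    (Filter.Eventually.of_forall fun p => ?_)
  simp only
  rw [← mul_assoc, ← Complex.exp_add, neg_add_cancel, Complex.exp_zero, one_mul]

/-- The real shift of the parameter under the translation of both arguments by `-(i/2) κ`. -/
def weylShift (h : 𝔥 × 𝔥) (κ : Complexification 𝔥) : ℝ × ℝ :=
  ((inner ℂ (ofReal h.1) κ).re / ‖h.1‖ ^ 2, (inner ℂ (ofReal h.2) κ).im / ‖h.2‖ ^ 2)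

theorem norm_sq_mul_weylShift (h : 𝔥 × 𝔥) (κ : Complexification 𝔥) :
    ‖h.1‖ ^ 2 * (weylShift h κ).1 = (inner ℂ (ofReal h.1) κ).re ∧
      ‖h.2‖ ^ 2 * (weylShift h κ).2 = (inner ℂ (ofReal h.2) κ).im := by
  constructor
  · have := norm_sq_mul_div (a := h.1) (z := ((inner ℂ (ofReal h.1) κ).re : ℂ))
      (fun h0 => by simp [h0, ofReal_zero])
    exact_mod_cast this
  · have := norm_sq_mul_div (a := h.2) (z := ((inner ℂ (ofReal h.2) κ).im : ℂ))
      (fun h0 => by simp [h0, ofReal_zero])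
    exact_mod_cast this

/-- The factor -i/2 and the common direction for f and g make the shift real, so that it can be
realized by translating φ, a function on real points only. -/
theorem weylArg_shift (h : 𝔥 × 𝔥) (κ f g : Complexification 𝔥) (c : ℝ) :
    weylArg h (f + (c : ℂ) • ((-Complex.I / 2) • κ)) (g + (c : ℂ) • ((-Complex.I / 2) • κ)) =
      weylArg h f g + (((c * (weylShift h κ).1 : ℝ) : ℂ), ((c * (weylShift h κ).2 : ℝ) : ℂ)) := by
  have hc : ∀ a : 𝔥, inner ℂ κ (ofReal a) = (starRingEnd ℂ) (inner ℂ (ofReal a) κ) := fun a =>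
    (inner_conj_symm _ _).symm
  have hI := Complex.I_sq
  refine Prod.ext ?_ ?_
  · simp only [weylArg, weylShift, inner_add_left, inner_add_right, inner_smul_left,
      inner_smul_right, Prod.fst_add, hc, map_div₀, map_neg, Complex.conj_I, Complex.conj_ofReal]
    push_cast
    rw [Complex.re_eq_add_conj]
    simp only [map_ofNat]
    rw [← mul_div_assoc, ← add_div]
    congr 1
    linear_combination (-(c / 2 : ℂ) * ((starRingEnd ℂ) (inner ℂ (ofReal h.1) κ) +
      inner ℂ (ofReal h.1) κ)) * hI
  · simp only [weylArg, weylShift, inner_add_left, inner_add_right, inner_smul_left,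
      inner_smul_right, Prod.snd_add, hc, map_div₀, map_neg, Complex.conj_I, Complex.conj_ofReal]
    push_cast
    rw [Complex.im_eq_sub_conj]
    simp only [map_ofNat]
    rw [← mul_div_assoc, ← add_div]
    congr 1
    have : ∀ x : ℂ, x / (2 * Complex.I) = -Complex.I / 2 * x := by
      intro x
      field_simp
      linear_combination x * hI
    rw [this]
    ring

/-- Dividing the kernel by exp⟨f,g⟩ leaves a Gaussian average of φ. Its derivative along the joint
shift of f and g by -(i/2)κ is, up to that division, (i/2)[a(κ)+a⁺(κ), M]; on the Gaussian side it
averages the directional derivative of φ. -/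
theorem IsWeylQuantization.hasCommutator_self {h : 𝔥 × 𝔥} {φ : ℝ × ℝ → ℂ}
    {M Mx My : BoundedOps 𝔥} (hφ : ContDiff ℝ ∞ φ) (hM : IsWeylQuantization h φ M)
    (hx : IsWeylQuantization h (partialX φ) Mx) (hy : IsWeylQuantization h (partialY φ) My)
    (κ : Complexification 𝔥) :
    HasCommutator κ κ M ((-2 * Complex.I) • ((((inner ℂ (ofReal h.1) κ).re : ℝ) : ℂ) • Mx +
      (((inner ℂ (ofReal h.2) κ).im : ℝ) : ℂ) • My)) := by
  intro f g
  set r₁ : ℝ := (inner ℂ (ofReal h.1) κ).re with hr₁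
  set r₂ : ℝ := (inner ℂ (ofReal h.2) κ).im with hr₂
  set N : BoundedOps 𝔥 := (r₁ : ℂ) • Mx + (r₂ : ℂ) • My with hN
  set v : Complexification 𝔥 := (-Complex.I / 2) • κ with hv
  set ψ : ℝ × ℝ → ℂ := fun p => (r₁ : ℂ) * partialX φ p + (r₂ : ℂ) * partialY φ p with hψ
  set θ := weylShift h κ with hθ
  obtain ⟨hθ₁, hθ₂⟩ := norm_sq_mul_weylShift h κ
  rw [← hθ, ← hr₁] at hθ₁
  rw [← hθ, ← hr₂] at hθ₂
  have hfd : Continuous (fderiv ℝ φ) := hφ.continuous_fderiv (by simp)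
  have hψc : Continuous ψ := by
    have h1 : Continuous (partialX φ) := hfd.clm_apply continuous_const
    have h2 : Continuous (partialY φ) := hfd.clm_apply continuous_const
    fun_prop
  have hshift := weylArg_shift h κ f g
  rw [← hv, ← hθ] at hshift
  have hφM : ∀ c : ℝ, Integrable (fun p => φ p * gaussDensity h
      (weylArg h f g + (((c * θ.1 : ℝ) : ℂ), ((c * θ.2 : ℝ) : ℂ))) p) (gaussPlane h) ∧
      Complex.exp (-inner ℂ (f + (c : ℂ) • v) (g + (c : ℂ) • v)) *
        matrixElement M (f + (c : ℂ) • v) (g + (c : ℂ) • v) =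
      ∫ p, φ p * gaussDensity h
        (weylArg h f g + (((c * θ.1 : ℝ) : ℂ), ((c * θ.2 : ℝ) : ℂ))) p ∂(gaussPlane h) := by
    intro c
    have h1 := hM.explicit (f + (c : ℂ) • v) (g + (c : ℂ) • v)
    rw [hshift] at h1
    refine ⟨h1.1, ?_⟩
    rw [h1.2, ← mul_assoc, ← Complex.exp_add, neg_add_cancel, Complex.exp_zero, one_mul]
  have hψN : ∀ c : ℝ, Integrable (fun p => ψ p * gaussDensity h
      (weylArg h f g + (((c * θ.1 : ℝ) : ℂ), ((c * θ.2 : ℝ) : ℂ))) p) (gaussPlane h) ∧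
      Complex.exp (-inner ℂ (f + (c : ℂ) • v) (g + (c : ℂ) • v)) *
        matrixElement N (f + (c : ℂ) • v) (g + (c : ℂ) • v) =
      ∫ p, ψ p * gaussDensity h
        (weylArg h f g + (((c * θ.1 : ℝ) : ℂ), ((c * θ.2 : ℝ) : ℂ))) p ∂(gaussPlane h) := by
    intro c
    have h1 := hx.explicit (f + (c : ℂ) • v) (g + (c : ℂ) • v)
    have h2 := hy.explicit (f + (c : ℂ) • v) (g + (c : ℂ) • v)
    rw [hshift] at h1 h2
    have h3 : ∀ p, ψ p * gaussDensity h
        (weylArg h f g + (((c * θ.1 : ℝ) : ℂ), ((c * θ.2 : ℝ) : ℂ))) p =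
        (r₁ : ℂ) * (partialX φ p * gaussDensity h
          (weylArg h f g + (((c * θ.1 : ℝ) : ℂ), ((c * θ.2 : ℝ) : ℂ))) p) +
        (r₂ : ℂ) * (partialY φ p * gaussDensity h
          (weylArg h f g + (((c * θ.1 : ℝ) : ℂ), ((c * θ.2 : ℝ) : ℂ))) p) := by
      intro p
      simp only [hψ]
      ring
    simp only [h3]
    refine ⟨(h1.1.const_mul _).add (h2.1.const_mul _), ?_⟩
    rw [integral_add (h1.1.const_mul _) (h2.1.const_mul _), integral_const_mul, integral_const_mul,
      hN, matrixElement_add, matrixElement_smul, matrixElement_smul, h1.2, h2.2]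
    have h4 : Complex.exp (-inner ℂ (f + (c : ℂ) • v) (g + (c : ℂ) • v)) *
        Complex.exp (inner ℂ (f + (c : ℂ) • v) (g + (c : ℂ) • v)) = 1 := by
      rw [← Complex.exp_add, neg_add_cancel, Complex.exp_zero]
    linear_combination (((r₁ : ℂ) * ∫ p, (partialX φ p * gaussDensity h
          (weylArg h f g + (((c * θ.1 : ℝ) : ℂ), ((c * θ.2 : ℝ) : ℂ))) p) ∂(gaussPlane h)) +
        (r₂ : ℂ) * ∫ p, (partialY φ p * gaussDensity h
          (weylArg h f g + (((c * θ.1 : ℝ) : ℂ), ((c * θ.2 : ℝ) : ℂ))) p) ∂(gaussPlane h)) * h4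
  have hline : ∀ c : ℝ, HasDerivAt (fun c : ℝ => inner ℂ (f + (c : ℂ) • v) (g + (c : ℂ) • v))
      (inner ℂ v (g + (c : ℂ) • v) + inner ℂ (f + (c : ℂ) • v) v) c := by
    intro c
    have h1 : ∀ k : Complexification 𝔥, HasDerivAt (fun c : ℝ => k + (c : ℂ) • v) v c := fun k => by
      simpa using ((Complex.ofRealCLM.hasDerivAt (x := c)).smul_const v).const_add k
    refine (HasDerivAt.inner ℂ (h1 f) (h1 g)).congr_deriv ?_
    rw [add_comm]
  have hexp : ∀ (B : BoundedOps 𝔥) (c : ℝ), HasDerivAt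
      (fun c : ℝ => Complex.exp (-inner ℂ (f + (c : ℂ) • v) (g + (c : ℂ) • v)) *
        matrixElement B (f + (c : ℂ) • v) (g + (c : ℂ) • v)) _ c := fun B c =>
    (hline c).neg.cexp.mul (hasDerivAt_matrixElement B f g v v c)
  set J : ℝ → ℂ := fun c => Complex.exp (-inner ℂ (f + (c : ℂ) • v) (g + (c : ℂ) • v)) *
        matrixElement N (f + (c : ℂ) • v) (g + (c : ℂ) • v) with hJ
  have hJc : Continuous J := continuous_iff_continuousAt.2 fun c => (hexp N c).continuousAt
  -- The integrated form avoids differentiation under the Gaussian integral: the existence of Mx and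
  -- My supplies integrability at every parameter, and J is continuous as a kernel.
  have hdiff : ∀ c : ℝ, 0 ≤ c →
      Complex.exp (-inner ℂ (f + (c : ℂ) • v) (g + (c : ℂ) • v)) *
        matrixElement M (f + (c : ℂ) • v) (g + (c : ℂ) • v) =
      (∫ s in (0 : ℝ)..c, J s) + ∫ p, φ p * gaussDensity h (weylArg h f g) p ∂(gaussPlane h) := by
    intro c hc
    have h1 := integral_shift_sub_eq h (weylArg h f g) θ c hc φ ψ hψc ?_
      (fun s => (hφM s).1) (fun s => (hψN s).1)
    · rw [(hφM c).2, ← sub_eq_iff_eq_add, h1]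
      refine intervalIntegral.integral_congr fun s _ => ?_
      exact ((hψN s).2).symm
    · intro p s
      have h2 : HasDerivAt (fun s : ℝ => p + (‖h.1‖ ^ 2 * (s * θ.1), ‖h.2‖ ^ 2 * (s * θ.2)))
          (r₁, r₂) s := by
        have h3 : (fun s : ℝ => p + (‖h.1‖ ^ 2 * (s * θ.1), ‖h.2‖ ^ 2 * (s * θ.2))) =
            fun s : ℝ => p + s • (r₁, r₂) := by
          funext s
          rw [← hθ₁, ← hθ₂]
          congr 1
          ext <;> simp <;> ring
        rw [h3]
        simpa using ((hasDerivAt_id s).smul_const (r₁, r₂)).const_add p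
      refine (((hφ.differentiable (by simp)) _).hasFDerivAt.comp_hasDerivAt s h2).congr_deriv ?_
      have h4 : ((r₁, r₂) : ℝ × ℝ) = r₁ • ((1, 0) : ℝ × ℝ) + r₂ • ((0, 1) : ℝ × ℝ) := by
        ext <;> simp
      rw [h4, map_add, map_smul, map_smul]
      simp [hψ, partialX, partialY]
  -- The integrated identity is available for c ≥ 0 only, so one-sided derivatives at 0 are
  -- compared.
  have hL := (hexp M 0).hasDerivWithinAt (s := Set.Ici 0)
  have hR : HasDerivWithinAt (fun c => (∫ s in (0 : ℝ)..c, J s) +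
      ∫ p, φ p * gaussDensity h (weylArg h f g) p ∂(gaussPlane h)) (J 0) (Set.Ici 0) 0 :=
    ((intervalIntegral.integral_hasDerivAt_right (hJc.intervalIntegrable _ _)
      (hJc.stronglyMeasurableAtFilter _ _) hJc.continuousAt).add_const _).hasDerivWithinAt
  have heq := (uniqueDiffWithinAt_Ici (0 : ℝ)).eq_deriv _ hL
    (hR.congr (fun c hc => hdiff c hc) (hdiff 0 le_rfl))
  simp only [hJ, Pi.neg_apply, Complex.ofReal_zero, zero_smul, add_zero] at heq
  have hne : Complex.exp (-inner ℂ f g) ≠ 0 := Complex.exp_ne_zero _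
  have heq2 : -(inner ℂ v g + inner ℂ f v) * matrixElement M f g +
      (inner ℂ (expDeriv f v) (M (expVec g)) + inner ℂ (expVec f) (M (expDeriv g v))) =
      matrixElement N f g := by
    refine mul_left_cancel₀ hne ?_
    rw [← heq]
    ring
  rw [matrixElement_smul, ← heq2, commForm_eq, hv]
  simp only [expDeriv_smul, inner_smul_left, inner_smul_right, map_smul, map_div₀, map_neg,
    Complex.conj_I, map_ofNat]
  linear_combination (inner ℂ (expVec f) (M (expDeriv g κ)) - inner ℂ (expDeriv f κ) (M (expVec g))
    + (inner ℂ κ g - inner ℂ f κ) * matrixElement M f g) * Complex.I_sq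

end WeylQuantization

/-! ### Stability of 𝓢 under commutators; the gradient as a commutator. -/

section SmoothFunctionals

open Complexification

variable {𝔥 : Type u} [NormedAddCommGroup 𝔥] [InnerProductSpace ℝ 𝔥]

theorem inner_conj_left (x y : Complexification 𝔥) : inner ℂ x.conj y = inner ℂ y.conj x := by
  apply Complex.ext
  · change inner ℝ x.re y.re + inner ℝ (-x.im) y.im = inner ℝ y.re x.re + inner ℝ (-y.im) x.im
    rw [inner_neg_left, inner_neg_left, real_inner_comm, real_inner_comm y.im]
  · change inner ℝ x.re y.im - inner ℝ (-x.im) y.re = inner ℝ y.re x.im - inner ℝ (-y.im) x.re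
    rw [inner_neg_left, inner_neg_left, real_inner_comm, real_inner_comm y.re]
    ring

theorem conj_ofReal (a : 𝔥) : (ofReal a).conj = ofReal a := ext' rfl neg_zero

theorem inner_ofReal_left (a : 𝔥) (x : Complexification 𝔥) :
    inner ℂ (ofReal a) x = inner ℂ x.conj (ofReal a) := by
  rw [← inner_conj_left, conj_ofReal]

/-- The annihilation part of `Q(k₁) - P(k₂)`. -/
def frechetAnn (k : DoubleSpace 𝔥) : Complexification 𝔥 := k.1.conj + Complex.I • k.2.conj

/-- The creation part of `Q(k₁) - P(k₂)`. -/
def frechetCre (k : DoubleSpace 𝔥) : Complexification 𝔥 := k.1 + Complex.I • k.2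

/-- The annihilation part of `P(k₁) + Q(k₂)`. -/
def fieldAnn (k : DoubleSpace 𝔥) : Complexification 𝔥 := (-Complex.I) • k.1.conj + k.2.conj

/-- The creation part of `P(k₁) + Q(k₂)`. -/
def fieldCre (k : DoubleSpace 𝔥) : Complexification 𝔥 := (-Complex.I) • k.1 + k.2

theorem fieldAnn_eq (k : DoubleSpace 𝔥) : fieldAnn k = (-Complex.I) • frechetAnn k := by
  rw [fieldAnn, frechetAnn, smul_add, smul_smul, neg_mul, Complex.I_mul_I, neg_neg, one_smul]

theorem fieldCre_eq (k : DoubleSpace 𝔥) : fieldCre k = (-Complex.I) • frechetCre k := by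
  rw [fieldCre, frechetCre, smul_add, smul_smul, neg_mul, Complex.I_mul_I, neg_neg, one_smul]

theorem frechetOperator_op (k : DoubleSpace 𝔥) (g : Complexification 𝔥) :
    (position k.1 - momentum k.2).op (expSpanVec g) =
      inner ℂ (frechetAnn k) g • expVec g + expDeriv g (frechetCre k) := by
  change ((ExpOperator.annihilate k.1.conj).op (expSpanVec g) +
    (ExpOperator.create k.1).op (expSpanVec g)) -
      Complex.I • ((ExpOperator.annihilate k.2.conj).op (expSpanVec g) -
    (ExpOperator.create k.2).op (expSpanVec g)) = _
  simp only [annihilate_op_expVec, create_op_expVec, frechetAnn, frechetCre, inner_add_left,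
    inner_smul_left, expDeriv_add, expDeriv_smul, Complex.conj_I]
  module

theorem frechetOperator_adj (k : DoubleSpace 𝔥) (f : Complexification 𝔥) :
    (position k.1 - momentum k.2).adj (expSpanVec f) =
      expDeriv f (frechetAnn k) + inner ℂ (frechetCre k) f • expVec f := by
  change ((ExpOperator.annihilate k.1.conj).adj (expSpanVec f) +
    (ExpOperator.create k.1).adj (expSpanVec f)) -
      (starRingEnd ℂ) Complex.I • ((ExpOperator.annihilate k.2.conj).adj (expSpanVec f) -
    (ExpOperator.create k.2).adj (expSpanVec f)) = _
  simp only [annihilate_adj_expVec, create_adj_expVec, frechetAnn, frechetCre, inner_add_left,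
    inner_smul_left, expDeriv_add, expDeriv_smul, Complex.conj_I]
  module

theorem fieldOperator_op (k : DoubleSpace 𝔥) (g : Complexification 𝔥) :
    (fieldOperator k).op (expSpanVec g) =
      inner ℂ (fieldAnn k) g • expVec g + expDeriv g (fieldCre k) := by
  change Complex.I • ((ExpOperator.annihilate k.1.conj).op (expSpanVec g) -
    (ExpOperator.create k.1).op (expSpanVec g)) +
      ((ExpOperator.annihilate k.2.conj).op (expSpanVec g) +
    (ExpOperator.create k.2).op (expSpanVec g)) = _
  simp only [annihilate_op_expVec, create_op_expVec, fieldAnn, fieldCre, inner_add_left,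
    inner_smul_left, expDeriv_add, expDeriv_smul, Complex.conj_I, map_neg]
  module

theorem fieldOperator_adj (k : DoubleSpace 𝔥) (f : Complexification 𝔥) :
    (fieldOperator k).adj (expSpanVec f) =
      expDeriv f (fieldAnn k) + inner ℂ (fieldCre k) f • expVec f := by
  change (starRingEnd ℂ) Complex.I • ((ExpOperator.annihilate k.1.conj).adj (expSpanVec f) -
    (ExpOperator.create k.1).adj (expSpanVec f)) +
      ((ExpOperator.annihilate k.2.conj).adj (expSpanVec f) +
    (ExpOperator.create k.2).adj (expSpanVec f)) = _
  simp only [annihilate_adj_expVec, create_adj_expVec, fieldAnn, fieldCre, inner_add_left,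
    inner_smul_left, expDeriv_add, expDeriv_smul, Complex.conj_I, map_neg]
  module

theorem frechetForm_eq (k : DoubleSpace 𝔥) (B : BoundedOps 𝔥) (f g : Complexification 𝔥) :
    frechetForm k B f g = Complex.I / 2 * commForm (frechetAnn k) (frechetCre k) B f g := by
  rw [frechetForm, commutatorForm, productForm, productForm, frechetOperator_op,
    frechetOperator_adj]
  rfl

theorem commutatorForm_fieldOperator (k : DoubleSpace 𝔥) (B : BoundedOps 𝔥)
    (f g : Complexification 𝔥) :
    commutatorForm (fieldOperator k) B f g = commForm (fieldAnn k) (fieldCre k) B f g := by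
  rw [commutatorForm, productForm, productForm, fieldOperator_op, fieldOperator_adj]
  rfl

theorem HasCommutator.frechet_eq {k : DoubleSpace 𝔥} {B N : BoundedOps 𝔥}
    (h : HasCommutator (frechetAnn k) (frechetCre k) B N) :
    InFrechetDomain k B ∧ frechet k B = (Complex.I / 2) • N := by
  have h1 : ∀ f g, matrixElement ((Complex.I / 2) • N) f g = frechetForm k B f g := fun f g => by
    rw [matrixElement_smul, h f g, frechetForm_eq]
  exact ⟨⟨_, h1⟩, boundedOperator_eq h1⟩

theorem HasCommutator.fieldCommutator_eq {k : DoubleSpace 𝔥} {B N : BoundedOps 𝔥}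
    (h : HasCommutator (fieldAnn k) (fieldCre k) B N) :
    DefinesBoundedOperator (commutatorForm (fieldOperator k) B) ∧ fieldCommutator k B = N := by
  have h1 : ∀ f g, matrixElement N f g = commutatorForm (fieldOperator k) B f g := fun f g => by
    rw [h f g, commutatorForm_fieldOperator]
  exact ⟨⟨_, h1⟩, boundedOperator_eq h1⟩

/-- Decomposing (p,q) into symmetric labels turns the real and imaginary parts of the inner products
into expressions that are complex linear in the field operator. -/
theorem IsWeylQuantization.hasCommutator {h : 𝔥 × 𝔥} {φ : ℝ × ℝ → ℂ}
    {M Mx My : BoundedOps 𝔥} (hφ : ContDiff ℝ ∞ φ) (hM : IsWeylQuantization h φ M)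
    (hx : IsWeylQuantization h (partialX φ) Mx) (hy : IsWeylQuantization h (partialY φ) My)
    (p q : Complexification 𝔥) :
    HasCommutator p q M
      ((-Complex.I * (inner ℂ (ofReal h.1) q + inner ℂ p (ofReal h.1))) • Mx +
        (inner ℂ p (ofReal h.2) - inner ℂ (ofReal h.2) q) • My) := by
  obtain ⟨κ₁, κ₂, rfl, rfl⟩ := exists_label_decomposition p q
  have h1 := (hM.hasCommutator_self hφ hx hy κ₁).add_label
    ((hM.hasCommutator_self hφ hx hy κ₂).smul_label Complex.I)
  convert h1 using 1
  have hre : ∀ (a : 𝔥) (κ : Complexification 𝔥), ((inner ℂ (ofReal a) κ).re : ℂ) =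
      (inner ℂ (ofReal a) κ + inner ℂ κ (ofReal a)) / 2 := fun a κ => by
    rw [Complex.re_eq_add_conj, inner_conj_symm]
  have him : ∀ (a : 𝔥) (κ : Complexification 𝔥), ((inner ℂ (ofReal a) κ).im : ℂ) =
      -Complex.I / 2 * (inner ℂ (ofReal a) κ - inner ℂ κ (ofReal a)) := fun a κ => by
    rw [Complex.im_eq_sub_conj, inner_conj_symm]
    field_simp
    linear_combination (inner ℂ (ofReal a) κ - inner ℂ κ (ofReal a)) * Complex.I_sq
  simp only [hre, him, smul_add, smul_smul, inner_add_left, inner_add_right, inner_smul_left,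
    inner_smul_right, Complex.conj_conj]
  conv_rhs => rw [add_add_add_comm, ← add_smul, ← add_smul]
  congr 2
  · ring
  · linear_combination (-(inner ℂ (ofReal h.2) κ₁ - inner ℂ κ₁ (ofReal h.2)) -
      Complex.I * (inner ℂ (ofReal h.2) κ₂ - inner ℂ κ₂ (ofReal h.2))) * Complex.I_sq

theorem contDiff_partialX {φ : ℝ × ℝ → ℂ} (hφ : ContDiff ℝ ∞ φ) : ContDiff ℝ ∞ (partialX φ) :=
  (hφ.fderiv_right (m := ∞) (by simp)).clm_apply contDiff_const

theorem contDiff_partialY {φ : ℝ × ℝ → ℂ} (hφ : ContDiff ℝ ∞ φ) : ContDiff ℝ ∞ (partialY φ) :=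
  (hφ.fderiv_right (m := ∞) (by simp)).clm_apply contDiff_const

/-- Smooth symbols are defined through derivatives in y followed by derivatives in x; symmetry of
second derivatives is what makes the class stable under `partialX`. -/
theorem partialY_partialX {φ : ℝ × ℝ → ℂ} (hφ : ContDiff ℝ ∞ φ) :
    partialY (partialX φ) = partialX (partialY φ) := by
  funext p
  have hd : DifferentiableAt ℝ (fderiv ℝ φ) p :=
    (hφ.fderiv_right (m := ∞) (by simp)).differentiable (by simp) p
  have h1 : ∀ v w : ℝ × ℝ, fderiv ℝ (fun x => fderiv ℝ φ x v) p w = fderiv ℝ (fderiv ℝ φ) p w v := by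
    intro v w
    rw [fderiv_clm_apply hd (differentiableAt_const v)]
    simp
  have hsymm : IsSymmSndFDerivAt ℝ φ p := hφ.contDiffAt.isSymmSndFDerivAt (by
    simp only [minSmoothness_of_isRCLikeNormedField]
    exact WithTop.coe_le_coe.2 le_top)
  change fderiv ℝ (fun x => fderiv ℝ φ x (1, 0)) p (0, 1) =
    fderiv ℝ (fun x => fderiv ℝ φ x (0, 1)) p (1, 0)
  rw [h1, h1]
  exact hsymm _ _

theorem partialY_iterate_partialX {φ : ℝ × ℝ → ℂ} (hφ : ContDiff ℝ ∞ φ) (n : ℕ) :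
    partialY^[n] (partialX φ) = partialX (partialY^[n] φ) := by
  induction n generalizing φ with
  | zero => rfl
  | succ n ih =>
    rw [Function.iterate_succ_apply, partialY_partialX hφ, ih (contDiff_partialY hφ),
      Function.iterate_succ_apply]

theorem IsSmoothSymbol.partialX {h : 𝔥 × 𝔥} {φ : ℝ × ℝ → ℂ} (hφ : IsSmoothSymbol h φ) :
    IsSmoothSymbol h (partialX φ) := by
  refine ⟨contDiff_partialX hφ.1, fun a b => ?_⟩
  rw [partialY_iterate_partialX hφ.1, ← Function.iterate_succ_apply]
  exact hφ.2 (a + 1) b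

theorem IsSmoothSymbol.partialY {h : 𝔥 × 𝔥} {φ : ℝ × ℝ → ℂ} (hφ : IsSmoothSymbol h φ) :
    IsSmoothSymbol h (partialY φ) := by
  refine ⟨contDiff_partialY hφ.1, fun a b => ?_⟩
  rw [← Function.iterate_succ_apply]
  exact hφ.2 a (b + 1)

/-- Induction on the generation of 𝓢. All labels are treated at once because the Leibniz rule in the
product step needs the commutators of both factors with every symmetric field. -/
theorem exists_hasCommutator {B : BoundedOps 𝔥} (hB : B ∈ smoothFunctionals 𝔥)
    (p q : Complexification 𝔥) : ∃ N ∈ smoothFunctionals 𝔥, HasCommutator p q B N := by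
  induction hB using Algebra.adjoin_induction generalizing p q with
  | mem M hM =>
    obtain ⟨h, φ, hφ, hM⟩ := hM
    obtain ⟨Mx, hx⟩ := hφ.2 1 0
    obtain ⟨My, hy⟩ := hφ.2 0 1
    have hMx : Mx ∈ smoothFunctionals 𝔥 := Algebra.subset_adjoin ⟨h, _, hφ.partialX, hx⟩
    have hMy : My ∈ smoothFunctionals 𝔥 := Algebra.subset_adjoin ⟨h, _, hφ.partialY, hy⟩
    exact ⟨_, add_mem (Subalgebra.smul_mem _ hMx _) (Subalgebra.smul_mem _ hMy _),
      hM.hasCommutator hφ.1 hx hy p q⟩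
  | algebraMap c => exact ⟨0, zero_mem _, HasCommutator.algebraMap p q c⟩
  | add B C _ _ hB hC =>
    obtain ⟨N, hN, h⟩ := hB p q
    obtain ⟨N', hN', h'⟩ := hC p q
    exact ⟨_, add_mem hN hN', h.add h'⟩
  | mul B C hBm hCm hB hC =>
    obtain ⟨N, hN, h⟩ := hB p q
    obtain ⟨N', hN', h'⟩ := hC p q
    exact ⟨_, add_mem (mul_mem hN hCm) (mul_mem hBm hN'), HasCommutator.mul
      (fun κ => (hB κ κ).imp fun _ h => h.2) (fun κ => (hC κ κ).imp fun _ h => h.2) h h'⟩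

theorem inFrechetDomain {B : BoundedOps 𝔥} (hB : B ∈ smoothFunctionals 𝔥) (k : DoubleSpace 𝔥) :
    InFrechetDomain k B :=
  let ⟨_, _, h⟩ := exists_hasCommutator hB (frechetAnn k) (frechetCre k)
  h.frechet_eq.1

theorem frechet_mem {B : BoundedOps 𝔥} (hB : B ∈ smoothFunctionals 𝔥) (k : DoubleSpace 𝔥) :
    frechet k B ∈ smoothFunctionals 𝔥 := by
  obtain ⟨N, hN, h⟩ := exists_hasCommutator hB (frechetAnn k) (frechetCre k)
  rw [h.frechet_eq.2]
  exact Subalgebra.smul_mem _ hN _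

theorem matrixElement_frechet {B : BoundedOps 𝔥} {k : DoubleSpace 𝔥} (hB : InFrechetDomain k B)
    (f g : Complexification 𝔥) : matrixElement (frechet k B) f g = frechetForm k B f g :=
  matrixElement_boundedOperator hB f g

theorem HasCommutator.leibniz {B C N N' : BoundedOps 𝔥} (hB : B ∈ smoothFunctionals 𝔥)
    (hC : C ∈ smoothFunctionals 𝔥) {p q : Complexification 𝔥} (h : HasCommutator p q B N)
    (h' : HasCommutator p q C N') : HasCommutator p q (B * C) (N * C + B * N') :=
  HasCommutator.mul (fun κ => (exists_hasCommutator hB κ κ).imp fun _ h => h.2)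
    (fun κ => (exists_hasCommutator hC κ κ).imp fun _ h => h.2) h h'

variable [CompleteSpace 𝔥]

theorem constInner_tmul (k : DoubleSpace 𝔥) (A : BoundedOps 𝔥) (l : DoubleSpace 𝔥) :
    constInner k (A ⊗ₜ[ℂ] l) = doubleInner (doubleConj k) l • A := by
  have : constInner k (A ⊗ₜ[ℂ] l) = doubleInner (doubleConj k) l •
    (ContinuousLinearMap.adjoint (1 : BoundedOps 𝔥) * A) := rfl
  rw [this, ← ContinuousLinearMap.star_eq_adjoint, star_one, one_mul]

theorem constInner_add (k : DoubleSpace 𝔥) (A B : VectorFields 𝔥) :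
    constInner k (A + B) = constInner k A + constInner k B := map_add _ _ _

theorem constInner_leftAction (k : DoubleSpace 𝔥) (F : BoundedOps 𝔥) (A : VectorFields 𝔥) :
    constInner k (leftAction F A) = F * constInner k A := by
  induction A using TensorProduct.induction_on with
  | zero => rw [map_zero, constInner, map_zero, mul_zero]
  | tmul A l =>
    rw [leftAction, LinearMap.rTensor_tmul, constInner_tmul, constInner_tmul, mul_smul_comm]
    rfl
  | add A B hA hB => rw [map_add, constInner_add, constInner_add, hA, hB, mul_add]

theorem constInner_rightAction (k : DoubleSpace 𝔥) (G : BoundedOps 𝔥) (A : VectorFields 𝔥) :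
    constInner k (rightAction G A) = constInner k A * G := by
  induction A using TensorProduct.induction_on with
  | zero => rw [map_zero, constInner, map_zero, zero_mul]
  | tmul A l =>
    rw [rightAction, LinearMap.rTensor_tmul, constInner_tmul, constInner_tmul, smul_mul_assoc]
    rfl
  | add A B hA hB => rw [map_add, constInner_add, constInner_add, hA, hB, add_mul]

/-- Both sides are derivations in G that agree on Weyl quantizations. Since this holds for every A
related to G, the choice made in `gradient` does not affect its contractions. -/
theorem IsGradient.frechet_eq {G : BoundedOps 𝔥} {A : VectorFields 𝔥} (hA : IsGradient G A) :
    G ∈ smoothFunctionals 𝔥 ∧ ∀ k : DoubleSpace 𝔥, frechet k G = constInner k A := by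
  induction hA with
  | weyl h φ M Mx My hφ hM hx hy =>
    refine ⟨Algebra.subset_adjoin ⟨h, φ, hφ, hM⟩, fun k => ?_⟩
    rw [((hM.hasCommutator hφ.1 hx hy (frechetAnn k) (frechetCre k)).frechet_eq).2,
      constInner_add, constInner_tmul, constInner_tmul, smul_add, smul_smul, smul_smul]
    simp only [frechetAnn, frechetCre, doubleInner, doubleConj, inner_zero_right, add_zero,
      zero_add, inner_add_left, inner_add_right, inner_smul_left, inner_smul_right,
      inner_ofReal_left, Complex.conj_I]
    congr 2
    · linear_combination (-inner ℂ k.1.conj (ofReal h.1)) * Complex.I_sq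
    · linear_combination (-inner ℂ k.2.conj (ofReal h.2)) * Complex.I_sq
  | scalar c =>
    refine ⟨Subalgebra.algebraMap_mem _ c, fun k => ?_⟩
    rw [(HasCommutator.algebraMap (frechetAnn k) (frechetCre k) c).frechet_eq.2, smul_zero,
      constInner, map_zero]
  | add F G A B hF hG ihF ihG =>
    refine ⟨add_mem ihF.1 ihG.1, fun k => ?_⟩
    obtain ⟨N, _, h⟩ := exists_hasCommutator ihF.1 (frechetAnn k) (frechetCre k)
    obtain ⟨N', _, h'⟩ := exists_hasCommutator ihG.1 (frechetAnn k) (frechetCre k)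
    rw [(h.add h').frechet_eq.2, constInner_add, ← ihF.2, ← ihG.2, h.frechet_eq.2,
      h'.frechet_eq.2, smul_add]
  | mul F G A B hF hG ihF ihG =>
    refine ⟨mul_mem ihF.1 ihG.1, fun k => ?_⟩
    obtain ⟨N, _, h⟩ := exists_hasCommutator ihF.1 (frechetAnn k) (frechetCre k)
    obtain ⟨N', _, h'⟩ := exists_hasCommutator ihG.1 (frechetAnn k) (frechetCre k)
    rw [(h.leibniz ihF.1 ihG.1 h').frechet_eq.2, constInner_add, constInner_leftAction,
      constInner_rightAction, ← ihF.2, ← ihG.2, h.frechet_eq.2, h'.frechet_eq.2, smul_add,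
      smul_mul_assoc, mul_smul_comm, add_comm]

theorem exists_isGradient {G : BoundedOps 𝔥} (hG : G ∈ smoothFunctionals 𝔥) :
    ∃ A, IsGradient G A := by
  induction hG using Algebra.adjoin_induction with
  | mem M hM =>
    obtain ⟨h, φ, hφ, hM⟩ := hM
    obtain ⟨Mx, hx⟩ := hφ.2 1 0
    obtain ⟨My, hy⟩ := hφ.2 0 1
    exact ⟨_, .weyl h φ M Mx My hφ hM hx hy⟩
  | algebraMap c => exact ⟨0, .scalar c⟩
  | add B C _ _ hB hC =>
    obtain ⟨A, hA⟩ := hB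
    obtain ⟨A', hA'⟩ := hC
    exact ⟨_, .add _ _ _ _ hA hA'⟩
  | mul B C _ _ hB hC =>
    obtain ⟨A, hA⟩ := hB
    obtain ⟨A', hA'⟩ := hC
    exact ⟨_, .mul _ _ _ _ hA hA'⟩

/-- The derivative `D_k G` is the contraction of the gradient with `k̄`. -/
theorem constInner_gradient {G : BoundedOps 𝔥} (hG : G ∈ smoothFunctionals 𝔥)
    (k : DoubleSpace 𝔥) : constInner k (gradient G) = frechet k G := by
  have h := exists_isGradient hG
  rw [gradient, dif_pos h]
  exact (h.choose_spec.frechet_eq.2 k).symm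

/-- The conjugation undoes the adjoint and the antilinearity of the inner product, so the pairing is
bilinear and symmetric in the vectors; only the order of the operators matters. -/
theorem fieldInner_fieldConj_tmul_right (A : VectorFields 𝔥) (F : BoundedOps 𝔥)
    (k : DoubleSpace 𝔥) : fieldInner (fieldConj A) (F ⊗ₜ[ℂ] k) = constInner k A * F := by
  induction A using TensorProduct.induction_on with
  | zero =>
    rw [map_zero, map_zero, constInner, map_zero, zero_mul]
    rfl
  | tmul A l =>
    have h1 : fieldInner (fieldConj (A ⊗ₜ[ℂ] l)) (F ⊗ₜ[ℂ] k) = doubleInner (doubleConj l) k •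
      (ContinuousLinearMap.adjoint (ContinuousLinearMap.adjoint A) * F) := rfl
    rw [h1, ContinuousLinearMap.adjoint_adjoint, constInner_tmul, smul_mul_assoc]
    congr 1
    simp only [doubleInner, doubleConj]
    rw [inner_conj_left, inner_conj_left l.2]
  | add A B hA hB =>
    rw [map_add, map_add, LinearMap.add_apply, hA, hB, constInner_add, add_mul]

theorem fieldInner_fieldConj_tmul_left (A : VectorFields 𝔥) (F : BoundedOps 𝔥)
    (k : DoubleSpace 𝔥) : fieldInner (fieldConj (F ⊗ₜ[ℂ] k)) A = F * constInner k A := by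
  induction A using TensorProduct.induction_on with
  | zero => rw [map_zero, constInner, map_zero, mul_zero]
  | tmul A l =>
    have h1 : fieldInner (fieldConj (F ⊗ₜ[ℂ] k)) (A ⊗ₜ[ℂ] l) = doubleInner (doubleConj k) l •
      (ContinuousLinearMap.adjoint (ContinuousLinearMap.adjoint F) * A) := rfl
    rw [h1, ContinuousLinearMap.adjoint_adjoint, constInner_tmul, mul_smul_comm]
  | add A B hA hB => rw [map_add, hA, hB, constInner_add, mul_add]

theorem leftGradient_elementary {n : ℕ} (F : Fin n → BoundedOps 𝔥) (h : Fin n → DoubleSpace 𝔥)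
    {G : BoundedOps 𝔥} (hG : G ∈ smoothFunctionals 𝔥) :
    leftGradient (elementary F h) G = ∑ j, frechet (h j) G * F j := by
  rw [leftGradient, elementary, map_sum]
  exact Finset.sum_congr rfl fun j _ => by
    rw [fieldInner_fieldConj_tmul_right, constInner_gradient hG]

theorem rightGradient_elementary {n : ℕ} (F : Fin n → BoundedOps 𝔥) (h : Fin n → DoubleSpace 𝔥)
    {G : BoundedOps 𝔥} (hG : G ∈ smoothFunctionals 𝔥) :
    rightGradient (elementary F h) G = ∑ j, F j * frechet (h j) G := by
  rw [rightGradient, elementary, map_sum, map_sum, LinearMap.sum_apply]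
  exact Finset.sum_congr rfl fun j _ => by
    rw [fieldInner_fieldConj_tmul_left, constInner_gradient hG]

theorem constInner_elementary (k : DoubleSpace 𝔥) {n : ℕ} (F : Fin n → BoundedOps 𝔥)
    (h : Fin n → DoubleSpace 𝔥) :
    constInner k (elementary F h) = ∑ j, doubleInner (doubleConj k) (h j) • F j := by
  rw [constInner, elementary, map_sum]
  exact Finset.sum_congr rfl fun j _ => constInner_tmul k (F j) (h j)

end SmoothFunctionals

/-! ### The divergence as multiplication of kernels; Heisenberg relation and product rules. -/

section Divergence

open Complexification

variable {𝔥 : Type u} [NormedAddCommGroup 𝔥] [InnerProductSpace ℝ 𝔥]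

/-- The symbol of `P(k₁) + Q(k₂)` between exponential vectors; the divergence acts on matrix elements
as multiplication by it. -/
def fieldSymbol (k : DoubleSpace 𝔥) (f g : Complexification 𝔥) : ℂ :=
  inner ℂ f (fieldCre k) + inner ℂ (fieldAnn k) g

theorem fieldSymbol_add (k l : DoubleSpace 𝔥) (f g : Complexification 𝔥) :
    fieldSymbol (k + l) f g = fieldSymbol k f g + fieldSymbol l f g := by
  simp only [fieldSymbol, fieldCre, fieldAnn, Prod.fst_add, Prod.snd_add, conj_add, smul_add,
    inner_add_left, inner_add_right]
  ring

theorem fieldSymbol_smul (c : ℂ) (k : DoubleSpace 𝔥) (f g : Complexification 𝔥) :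
    fieldSymbol (c • k) f g = c * fieldSymbol k f g := by
  simp only [fieldSymbol, fieldCre, fieldAnn, Prod.smul_fst, Prod.smul_snd, conj_smul,
    inner_add_left, inner_add_right, inner_smul_left, inner_smul_right, Complex.conj_conj]
  ring

/-- The matrix elements of the divergence as a linear functional of the vector field. -/
def divergenceFunctional (f g : Complexification 𝔥) : VectorFields 𝔥 →ₗ[ℂ] ℂ :=
  TensorProduct.lift (LinearMap.mk₂ ℂ
    (fun (B : BoundedOps 𝔥) (k : DoubleSpace 𝔥) => fieldSymbol k f g * matrixElement B f g)
    (fun B C k => by rw [matrixElement_add, mul_add])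
    (fun c B k => by rw [matrixElement_smul, smul_eq_mul]; ring)
    (fun B k l => by rw [fieldSymbol_add, add_mul])
    (fun c B k => by rw [fieldSymbol_smul, smul_eq_mul]; ring))

theorem divergenceFunctional_elementary (f g : Complexification 𝔥) {n : ℕ}
    (F : Fin n → BoundedOps 𝔥) (h : Fin n → DoubleSpace 𝔥) :
    divergenceFunctional f g (elementary F h) =
      ∑ j, fieldSymbol (h j) f g * matrixElement (F j) f g := by
  rw [elementary, map_sum]
  rfl

/-- P(k₁)+Q(k₂) and Q(k₁)-P(k₂) have labels differing by the factor -i (`fieldAnn_eq`,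
`fieldCre_eq`). Therefore the terms aB and Ba⁺ cancel and a⁺B + Ba remains, whose kernel involves no
derivative. -/
theorem anticommutatorForm_sub_frechetForm (k : DoubleSpace 𝔥) (B : BoundedOps 𝔥)
    (f g : Complexification 𝔥) :
    1 / 2 * anticommutatorForm (fieldOperator k) B f g - frechetForm k B f g =
      fieldSymbol k f g * matrixElement B f g := by
  have h1 : anticommutatorForm (fieldOperator k) B f g =
      inner ℂ (expDeriv f (fieldAnn k) + inner ℂ (fieldCre k) f • expVec f) (B (expVec g)) +
        inner ℂ (expVec f) (B (inner ℂ (fieldAnn k) g • expVec g + expDeriv g (fieldCre k))) := by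
    rw [anticommutatorForm, productForm, productForm, fieldOperator_op, fieldOperator_adj]
    rfl
  rw [h1, frechetForm_eq, commForm_eq, fieldSymbol, fieldAnn_eq, fieldCre_eq]
  simp only [expDeriv_smul, inner_add_left, inner_add_right, inner_smul_left, inner_smul_right,
    map_add, map_smul, map_neg, Complex.conj_I, matrixElement, map_mul, inner_conj_symm]
  ring

theorem divergenceForm_eq {n : ℕ} {F : Fin n → BoundedOps 𝔥}
    (hF : ∀ j, F j ∈ smoothFunctionals 𝔥) (h : Fin n → DoubleSpace 𝔥)
    (f g : Complexification 𝔥) :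
    divergenceForm F h f g = divergenceFunctional f g (elementary F h) := by
  rw [divergenceForm, divergenceFunctional_elementary, Finset.mul_sum, ← Finset.sum_sub_distrib]
  refine Finset.sum_congr rfl fun j _ => ?_
  rw [matrixElement_frechet (inFrechetDomain (hF j) _), anticommutatorForm_sub_frechetForm]

theorem IsDivergence.matrixElement_eq {u : VectorFields 𝔥} {M : BoundedOps 𝔥}
    (h : IsDivergence u M) (f g : Complexification 𝔥) :
    matrixElement M f g = divergenceFunctional f g u := by
  obtain ⟨n, F, h, hF, rfl, hM⟩ := h
  rw [hM, divergenceForm_eq hF]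

/-- Membership in the domain refers to some representation of u. The functional depends only on the
tensor, so any given representation with coefficients in 𝓢 serves as well. -/
theorem mem_divergenceDomain_iff {n : ℕ} {F : Fin n → BoundedOps 𝔥}
    (hF : ∀ j, F j ∈ smoothFunctionals 𝔥) (h : Fin n → DoubleSpace 𝔥) :
    elementary F h ∈ divergenceDomain 𝔥 ↔
      ∃ M : BoundedOps 𝔥, ∀ f g, matrixElement M f g = divergenceFunctional f g (elementary F h) := by
  constructor
  · rintro ⟨m, F', h', hF', heq, M, hM⟩
    exact ⟨M, fun f g => by rw [hM, divergenceForm_eq hF', heq]⟩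
  · rintro ⟨M, hM⟩
    exact ⟨n, F, h, hF, rfl, M, fun f g => by rw [hM, divergenceForm_eq hF]⟩

theorem divergence_elementary_eq {n : ℕ} {F : Fin n → BoundedOps 𝔥}
    (hF : ∀ j, F j ∈ smoothFunctionals 𝔥) (h : Fin n → DoubleSpace 𝔥) {M : BoundedOps 𝔥}
    (hM : ∀ f g, matrixElement M f g = divergenceFunctional f g (elementary F h)) :
    divergence (elementary F h) = M := by
  have hex : ∃ M, IsDivergence (elementary F h) M :=
    ⟨M, n, F, h, hF, rfl, fun f g => by rw [hM, divergenceForm_eq hF]⟩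
  rw [divergence, dif_pos hex]
  exact eq_of_matrixElement fun f g => (hex.choose_spec.matrixElement_eq f g).trans (hM f g).symm

theorem leftAction_elementary (G : BoundedOps 𝔥) {n : ℕ} (F : Fin n → BoundedOps 𝔥)
    (h : Fin n → DoubleSpace 𝔥) :
    leftAction G (elementary F h) = elementary (fun j => G * F j) h := by
  rw [elementary, map_sum]
  rfl

theorem rightAction_elementary (G : BoundedOps 𝔥) {n : ℕ} (F : Fin n → BoundedOps 𝔥)
    (h : Fin n → DoubleSpace 𝔥) :
    rightAction G (elementary F h) = elementary (fun j => F j * G) h := by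
  rw [elementary, map_sum]
  rfl

/-- Differentiating the matrix elements of a divergence. -/
theorem commForm_of_matrixElement_eq {n : ℕ} {F : Fin n → BoundedOps 𝔥}
    {h : Fin n → DoubleSpace 𝔥} {M : BoundedOps 𝔥}
    (hM : ∀ f g, matrixElement M f g = ∑ j, fieldSymbol (h j) f g * matrixElement (F j) f g)
    (p q f g : Complexification 𝔥) :
    commForm p q M f g = ∑ j, ((inner ℂ p (fieldCre (h j)) - inner ℂ (fieldAnn (h j)) q) *
      matrixElement (F j) f g + fieldSymbol (h j) f g * commForm p q (F j) f g) := by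
  -- The direction (p,-q) is the one occurring in `commForm_eq`; the product rule along it yields
  -- the commutators of the F_j plus the derivatives of the symbols.
  have hM1 := hasDerivAt_matrixElement M f g p (-q) 0
  have hω : ∀ j, HasDerivAt
      (fun t : ℝ => fieldSymbol (h j) (f + (t : ℂ) • p) (g + (t : ℂ) • (-q)))
      (inner ℂ p (fieldCre (h j)) - inner ℂ (fieldAnn (h j)) q) 0 := by
    intro j
    have h1 : (fun t : ℝ => fieldSymbol (h j) (f + (t : ℂ) • p) (g + (t : ℂ) • (-q))) =
        fun t : ℝ => fieldSymbol (h j) f g +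
          (t : ℂ) * (inner ℂ p (fieldCre (h j)) - inner ℂ (fieldAnn (h j)) q) := by
      funext t
      simp only [fieldSymbol, inner_add_left, inner_add_right, inner_smul_left, inner_smul_right,
        inner_neg_right, Complex.conj_ofReal]
      ring
    rw [h1]
    simpa using ((Complex.ofRealCLM.hasDerivAt (x := (0 : ℝ))).mul_const
      (inner ℂ p (fieldCre (h j)) - inner ℂ (fieldAnn (h j)) q)).const_add (fieldSymbol (h j) f g)
  have hF1 := HasDerivAt.fun_sum (u := Finset.univ) fun j _ =>
    (hω j).mul (hasDerivAt_matrixElement (F j) f g p (-q) 0)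
  have heq : (fun t : ℝ => matrixElement M (f + (t : ℂ) • p) (g + (t : ℂ) • (-q))) =
      fun t : ℝ => ∑ j, fieldSymbol (h j) (f + (t : ℂ) • p) (g + (t : ℂ) • (-q)) *
        matrixElement (F j) (f + (t : ℂ) • p) (g + (t : ℂ) • (-q)) := funext fun t => hM _ _
  rw [heq] at hM1
  have hd := hM1.unique hF1
  have hneg : ∀ B : BoundedOps 𝔥, inner ℂ (expVec f) (B (expDeriv g (-q))) =
      -inner ℂ (expVec f) (B (expDeriv g q)) := by
    intro B
    have : expDeriv g (-q) = -expDeriv g q := map_neg _ _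
    rw [this, map_neg, inner_neg_right]
  simp only [Complex.ofReal_zero, zero_smul, add_zero, hneg, ← sub_eq_add_neg] at hd
  rw [commForm_eq, hd, hM, Finset.mul_sum, ← Finset.sum_add_distrib]
  refine Finset.sum_congr rfl fun j _ => ?_
  rw [commForm_eq]
  ring

/-- The canonical commutation relation: the scalar (i/2)[Q(k₁)-P(k₂), P(h₁)+Q(h₂)]. -/
theorem doubleInner_doubleConj (k h : DoubleSpace 𝔥) :
    Complex.I / 2 * (inner ℂ (frechetAnn k) (fieldCre h) - inner ℂ (fieldAnn h) (frechetCre k)) =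
      doubleInner (doubleConj k) h := by
  simp only [frechetAnn, fieldCre, fieldAnn, frechetCre, doubleInner, doubleConj, inner_add_left,
    inner_add_right, inner_smul_left, inner_smul_right, map_neg, Complex.conj_I]
  rw [inner_conj_left h.1 k.1, inner_conj_left h.1 k.2, inner_conj_left h.2 k.1,
    inner_conj_left h.2 k.2]
  linear_combination (-inner ℂ k.1.conj h.1 - inner ℂ k.2.conj h.2) * Complex.I_sq

/-- The matrix elements of a divergence in terms of creation operators acting first. -/
theorem fieldSymbol_mul_eq_right (k : DoubleSpace 𝔥) (B : BoundedOps 𝔥)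
    (f g : Complexification 𝔥) :
    fieldSymbol k f g * matrixElement B f g =
      inner ℂ (expVec f) (B ((fieldOperator k).op (expSpanVec g))) +
        commForm 0 (fieldCre k) B f g := by
  have h0 : expDeriv f (0 : Complexification 𝔥) = 0 := map_zero _
  rw [fieldOperator_op, commForm_eq, fieldSymbol, h0]
  simp only [map_add, map_smul, inner_add_right, inner_smul_right, inner_zero_left, matrixElement]
  ring

theorem fieldSymbol_mul_eq_left (k : DoubleSpace 𝔥) (B : BoundedOps 𝔥)
    (f g : Complexification 𝔥) :
    fieldSymbol k f g * matrixElement B f g =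
      inner ℂ ((fieldOperator k).adj (expSpanVec f)) (B (expVec g)) -
        commForm (fieldAnn k) 0 B f g := by
  have h0 : expDeriv g (0 : Complexification 𝔥) = 0 := map_zero _
  rw [fieldOperator_adj, commForm_eq, fieldSymbol, h0]
  simp only [map_zero, inner_add_left, inner_smul_left, inner_zero_right, matrixElement,
    inner_conj_symm]
  ring

/-- Subtracting (i/2)(Q(k₁)-P(k₂)) from half of P(k₁)+Q(k₂) leaves exactly its creation part; adding
it leaves the annihilation part. -/
theorem commForm_creation (k : DoubleSpace 𝔥) (B : BoundedOps 𝔥) (f g : Complexification 𝔥) :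
    commForm 0 (fieldCre k) B f g =
      1 / 2 * commForm (fieldAnn k) (fieldCre k) B f g - frechetForm k B f g := by
  have h0 : expDeriv f (0 : Complexification 𝔥) = 0 := map_zero _
  rw [frechetForm_eq, commForm_eq, commForm_eq, commForm_eq, fieldAnn_eq, fieldCre_eq, h0]
  simp only [expDeriv_smul, inner_smul_left, inner_smul_right, map_smul, map_neg, Complex.conj_I,
    inner_zero_left]
  ring

theorem commForm_annihilation (k : DoubleSpace 𝔥) (B : BoundedOps 𝔥) (f g : Complexification 𝔥) :
    commForm (fieldAnn k) 0 B f g =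
      1 / 2 * commForm (fieldAnn k) (fieldCre k) B f g + frechetForm k B f g := by
  have h0 : expDeriv g (0 : Complexification 𝔥) = 0 := map_zero _
  rw [frechetForm_eq, commForm_eq, commForm_eq, commForm_eq, fieldAnn_eq, fieldCre_eq, h0]
  simp only [expDeriv_smul, inner_smul_left, inner_smul_right, map_smul, map_neg, Complex.conj_I,
    inner_zero_right, map_zero]
  ring

theorem definesBoundedOperator_fieldCommutator {G : BoundedOps 𝔥} (hG : G ∈ smoothFunctionals 𝔥)
    (k : DoubleSpace 𝔥) : DefinesBoundedOperator (commutatorForm (fieldOperator k) G) :=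
  let ⟨_, _, h⟩ := exists_hasCommutator hG (fieldAnn k) (fieldCre k)
  h.fieldCommutator_eq.1

theorem matrixElement_fieldCommutator {G : BoundedOps 𝔥} (hG : G ∈ smoothFunctionals 𝔥)
    (k : DoubleSpace 𝔥) (f g : Complexification 𝔥) :
    matrixElement (fieldCommutator k G) f g = commForm (fieldAnn k) (fieldCre k) G f g := by
  rw [← commutatorForm_fieldOperator]
  exact matrixElement_boundedOperator (definesBoundedOperator_fieldCommutator hG k) f g

theorem hasCommutator_creation {G : BoundedOps 𝔥} (hG : G ∈ smoothFunctionals 𝔥)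
    (k : DoubleSpace 𝔥) : HasCommutator 0 (fieldCre k) G
      ((1 / 2 : ℂ) • fieldCommutator k G - frechet k G) := fun f g => by
  rw [sub_eq_add_neg, ← neg_one_smul ℂ (frechet k G), matrixElement_add, matrixElement_smul,
    matrixElement_smul, matrixElement_fieldCommutator hG,
    matrixElement_frechet (inFrechetDomain hG k), commForm_creation]
  ring

theorem hasCommutator_annihilation {G : BoundedOps 𝔥} (hG : G ∈ smoothFunctionals 𝔥)
    (k : DoubleSpace 𝔥) : HasCommutator (fieldAnn k) 0 G
      ((1 / 2 : ℂ) • fieldCommutator k G + frechet k G) := fun f g => by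
  rw [matrixElement_add, matrixElement_smul, matrixElement_fieldCommutator hG,
    matrixElement_frechet (inFrechetDomain hG k), commForm_annihilation]

/-- With δ(u) = Σ(F_jT_j + [a⁺_j,F_j]) all unbounded operators stand on the right, so G may be
applied from the left. Comparison with Σ(GF_jT_j + [a⁺_j,GF_j]) leaves the terms [a⁺_j,G]F_j. -/
theorem matrixElement_left_product {n : ℕ} {F : Fin n → BoundedOps 𝔥}
    (hF : ∀ j, F j ∈ smoothFunctionals 𝔥) {h : Fin n → DoubleSpace 𝔥} {M G : BoundedOps 𝔥}
    (hM : ∀ f g, matrixElement M f g = divergenceFunctional f g (elementary F h))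
    (hG : G ∈ smoothFunctionals 𝔥) (f g : Complexification 𝔥) :
    matrixElement (G * M - ∑ j, frechet (h j) G * F j +
        (1 / 2 : ℂ) • ∑ j, fieldCommutator (h j) G * F j) f g =
      divergenceFunctional f g (elementary (fun j => G * F j) h) := by
  choose A _ hA using fun j => exists_hasCommutator (hF j) 0 (fieldCre (h j))
  have hvec : M (expVec g) = ∑ j, (F j ((fieldOperator (h j)).op (expSpanVec g)) +
      A j (expVec g)) := by
    refine eq_of_inner_expVec fun k => ?_
    refine (hM k g).trans ?_
    rw [divergenceFunctional_elementary, inner_sum]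
    refine Finset.sum_congr rfl fun j _ => ?_
    rw [fieldSymbol_mul_eq_right, ← hA j k g, inner_add_right]
    rfl
  have hsum : G * M - ∑ j, frechet (h j) G * F j +
      (1 / 2 : ℂ) • ∑ j, fieldCommutator (h j) G * F j = G * M +
      ∑ j, ((1 / 2 : ℂ) • fieldCommutator (h j) G - frechet (h j) G) * F j := by
    simp only [sub_mul, Finset.sum_sub_distrib, smul_mul_assoc, Finset.smul_sum]
    abel
  rw [hsum, divergenceFunctional_elementary, matrixElement_add]
  have h1 : matrixElement (G * M) f g = ∑ j, (inner ℂ (expVec f)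
      ((G * F j) ((fieldOperator (h j)).op (expSpanVec g))) + matrixElement (G * A j) f g) := by
    change inner ℂ (expVec f) (G (M (expVec g))) = _
    rw [hvec, map_sum, inner_sum]
    refine Finset.sum_congr rfl fun j _ => ?_
    rw [map_add, inner_add_right]
    rfl
  have h2 : matrixElement (∑ j, ((1 / 2 : ℂ) • fieldCommutator (h j) G - frechet (h j) G) * F j)
      f g = ∑ j, matrixElement (((1 / 2 : ℂ) • fieldCommutator (h j) G - frechet (h j) G) * F j)
        f g := by
    rw [matrixElement, sum_apply, inner_sum]
    rfl
  rw [h1, h2, ← Finset.sum_add_distrib]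
  refine Finset.sum_congr rfl fun j _ => ?_
  rw [fieldSymbol_mul_eq_right,
    ← (hasCommutator_creation hG (h j)).leibniz hG (hF j) (hA j) f g, matrixElement_add]
  ring

/-- Mirror image, with δ(u) = Σ(T_jF_j - [a_j,F_j]) and the unbounded operators on the left; what is
left over is -F_j[a_j,G]. -/
theorem matrixElement_right_product {n : ℕ} {F : Fin n → BoundedOps 𝔥}
    (hF : ∀ j, F j ∈ smoothFunctionals 𝔥) {h : Fin n → DoubleSpace 𝔥} {M G : BoundedOps 𝔥}
    (hM : ∀ f g, matrixElement M f g = divergenceFunctional f g (elementary F h))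
    (hG : G ∈ smoothFunctionals 𝔥) (f g : Complexification 𝔥) :
    matrixElement (M * G - ∑ j, F j * frechet (h j) G +
        (1 / 2 : ℂ) • ∑ j, F j * (-fieldCommutator (h j) G)) f g =
      divergenceFunctional f g (elementary (fun j => F j * G) h) := by
  choose A _ hA using fun j => exists_hasCommutator (hF j) (fieldAnn (h j)) 0
  -- As an equality of bounded functionals this extends by density from exponential vectors to all
  -- vectors, in particular to G E(g).
  have hvec : (innerSL ℂ (expVec f)) ∘L M = ∑ j,
      ((innerSL ℂ ((fieldOperator (h j)).adj (expSpanVec f))) ∘L F j -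
        (innerSL ℂ (expVec f)) ∘L A j) := by
    refine ContinuousLinearMap.ext_on (s := Set.range expVec) dense_expSpan ?_
    rintro _ ⟨k, rfl⟩
    refine (hM f k).trans ?_
    rw [divergenceFunctional_elementary, sum_apply]
    refine Finset.sum_congr rfl fun j _ => ?_
    rw [fieldSymbol_mul_eq_left, ← hA j f k]
    rfl
  have hsum : M * G - ∑ j, F j * frechet (h j) G +
      (1 / 2 : ℂ) • ∑ j, F j * (-fieldCommutator (h j) G) = M * G +
      (-1 : ℂ) • ∑ j, F j * ((1 / 2 : ℂ) • fieldCommutator (h j) G + frechet (h j) G) := by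
    simp only [mul_add, Finset.sum_add_distrib, mul_smul_comm, mul_neg, Finset.smul_sum, smul_add,
      smul_neg, Finset.sum_neg_distrib, neg_smul, one_smul]
    abel
  rw [hsum, divergenceFunctional_elementary, matrixElement_add, matrixElement_smul]
  have h1 : matrixElement (M * G) f g = ∑ j, (inner ℂ ((fieldOperator (h j)).adj (expSpanVec f))
      ((F j * G) (expVec g)) - matrixElement (A j * G) f g) := by
    have := congrArg (fun L => L (G (expVec g))) hvec
    refine Eq.trans this ?_
    rw [sum_apply]
    rfl
  have h2 : matrixElement (∑ j, F j * ((1 / 2 : ℂ) • fieldCommutator (h j) G + frechet (h j) G))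
      f g = ∑ j, matrixElement (F j * ((1 / 2 : ℂ) • fieldCommutator (h j) G + frechet (h j) G))
        f g := by
    rw [matrixElement, sum_apply, inner_sum]
    rfl
  rw [h1, h2, Finset.mul_sum, ← Finset.sum_add_distrib]
  refine Finset.sum_congr rfl fun j _ => ?_
  rw [fieldSymbol_mul_eq_left,
    ← (hA j).leibniz (hF j) hG (hasCommutator_annihilation hG (h j)) f g, matrixElement_add]
  ring

variable [CompleteSpace 𝔥]

/-- The Heisenberg commutation relation between `D_k` and `δ` for matrix elements. -/
theorem frechetForm_divergence {n : ℕ} {F : Fin n → BoundedOps 𝔥}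
    (hF : ∀ j, F j ∈ smoothFunctionals 𝔥) {h : Fin n → DoubleSpace 𝔥} {M : BoundedOps 𝔥}
    (hM : ∀ f g, matrixElement M f g = divergenceFunctional f g (elementary F h))
    (k : DoubleSpace 𝔥) (f g : Complexification 𝔥) :
    frechetForm k M f g = matrixElement (constInner k (elementary F h)) f g +
      divergenceFunctional f g (elementary (fun j => frechet k (F j)) h) := by
  rw [frechetForm_eq, commForm_of_matrixElement_eq (F := F) (h := h)
    (fun f g => by rw [hM, divergenceFunctional_elementary]), constInner_elementary,
    divergenceFunctional_elementary, matrixElement, sum_apply, inner_sum,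
    Finset.mul_sum, ← Finset.sum_add_distrib]
  refine Finset.sum_congr rfl fun j _ => ?_
  rw [matrixElement_frechet (inFrechetDomain (hF j) k), frechetForm_eq, ← doubleInner_doubleConj]
  change _ = matrixElement (_ • F j) f g + _
  rw [matrixElement_smul]
  ring

end Divergence

end QuantumMalliavin

end

/-! ### The proposition, assembled from the kernel identities. -/

theorem mainTheorem11 {𝔥 : Type*} [NormedAddCommGroup 𝔥] [InnerProductSpace ℝ 𝔥] [CompleteSpace 𝔥]
    [TopologicalSpace.SeparableSpace 𝔥]
    (u : QuantumMalliavin.VectorFields 𝔥) (hu : u ∈ QuantumMalliavin.divergenceDomain 𝔥)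
    {n : ℕ} (F : Fin n → QuantumMalliavin.BoundedOps 𝔥)
    (hF : ∀ j, F j ∈ QuantumMalliavin.smoothFunctionals 𝔥)
    (h : Fin n → QuantumMalliavin.DoubleSpace 𝔥) (hrep : u = QuantumMalliavin.elementary F h) :
    -- the Heisenberg commutation relation
    (∀ k : QuantumMalliavin.DoubleSpace 𝔥,
      (∀ j, QuantumMalliavin.InFrechetDomain k (F j)) ∧
      QuantumMalliavin.elementary (fun j => QuantumMalliavin.frechet k (F j)) h ∈
        QuantumMalliavin.smoothFields 𝔥 ∧
      (∀ f g : QuantumMalliavin.Complexification 𝔥,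
        QuantumMalliavin.frechetForm k (QuantumMalliavin.divergence u) f g =
          QuantumMalliavin.matrixElement (QuantumMalliavin.constInner k u) f g +
          QuantumMalliavin.divergenceForm (fun j => QuantumMalliavin.frechet k (F j)) h f g) ∧
      (QuantumMalliavin.InFrechetDomain k (QuantumMalliavin.divergence u) ↔
        QuantumMalliavin.elementary (fun j => QuantumMalliavin.frechet k (F j)) h ∈
          QuantumMalliavin.divergenceDomain 𝔥) ∧
      (QuantumMalliavin.InFrechetDomain k (QuantumMalliavin.divergence u) →
        QuantumMalliavin.frechet k (QuantumMalliavin.divergence u) =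
          QuantumMalliavin.constInner k u +
          QuantumMalliavin.divergence
            (QuantumMalliavin.elementary (fun j => QuantumMalliavin.frechet k (F j)) h))) ∧
    -- the product rules
    (∀ G ∈ QuantumMalliavin.smoothFunctionals 𝔥,
      (∀ j, QuantumMalliavin.DefinesBoundedOperator
        (QuantumMalliavin.commutatorForm (QuantumMalliavin.fieldOperator (h j)) G)) ∧
      QuantumMalliavin.leftAction G u ∈ QuantumMalliavin.divergenceDomain 𝔥 ∧
      QuantumMalliavin.divergence (QuantumMalliavin.leftAction G u) =
        G * QuantumMalliavin.divergence u - QuantumMalliavin.leftGradient u G +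
        (1 / 2 : ℂ) • ∑ j, QuantumMalliavin.fieldCommutator (h j) G * F j ∧
      QuantumMalliavin.rightAction G u ∈ QuantumMalliavin.divergenceDomain 𝔥 ∧
      QuantumMalliavin.divergence (QuantumMalliavin.rightAction G u) =
        QuantumMalliavin.divergence u * G - QuantumMalliavin.rightGradient u G +
        (1 / 2 : ℂ) • ∑ j, F j * (-QuantumMalliavin.fieldCommutator (h j) G)) ∧
    -- the corrections vanish if the operator commutes with all `P(h₁) + Q(h₂)`
    (∀ G : QuantumMalliavin.BoundedOps 𝔥,
      (∀ j, ∀ f g : QuantumMalliavin.Complexification 𝔥,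
        QuantumMalliavin.commutatorForm (QuantumMalliavin.fieldOperator (h j)) G f g = 0) →
      (1 / 2 : ℂ) • ∑ j, QuantumMalliavin.fieldCommutator (h j) G * F j = 0 ∧
      (1 / 2 : ℂ) • ∑ j, F j * (-QuantumMalliavin.fieldCommutator (h j) G) = 0 ∧
      (G ∈ QuantumMalliavin.smoothFunctionals 𝔥 →
        QuantumMalliavin.divergence (QuantumMalliavin.leftAction G u) =
          G * QuantumMalliavin.divergence u - QuantumMalliavin.leftGradient u G ∧
        QuantumMalliavin.divergence (QuantumMalliavin.rightAction G u) =
          QuantumMalliavin.divergence u * G - QuantumMalliavin.rightGradient u G)) := by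
  have hdom := hu
  rw [hrep, QuantumMalliavin.mem_divergenceDomain_iff hF] at hdom
  obtain ⟨M, hM⟩ := hdom
  have hdiv : QuantumMalliavin.divergence u = M := by
    rw [hrep]
    exact QuantumMalliavin.divergence_elementary_eq hF h hM
  have hprod : ∀ G ∈ QuantumMalliavin.smoothFunctionals 𝔥,
      QuantumMalliavin.leftAction G u ∈ QuantumMalliavin.divergenceDomain 𝔥 ∧
      QuantumMalliavin.divergence (QuantumMalliavin.leftAction G u) =
        G * M - QuantumMalliavin.leftGradient u G +
        (1 / 2 : ℂ) • ∑ j, QuantumMalliavin.fieldCommutator (h j) G * F j ∧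
      QuantumMalliavin.rightAction G u ∈ QuantumMalliavin.divergenceDomain 𝔥 ∧
      QuantumMalliavin.divergence (QuantumMalliavin.rightAction G u) =
        M * G - QuantumMalliavin.rightGradient u G +
        (1 / 2 : ℂ) • ∑ j, F j * (-QuantumMalliavin.fieldCommutator (h j) G) := by
    intro G hG
    have hGF : ∀ j, G * F j ∈ QuantumMalliavin.smoothFunctionals 𝔥 := fun j => mul_mem hG (hF j)
    have hFG : ∀ j, F j * G ∈ QuantumMalliavin.smoothFunctionals 𝔥 := fun j => mul_mem (hF j) hG
    have hl := QuantumMalliavin.matrixElement_left_product hF hM hG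
    have hr := QuantumMalliavin.matrixElement_right_product hF hM hG
    rw [hrep, QuantumMalliavin.leftAction_elementary, QuantumMalliavin.rightAction_elementary,
      QuantumMalliavin.leftGradient_elementary F h hG,
      QuantumMalliavin.rightGradient_elementary F h hG,
      QuantumMalliavin.mem_divergenceDomain_iff hGF, QuantumMalliavin.mem_divergenceDomain_iff hFG]
    exact ⟨⟨_, hl⟩, QuantumMalliavin.divergence_elementary_eq hGF h hl, ⟨_, hr⟩,
      QuantumMalliavin.divergence_elementary_eq hFG h hr⟩
  rw [hdiv]
  refine ⟨fun k => ?_, fun G hG => ⟨fun j =>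
    QuantumMalliavin.definesBoundedOperator_fieldCommutator hG (h j), hprod G hG⟩, fun G hG => ?_⟩
  · have hDF : ∀ j, QuantumMalliavin.frechet k (F j) ∈ QuantumMalliavin.smoothFunctionals 𝔥 :=
      fun j => QuantumMalliavin.frechet_mem (hF j) k
    have hrel := QuantumMalliavin.frechetForm_divergence hF hM k
    -- The kernels of D_kδ(u) and δ(D_ku) differ by that of the bounded operator ⟨k̄,u⟩, so one
    -- defines a bounded operator exactly when the other does.
    have hbdd : ∀ N : QuantumMalliavin.BoundedOps 𝔥,
        (∀ f g, QuantumMalliavin.matrixElement N f g = QuantumMalliavin.frechetForm k M f g) →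
        ∀ f g, QuantumMalliavin.matrixElement
          (N + (-1 : ℂ) • QuantumMalliavin.constInner k (QuantumMalliavin.elementary F h)) f g =
          QuantumMalliavin.divergenceFunctional f g
            (QuantumMalliavin.elementary (fun j => QuantumMalliavin.frechet k (F j)) h) := by
      intro N hN f g
      rw [QuantumMalliavin.matrixElement_add, QuantumMalliavin.matrixElement_smul, hN, hrel]
      ring
    refine ⟨fun j => QuantumMalliavin.inFrechetDomain (hF j) k, ⟨n, _, h, hDF, rfl⟩,
      fun f g => ?_, ?_, ?_⟩
    · rw [hrel, hrep, QuantumMalliavin.divergenceForm_eq hDF]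
    · rw [QuantumMalliavin.mem_divergenceDomain_iff hDF]
      constructor
      · rintro ⟨N, hN⟩
        exact ⟨_, hbdd N hN⟩
      · rintro ⟨N, hN⟩
        exact ⟨QuantumMalliavin.constInner k (QuantumMalliavin.elementary F h) + N, fun f g => by
          rw [QuantumMalliavin.matrixElement_add, hN, hrel]⟩
    · intro hN
      rw [QuantumMalliavin.divergence_elementary_eq hDF h
        (hbdd _ (QuantumMalliavin.matrixElement_frechet hN)), hrep, neg_one_smul]
      abel
  -- A vanishing commutator form is the kernel of the zero operator, so this works for G outside 𝓢
  -- too.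
  · have h0 : ∀ j, QuantumMalliavin.fieldCommutator (h j) G = 0 := fun j =>
      QuantumMalliavin.boundedOperator_eq fun f g => by
        rw [hG j f g]
        exact inner_zero_right _
    have h1 : (1 / 2 : ℂ) • ∑ j, QuantumMalliavin.fieldCommutator (h j) G * F j = 0 := by
      simp [h0]
    have h2 : (1 / 2 : ℂ) • ∑ j, F j * (-QuantumMalliavin.fieldCommutator (h j) G) = 0 := by
      simp [h0]
    refine ⟨h1, h2, fun hGs => ?_⟩
    obtain ⟨_, hl, _, hr⟩ := hprod G hGs
    rw [hl, hr, h1, h2, add_zero, add_zero]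
    exact ⟨rfl, rfl⟩
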